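/- **Setting.** There are $n$ parties $p_0,\dots,p_{n-1}$ with authenticated point-to-point channels, and an integer $t\ge 0$ with $3t<n$. The network is partially synchronous: there are a known $\Delta>0$ and an unknown time GST such that a message sent at time $\tau$ is received by time $\max(\tau,\mathrm{GST})+\Delta$. An adaptive adversary schedules all events subject to this, and corrupts at most $t$ parties at times of its choice; $f\le t$ is the number of parties corrupted in the execution, and the other parties are *honest*. Corrupted parties may send anything, but (ideal signatures) the partial signature $\mathrm{tsign}_p(m)$ of a party $p$ that is not corrupted is available to the adversary only after $p$ has sent it. A $k$-threshold signature on $m$ combines the partial signatures on $m$ of exactly $k$ parties. Each party goes through views $0,1,2,\dots$, starting at time $0$; before GST the pace is arbitrary and may differ between parties; every view that starts after GST starts at the same time for all parties and lasts at least $9\Delta$. The leader of view $k$ is $p_{k \bmod n}$. Local computation takes no time, and there are finitely many events in bounded time. **Protocol ByzantineAgreementGST.** Party $p$ has an input $v_{in}\in\{0,1\}$ and variables $key$, $lock$, $commit$, initially $\bot$, each of which holds a value $v$, a view $w$ and an $(n-t)$-threshold signature on $(\mathrm{KEY},v,w)$, $(\mathrm{LOCK},v,w)$ or $(\mathrm{COMMIT},v,w)$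 respectively. Each message carries the view in which it was sent. Received messages of the current view are kept until the end of the view; messages of other views, and invalid ones, are ignored, with one exception: whenever a party with $commit=\bot$ receives a message that carries a valid commit (a $\mathrm{SendCommit}$, or a $\mathrm{Suggest}$ of a commit), whatever its view, it stores this commit and decides its value. In view $k$ with leader $L$: *Leader* (only if it has $commit=\bot$ when it enters the view). (1) Send $\mathrm{RequestSuggestion}$ to all and wait for valid $\mathrm{Suggest}$ messages from $n-t$ parties. If one of them contains a commit, send it to all by $\mathrm{SendCommit}$ and stop. Otherwise, if some contain keys, let $v$ be the value of a key with the highest view and propose $v$ with that key. Otherwise let $v$ be the most common suggested input, and propose $v$ with the $(t+1)$-threshold signature combined from $t+1$ of the suggested signatures on $(\mathrm{INPUT},v)$. (2) Send $\mathrm{ProposeKey}$ with this proposal to all, wait for $n-t$ signatures on $(\mathrm{KEY},v,k)$, and combine them to a key proof. (3) Send $\mathrm{ProposeLock}$ with $v$ and the key proof to all, wait for $n-t$ signatures on $(\mathrm{LOCK},v,k)$, and combine them to a lock proof. (4) Send $\mathrm{ProposeCommit}$ with $v$ and the lock proof to all, wait for $n-t$ signatures on $(\mathrm{COMMIT},v,k)$,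 combine them to a commit, and send it to all by $\mathrm{SendCommit}$. *Every party* (the leader too), answering only to $L$. (1) Wait for $\mathrm{RequestSuggestion}$. If $commit\ne\bot$, then $\mathrm{Suggest}$ the commit, unless a commit was suggested to $L$ before in this execution, and do no more in this view; else if $key\neq\bot$, $\mathrm{Suggest}$ the key; else $\mathrm{Suggest}$ $v_{in}$ with a signature on $(\mathrm{INPUT},v_{in})$. (2) Wait for a valid $\mathrm{ProposeKey}$ for a value $v$. If $lock\ne\bot$, and the proposal is not a key or is a key whose view is less than the view of $lock$, do no more in this view; else send a signature on $(\mathrm{KEY},v,k)$. (3) Wait for $\mathrm{ProposeLock}$ with a valid key proof of view $k$ for a value $v$, set $key$ to it, and send a signature on $(\mathrm{LOCK},v,k)$. (4) Wait for $\mathrm{ProposeCommit}$ with a valid lock proof of view $k$ for a value $v$, set $lock$ to it, and send a signature on $(\mathrm{COMMIT},v,k)$. **Theorem.** There is an absolute constant $C$ such that for all $n,t$ with $3t<n$, every execution of ByzantineAgreementGST as above satisfies * *Agreement*: no two honest parties decide different values; * *Strong Unanimity*: if all honest parties have the same input $v$, no honest party decides a value other than $v$ (hence, by Termination, they all decide $v$);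 * *Termination*: every honest party eventually decides; and the total number of messages that parties send, while not corrupted, from time GST on is at most $C\,(n+n f)$. -/

import Mathlib

namespace GSTAgreement

/-! ### Values and idealised signatures

Signatures are symbolic terms: a partial signature of `p` on `m` is the term `tsign p m`, and a
threshold signature is the term combined from the partial signatures of a set of parties. What the
adversary may use is restricted below (`Config.CanForge`). -/

/-- The binary values that are proposed and decided. -/
abbrev Value := Bool

/-- The strings that parties sign. Key, lock and commit shares are bound to their view. -/
inductive Content where
  | input (v : Value)
  | key (v : Value) (view : ℕ)
  | lock (v : Value) (view : ℕ)
  | commit (v : Value) (view : ℕ)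
  deriving DecidableEq

/-- The partial signature of `signer` on `content`. -/
structure PartialSig (n : ℕ) where
  signer : Fin n
  content : Content
  deriving DecidableEq

/-- The combination of the partial signatures on `content` of the parties in `signers`. -/
structure ThresholdSig (n : ℕ) where
  content : Content
  signers : Finset (Fin n)
  deriving DecidableEq

def tsign {n : ℕ} (p : Fin n) (m : Content) : PartialSig n := ⟨p, m⟩

def tcombine {n : ℕ} (m : Content) (P : Finset (Fin n)) : ThresholdSig n := ⟨m, P⟩

/-- Verification with threshold `k`: the signature combines `k` partial signatures on `m`. -/
def tverify {n : ℕ} (k : ℕ) (m : Content) (σ : ThresholdSig n) : Bool :=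
  decide (σ.content = m ∧ σ.signers.card = k)

/-- A key, lock or commit: a value, a view number and a proof. -/
structure Cert (n : ℕ) where
  value : Value
  view : ℕ
  proof : ThresholdSig n
  deriving DecidableEq

/-- The certificate is a valid key. -/
def Cert.isKey {n : ℕ} (t : ℕ) (c : Cert n) : Bool :=
  tverify (n - t) (.key c.value c.view) c.proof

/-- The certificate is a valid commit. -/
def Cert.isCommit {n : ℕ} (t : ℕ) (c : Cert n) : Bool :=
  tverify (n - t) (.commit c.value c.view) c.proof

/-! ### Messages -/

/-- The argument of a `Suggest` message. -/
inductive Suggestion (n : ℕ) where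
  | commit (c : Cert n)
  | key (c : Cert n)
  | input (v : Value) (ρ : PartialSig n)
  deriving DecidableEq

/-- The justification in a `ProposeKey` message: an earlier key, or a combination of `t + 1`
partial signatures on an input value. -/
inductive Proposal (n : ℕ) where
  | key (c : Cert n)
  | combine (σ : ThresholdSig n)
  deriving DecidableEq

inductive Msg (n : ℕ) where
  | requestSuggestion
  | suggest (s : Suggestion n)
  | proposeKey (v : Value) (pr : Proposal n)
  | checkedKey (ρ : PartialSig n)
  | proposeLock (v : Value) (σ : ThresholdSig n)
  | checkedLock (ρ : PartialSig n)
  | proposeCommit (v : Value) (σ : ThresholdSig n)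
  | checkedCommit (ρ : PartialSig n)
  | sendCommit (c : Cert n)
  deriving DecidableEq

/-- A message in transit, with its sender, its recipient and the view in which it was sent. -/
structure Packet (n : ℕ) where
  src : Fin n
  dst : Fin n
  view : ℕ
  msg : Msg n
  deriving DecidableEq

def Suggestion.valid {n : ℕ} (t : ℕ) (src : Fin n) : Suggestion n → Bool
  | .commit c => c.isCommit t
  | .key c => c.isKey t
  | .input v ρ => decide (ρ = tsign src (.input v))

def Proposal.valid {n : ℕ} (t : ℕ) (v : Value) : Proposal n → Bool
  | .key c => decide (c.value = v) && c.isKey t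
  | .combine σ => tverify (t + 1) (.input v) σ

/-- The commit carried by a message, if there is one. -/
def Msg.carriedCommit {n : ℕ} : Msg n → Option (Cert n)
  | .sendCommit c => some c
  | .suggest (.commit c) => some c
  | _ => none

/-- The partial signature that a message contains in the clear, if there is one. -/
def Msg.partialSig {n : ℕ} : Msg n → Option (PartialSig n)
  | .suggest (.input _ ρ) => some ρ
  | .checkedKey ρ => some ρ
  | .checkedLock ρ => some ρ
  | .checkedCommit ρ => some ρ
  | _ => none

/-- The threshold signature that a message contains, if there is one. -/
def Msg.thresholdSig {n : ℕ} : Msg n → Option (ThresholdSig n)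
  | .suggest (.commit c) => some c.proof
  | .suggest (.key c) => some c.proof
  | .proposeKey _ (.key c) => some c.proof
  | .proposeKey _ (.combine σ) => some σ
  | .proposeLock _ σ => some σ
  | .proposeCommit _ σ => some σ
  | .sendCommit c => some c.proof
  | _ => none

/-! ### Local states -/

/-- What `ViewPartyProtocol` is waiting for (`rest`: it waits for the rest of the view). -/
inductive PartyPhase where
  | request | proposeKey | proposeLock | proposeCommit | rest
  deriving DecidableEq

/-- What `ViewLeaderProtocol` is waiting for, together with the proposed value
(`off`: it is not run, or has ended). -/
inductive LeaderPhase where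
  | off | suggest
  | checkedKey (v : Value) | checkedLock (v : Value) | checkedCommit (v : Value)
  deriving DecidableEq

/-- The local state of a party. `inbox` holds the messages of the current view received so far, in
order of arrival; `commitSentTo` holds the parties to which a commit has been suggested. -/
structure State (n : ℕ) where
  view : Option ℕ
  key : Option (Cert n)
  lock : Option (Cert n)
  commit : Option (Cert n)
  decision : Option Value
  commitSentTo : Finset (Fin n)
  inbox : List (Fin n × Msg n)
  partyPhase : PartyPhase
  leaderPhase : LeaderPhase

/-- The state before view `0` is entered. -/
def State.start (n : ℕ) : State n where
  view := none
  key := none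
  lock := none
  commit := none
  decision := none
  commitSentTo := ∅
  inbox := []
  partyPhase := .rest
  leaderPhase := .off

/-- The round-robin leader of view `k`. -/
def leader (n : ℕ) [NeZero n] (k : ℕ) : Fin n := Fin.ofNat n k

/-- The messages by which `p` sends `m` to every party in view `k`. -/
def broadcast {n : ℕ} (p : Fin n) (k : ℕ) (m : Msg n) : List (Packet n) :=
  (List.finRange n).map fun q => ⟨p, q, k, m⟩

/-! ### The protocol -/

section Protocol

variable {n : ℕ} [NeZero n]

/-- Party `p` moves to view `k`, unless it is already there. The leader of the view starts
`ViewLeaderProtocol` if it has no commit. -/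
def enterView (p : Fin n) (k : ℕ) (s : State n) : State n × List (Packet n) :=
  if s.view = some k then (s, []) else
    let s' := { s with view := some k, inbox := [], partyPhase := .request, leaderPhase := .off }
    if p = leader n k ∧ s.commit.isNone then
      ({ s' with leaderPhase := .suggest }, broadcast p k .requestSuggestion)
    else (s', [])

/-- A valid commit, whatever message carries it and in whatever view it was sent, is adopted and
its value decided by a party that has no commit yet. -/
def acceptCommit (t : ℕ) (m : Msg n) (s : State n) : State n :=
  match m.carriedCommit with
  | some c =>
      if c.isCommit t ∧ s.commit.isNone then
        { s with commit := some c, decision := some c.value }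
      else s
  | none => s

/-- A valid `ProposeKey`. -/
def validProposeKey (t : ℕ) : Msg n → Option (Value × Proposal n)
  | .proposeKey v pr => if pr.valid t v then some (v, pr) else none
  | _ => none

/-- A `ProposeLock` valid in view `k`: it carries a key proof of that view. -/
def validProposeLock (t k : ℕ) : Msg n → Option (Value × ThresholdSig n)
  | .proposeLock v σ => if tverify (n - t) (.key v k) σ then some (v, σ) else none
  | _ => none

/-- A `ProposeCommit` valid in view `k`: it carries a lock proof of that view. -/
def validProposeCommit (t k : ℕ) : Msg n → Option (Value × ThresholdSig n)
  | .proposeCommit v σ => if tverify (n - t) (.lock v k) σ then some (v, σ) else none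
  | _ => none

/-- A valid `Suggest` from `src`. -/
def validSuggest (t : ℕ) (src : Fin n) : Msg n → Option (Suggestion n)
  | .suggest x => if x.valid t src then some x else none
  | _ => none

/-- The first message from `src` in the inbox that `check` accepts. -/
def firstFrom {α : Type} (inbox : List (Fin n × Msg n)) (src : Fin n) (check : Msg n → Option α) :
    Option α :=
  inbox.findSome? fun e => if e.1 = src then check e.2 else none

/-- A proposal is compatible with the lock if there is no lock, or if it is a key whose view is not
strictly less than the view of the lock. -/
def lockAllows : Option (Cert n) → Proposal n → Bool
  | none, _ => true
  | some _, .combine _ => false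
  | some l, .key c => decide (l.view ≤ c.view)

/-- One step of `ViewPartyProtocol` of party `p` with input `v_in` in view `k`: if the awaited
message has arrived, it is handled; otherwise nothing happens. -/
def partyStep (t : ℕ) (p : Fin n) (v_in : Value) (k : ℕ) (s : State n) :
    State n × List (Packet n) :=
  let L := leader n k
  let reply : Msg n → List (Packet n) := fun m => [⟨p, L, k, m⟩]
  match s.partyPhase with
  | .request =>
      if (L, Msg.requestSuggestion) ∈ s.inbox then
        match s.commit, s.key with
        | some c, _ =>
            if L ∈ s.commitSentTo then ({ s with partyPhase := .rest }, [])
            else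
              ({ s with partyPhase := .rest, commitSentTo := insert L s.commitSentTo },
                reply (.suggest (.commit c)))
        | none, some c => ({ s with partyPhase := .proposeKey }, reply (.suggest (.key c)))
        | none, none =>
            ({ s with partyPhase := .proposeKey },
              reply (.suggest (.input v_in (tsign p (.input v_in)))))
      else (s, [])
  | .proposeKey =>
      match firstFrom s.inbox L (validProposeKey t) with
      | some (v, pr) =>
          if lockAllows s.lock pr then
            ({ s with partyPhase := .proposeLock }, reply (.checkedKey (tsign p (.key v k))))
          else ({ s with partyPhase := .rest }, [])
      | none => (s, [])
  | .proposeLock =>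
      match firstFrom s.inbox L (validProposeLock t k) with
      | some (v, σ) =>
          ({ s with partyPhase := .proposeCommit, key := some ⟨v, k, σ⟩ },
            reply (.checkedLock (tsign p (.lock v k))))
      | none => (s, [])
  | .proposeCommit =>
      match firstFrom s.inbox L (validProposeCommit t k) with
      | some (v, σ) =>
          ({ s with partyPhase := .rest, lock := some ⟨v, k, σ⟩ },
            reply (.checkedCommit (tsign p (.commit v k))))
      | none => (s, [])
  | .rest => (s, [])

/-- The first valid suggestion of every party that has sent one. -/
def suggestions (t : ℕ) (inbox : List (Fin n × Msg n)) : List (Fin n × Suggestion n) :=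
  (List.finRange n).filterMap fun q =>
    (firstFrom inbox q (validSuggest t q)).map fun x => (q, x)

/-- The first commit among the suggestions. -/
def suggestedCommit (l : List (Fin n × Suggestion n)) : Option (Cert n) :=
  l.findSome? fun e => match e.2 with
    | .commit c => some c
    | _ => none

/-- A key with the highest view number among the suggestions. -/
def suggestedKey (l : List (Fin n × Suggestion n)) : Option (Cert n) :=
  (l.filterMap fun e => match e.2 with
    | .key c => some c
    | _ => none).argmax Cert.view

/-- The parties that suggest `v` as their input. -/
def proposers (l : List (Fin n × Suggestion n)) (v : Value) : List (Fin n) :=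
  l.filterMap fun e => match e.2 with
    | .input w _ => if w = v then some e.1 else none
    | _ => none

/-- The most common input value among the suggestions (a tie is broken towards `true`). -/
def mostCommon (l : List (Fin n × Suggestion n)) : Value :=
  decide ((proposers l false).length ≤ (proposers l true).length)

/-- The parties `q` whose partial signature on `m`, wrapped by `wrap`, has arrived. -/
def responders (inbox : List (Fin n × Msg n)) (wrap : PartialSig n → Msg n) (m : Content) :
    List (Fin n) :=
  (List.finRange n).filter fun q => decide ((q, wrap (tsign q m)) ∈ inbox)

/-- One step of `ViewLeaderProtocol` of the leader `p` of view `k`: if the awaited `n - t` messages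
have arrived, the next message is broadcast; otherwise nothing happens. -/
def leaderStep (t : ℕ) (p : Fin n) (k : ℕ) (s : State n) : State n × List (Packet n) :=
  match s.leaderPhase with
  | .off => (s, [])
  | .suggest =>
      let l := suggestions t s.inbox
      if l.length < n - t then (s, []) else
        match suggestedCommit l, suggestedKey l with
        | some c, _ => ({ s with leaderPhase := .off }, broadcast p k (.sendCommit c))
        | none, some c =>
            ({ s with leaderPhase := .checkedKey c.value },
              broadcast p k (.proposeKey c.value (.key c)))
        | none, none =>
            let v := mostCommon l
            let σ := tcombine (.input v) ((proposers l v).take (t + 1)).toFinset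
            ({ s with leaderPhase := .checkedKey v }, broadcast p k (.proposeKey v (.combine σ)))
  | .checkedKey v =>
      let R := responders s.inbox .checkedKey (.key v k)
      if R.length < n - t then (s, []) else
        ({ s with leaderPhase := .checkedLock v },
          broadcast p k (.proposeLock v (tcombine (.key v k) (R.take (n - t)).toFinset)))
  | .checkedLock v =>
      let R := responders s.inbox .checkedLock (.lock v k)
      if R.length < n - t then (s, []) else
        ({ s with leaderPhase := .checkedCommit v },
          broadcast p k (.proposeCommit v (tcombine (.lock v k) (R.take (n - t)).toFinset)))
  | .checkedCommit v =>
      let R := responders s.inbox .checkedCommit (.commit v k)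
      if R.length < n - t then (s, []) else
        ({ s with leaderPhase := .off },
          broadcast p k (.sendCommit ⟨v, k, tcombine (.commit v k) (R.take (n - t)).toFinset⟩))

/-- `m` successive steps, with all messages that they send. -/
def runSteps (step : State n → State n × List (Packet n)) : ℕ → State n → State n × List (Packet n)
  | 0, s => (s, [])
  | m + 1, s =>
      let r := step s
      let r' := runSteps step m r.1
      (r'.1, r.2 ++ r'.2)

/-- Party `p`, in view `k`, receives a packet. A message of another view is ignored, unless it
carries a valid commit. Both sub-protocols then run until they block: each of them passes at most
four waiting instructions in a view. -/
def receive (t : ℕ) (p : Fin n) (v_in : Value) (k : ℕ) (pkt : Packet n) (s : State n) :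
    State n × List (Packet n) :=
  let r₀ := enterView p k s
  let s₁ := acceptCommit t pkt.msg r₀.1
  let s₂ := if pkt.view = k then { s₁ with inbox := s₁.inbox ++ [(pkt.src, pkt.msg)] } else s₁
  let r₃ := runSteps (partyStep t p v_in k) 4 s₂
  let r₄ := runSteps (leaderStep t p k) 4 r₃.1
  (r₄.1, r₀.2 ++ r₃.2 ++ r₄.2)

/-! ### Global configurations and events -/

/-- What can happen at an instant: the clock of `p` lets it act, a packet is received, or the
adversary corrupts `p`. -/
inductive Event (n : ℕ) where
  | tick (p : Fin n)
  | deliver (pkt : Packet n)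
  | corrupt (p : Fin n)

/-- `sent` is the set of all packets sent so far by parties that were not corrupted when they
sent them. -/
structure Config (n : ℕ) where
  state : Fin n → State n
  corrupted : Finset (Fin n)
  sent : Set (Packet n)

def Config.start (n : ℕ) : Config n where
  state := fun _ => State.start n
  corrupted := ∅
  sent := ∅

/-- The adversary knows the partial signature `ρ`: its signer is corrupted, or `ρ` has been sent. -/
def Config.Knows (c : Config n) (ρ : PartialSig n) : Prop :=
  ρ.signer ∈ c.corrupted ∨ ∃ pkt ∈ c.sent, pkt.msg.partialSig = some ρ

/-- The adversary can send `pkt`: the channels are authenticated, so the sender is a corrupted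
party, and all the partial signatures in `pkt` or in the threshold signatures of `pkt` are known to
the adversary, who can otherwise write what it likes. -/
def Config.CanForge (c : Config n) (pkt : Packet n) : Prop :=
  pkt.src ∈ c.corrupted ∧
  (∀ ρ, pkt.msg.partialSig = some ρ → c.Knows ρ) ∧
  (∀ σ, pkt.msg.thresholdSig = some σ → ∀ q ∈ σ.signers, c.Knows (tsign q σ.content))

/-- Party `p` reaches a new state and sends some packets. -/
def Config.perform (c : Config n) (p : Fin n) (r : State n × List (Packet n)) :
    Config n × List (Packet n) :=
  ({ c with state := Function.update c.state p r.1, sent := c.sent ∪ {x | x ∈ r.2} }, r.2)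

/-- The effect of an event, when `view q` is the current view of `q`: the new configuration and the
packets sent by the (uncorrupted) party at which the event takes place. -/
def Config.next (t : ℕ) (input : Fin n → Value) (view : Fin n → ℕ) (c : Config n) :
    Event n → Config n × List (Packet n)
  | .tick p =>
      if p ∈ c.corrupted then (c, []) else c.perform p (enterView p (view p) (c.state p))
  | .deliver pkt =>
      if pkt.dst ∈ c.corrupted then (c, []) else
        c.perform pkt.dst
          (receive t pkt.dst (input pkt.dst) (view pkt.dst) pkt (c.state pkt.dst))
  | .corrupt p => ({ c with corrupted := insert p c.corrupted }, [])

end Protocol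

/-! ### Executions in partial synchrony -/

/-- The data of a timed execution with `n` parties: the delay bound, the global stabilization time,
the input values, the times `enter p k` at which `p` moves to view `k`, and a sequence of timed
events. -/
structure Execution (n : ℕ) where
  delta : ℝ
  gst : ℝ
  input : Fin n → Value
  enter : Fin n → ℕ → ℝ
  time : ℕ → ℝ
  event : ℕ → Event n

namespace Execution

variable {n : ℕ} [NeZero n]

/-- The view of `p` at time `τ`: the last view that it has entered. -/
noncomputable def viewAt (E : Execution n) (τ : ℝ) (p : Fin n) : ℕ :=
  sSup {k | E.enter p k ≤ τ}

/-- The configuration just before event `i`, when the parties run the protocol with tolerance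
`t`. -/
noncomputable def config (E : Execution n) (t : ℕ) : ℕ → Config n
  | 0 => Config.start n
  | i + 1 => ((E.config t i).next t E.input (E.viewAt (E.time i)) (E.event i)).1

/-- The packets that an uncorrupted party sends at event `i`. -/
noncomputable def sends (E : Execution n) (t i : ℕ) : List (Packet n) :=
  ((E.config t i).next t E.input (E.viewAt (E.time i)) (E.event i)).2

/-- The parties that are corrupted at some point. -/
def faulty (E : Execution n) : Set (Fin n) := {p | ∃ i, E.event i = .corrupt p}

/-- A party is honest if it is never corrupted. -/
def Honest (E : Execution n) (p : Fin n) : Prop := p ∉ E.faulty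

/-- The number `f` of parties that are actually corrupted. -/
noncomputable def f (E : Execution n) : ℕ := E.faulty.ncard

/-- Views: every party goes through the views `0, 1, 2, …`, starting at time `0`, at a pace that is
arbitrary before GST; a view that starts after GST starts at the same time for all parties and
lasts for `9 Δ` at least. (For a corrupted party the times mean nothing.) -/
structure ViewsSynchronized (E : Execution n) : Prop where
  enter_zero : ∀ p, E.enter p 0 = 0
  strictMono : ∀ p, StrictMono (E.enter p)
  unbounded : ∀ p, Filter.Tendsto (E.enter p) Filter.atTop Filter.atTop
  common : ∀ p q k, E.gst ≤ E.enter p k → E.enter q k = E.enter p k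
  duration : ∀ p k, E.gst ≤ E.enter p k → E.enter p k + 9 * E.delta ≤ E.enter p (k + 1)

/-- The executions of the protocol with tolerance `t` in a partially synchronous network against
an adaptive adversary that corrupts at most `t` parties. -/
structure Admissible (E : Execution n) (t : ℕ) : Prop where
  delta_pos : 0 < E.delta
  views : E.ViewsSynchronized
  time_nonneg : ∀ i, 0 ≤ E.time i
  time_mono : Monotone E.time
  time_unbounded : Filter.Tendsto E.time Filter.atTop Filter.atTop
  /-- At most `t` parties are corrupted. -/
  faulty_le : E.f ≤ t
  /-- Every party acts when it enters a view. -/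
  tick : ∀ p k, ∃ i, E.time i = E.enter p k ∧ E.event i = .tick p
  /-- What is received was sent before by an honest sender, or comes from the adversary. -/
  authentic : ∀ i pkt, E.event i = .deliver pkt →
    pkt ∈ (E.config t i).sent ∨ (E.config t i).CanForge pkt
  /-- A message sent at time `τ` is received by time `max τ GST + Δ`. -/
  delivery : ∀ i, ∀ pkt ∈ E.sends t i, ∃ j, i < j ∧ E.event j = .deliver pkt ∧
    E.time j ≤ max (E.time i) E.gst + E.delta

/-- By the time of event `i`, party `p` has decided `v`. -/
def Decides (E : Execution n) (t : ℕ) (p : Fin n) (i : ℕ) (v : Value) : Prop :=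
  ((E.config t i).state p).decision = some v

/-- Every honest party eventually decides a value. -/
def Termination (E : Execution n) (t : ℕ) : Prop :=
  ∀ p, E.Honest p → ∃ i v, E.Decides t p i v

/-- Honest parties never decide different values. -/
def Agreement (E : Execution n) (t : ℕ) : Prop :=
  ∀ p q i j v w, E.Honest p → E.Honest q → E.Decides t p i v → E.Decides t q j w → v = w

/-- If all honest parties propose `v`, then no honest party decides another value. -/
def StrongUnanimity (E : Execution n) (t : ℕ) : Prop :=
  ∀ v, (∀ p, E.Honest p → E.input p = v) →
    ∀ p i w, E.Honest p → E.Decides t p i w → w = v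

/-- The total number of messages sent after GST by parties that are not corrupted when they send
them. A message to all parties counts `n` times. -/
noncomputable def messagesAfterGST (E : Execution n) (t : ℕ) : ℕ∞ :=
  open Classical in
  ⨆ N : ℕ, ((∑ i ∈ Finset.range N, if E.gst ≤ E.time i then (E.sends t i).length else 0 : ℕ) : ℕ∞)

end Execution

end GSTAgreement

/-! Safety is quorum intersection. Since `3 * t < n`, two sets of `n - t` signers share a party that
is never corrupted, and such a party signs at most one key per view; hence all keys of one view have
the same value (`Admissible.key_unique`). An honest party that contributed to a commit of view `w`
has from then on a lock of view at least `w`, and it signs a further key only if the proposal is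
itself a key of view at least that of its lock. Every key of a view after `w` carries the signature
of such a party, and following the justifying keys back in time one sees that every key of view at
least `w` has the value of the commit (`Admissible.key_after_commit`). A commit rests on a lock of
its view, and a lock on a key of its view, so two commits agree. The same walk back in time, which
can also end at `t + 1` signatures on an input, one of them by an honest party, gives strong
unanimity.

For liveness, a lock never stands in the way of a proposal of an uncorrupted leader
(`Admissible.lockCompatible`): the signers of the lock and the parties whose suggestions the leader
used share an honest party, whose suggested key is at least as recent as the lock. Now consider a
view, after GST together with its predecessor, whose leader stays uncorrupted and starts without a
commit. If `n - t` honest parties answer with keys or inputs, eight message delays suffice for the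
leader to send a commit (`Admissible.sendCommit_of_suggested`). Otherwise more than `t - f` honest
parties answer with a commit. Either the leader sees one in time and forwards it, or it has based a
proposal on `n - t` other answers; then at most `t` honest parties answer with a commit, and the
leader itself obtains a commit before the view ends (`Admissible.view_outcome`). So a leader without
a commit soon has one, and one round of leaders gives a commit to everybody.

For the cost, a view takes at most `9 * n` messages, and a view after GST is silent if its leader is
not corrupted and has a commit. In a round of `n` views the active ones have a corrupted leader (at
most `f`), or an honest leader that succeeds (at most 2, since success spreads to all), or an honest
leader that fails. The last kind is where the factor `f` is won: at the first failure more than `t -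
f` honest parties have a commit, each later failing leader newly joins them, and at the last failure
they are still at most `t`; so there are at most `f + 1` failures (`Admissible.card_fails_le`).
After the round only commits are suggested, at most once by each party to each faulty leader, which
costs at most `n * f`.

All facts about local states come from cutting the handling of an event into the atomic transitions
of `Micro`. The invariant `LocalInv` relates the state of a party to the set `S` of packets sent by
uncorrupted parties and the set `D` of corrupted parties, and the idleness predicates express that
no enabled step is left undone after an event. -/

namespace GSTAgreement

set_option linter.unusedSectionVars false

/-! ### Atomic transitions of one party -/

section Local

variable {n : ℕ} [NeZero n]

/-- The effect on party `p` in view `k` of a clock event (`none`) or of a received packet. -/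
def act (t : ℕ) (p : Fin n) (v : Value) (k : ℕ) :
    Option (Packet n) → State n → State n × List (Packet n)
  | none, s => enterView p k s
  | some pkt, s => receive t p v k pkt s

/-- The atomic transitions of party `p` in view `k` while it handles the packet `o`. -/
inductive Micro (t : ℕ) (p : Fin n) (v : Value) (k : ℕ) (o : Option (Packet n)) :
    State n → State n → List (Packet n) → Prop
  | enterLead (s : State n) : (∀ j, s.view = some j → j < k) → p = leader n k → s.commit = none →
      Micro t p v k o s
        { s with view := some k, inbox := [], partyPhase := .request, leaderPhase := .suggest }
        (broadcast p k .requestSuggestion)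
  | enterIdle (s : State n) : (∀ j, s.view = some j → j < k) →
      ¬ (p = leader n k ∧ s.commit = none) →
      Micro t p v k o s
        { s with view := some k, inbox := [], partyPhase := .request, leaderPhase := .off } []
  | accept (s : State n) (pkt : Packet n) (c : Cert n) : s.view = some k → o = some pkt →
      pkt.msg.carriedCommit = some c → c.isCommit t = true → s.commit = none →
      Micro t p v k o s { s with commit := some c, decision := some c.value } []
  | recv (s : State n) (pkt : Packet n) : s.view = some k → o = some pkt → pkt.view = k →
      Micro t p v k o s { s with inbox := s.inbox ++ [(pkt.src, pkt.msg)] } []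
  | requestOld (s : State n) : s.view = some k → s.partyPhase = .request →
      (leader n k, Msg.requestSuggestion) ∈ s.inbox → s.commit ≠ none →
      leader n k ∈ s.commitSentTo →
      Micro t p v k o s { s with partyPhase := .rest } []
  | requestCommit (s : State n) (c : Cert n) : s.view = some k → s.partyPhase = .request →
      (leader n k, Msg.requestSuggestion) ∈ s.inbox → s.commit = some c →
      leader n k ∉ s.commitSentTo →
      Micro t p v k o s
        { s with partyPhase := .rest, commitSentTo := insert (leader n k) s.commitSentTo }
        [⟨p, leader n k, k, .suggest (.commit c)⟩]
  | requestKey (s : State n) (c : Cert n) : s.view = some k → s.partyPhase = .request →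
      (leader n k, Msg.requestSuggestion) ∈ s.inbox → s.commit = none → s.key = some c →
      Micro t p v k o s { s with partyPhase := .proposeKey }
        [⟨p, leader n k, k, .suggest (.key c)⟩]
  | requestInput (s : State n) : s.view = some k → s.partyPhase = .request →
      (leader n k, Msg.requestSuggestion) ∈ s.inbox → s.commit = none → s.key = none →
      Micro t p v k o s { s with partyPhase := .proposeKey }
        [⟨p, leader n k, k, .suggest (.input v (tsign p (.input v)))⟩]
  | keyAccept (s : State n) (w : Value) (pr : Proposal n) : s.view = some k →
      s.partyPhase = .proposeKey → (leader n k, Msg.proposeKey w pr) ∈ s.inbox →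
      pr.valid t w = true → lockAllows s.lock pr = true →
      Micro t p v k o s { s with partyPhase := .proposeLock }
        [⟨p, leader n k, k, .checkedKey (tsign p (.key w k))⟩]
  | keyReject (s : State n) (w : Value) (pr : Proposal n) : s.view = some k →
      s.partyPhase = .proposeKey → (leader n k, Msg.proposeKey w pr) ∈ s.inbox →
      pr.valid t w = true → lockAllows s.lock pr = false →
      Micro t p v k o s { s with partyPhase := .rest } []
  | setKey (s : State n) (w : Value) (σ : ThresholdSig n) : s.view = some k →
      s.partyPhase = .proposeLock → (leader n k, Msg.proposeLock w σ) ∈ s.inbox →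
      tverify (n - t) (.key w k) σ = true →
      Micro t p v k o s { s with partyPhase := .proposeCommit, key := some ⟨w, k, σ⟩ }
        [⟨p, leader n k, k, .checkedLock (tsign p (.lock w k))⟩]
  | setLock (s : State n) (w : Value) (σ : ThresholdSig n) : s.view = some k →
      s.partyPhase = .proposeCommit → (leader n k, Msg.proposeCommit w σ) ∈ s.inbox →
      tverify (n - t) (.lock w k) σ = true →
      Micro t p v k o s { s with partyPhase := .rest, lock := some ⟨w, k, σ⟩ }
        [⟨p, leader n k, k, .checkedCommit (tsign p (.commit w k))⟩]
  | leadCommit (s : State n) (c : Cert n) : s.view = some k → s.leaderPhase = .suggest →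
      n - t ≤ (suggestions t s.inbox).length →
      suggestedCommit (suggestions t s.inbox) = some c →
      Micro t p v k o s { s with leaderPhase := .off } (broadcast p k (.sendCommit c))
  | leadKey (s : State n) (c : Cert n) : s.view = some k → s.leaderPhase = .suggest →
      n - t ≤ (suggestions t s.inbox).length →
      suggestedCommit (suggestions t s.inbox) = none →
      suggestedKey (suggestions t s.inbox) = some c →
      Micro t p v k o s { s with leaderPhase := .checkedKey c.value }
        (broadcast p k (.proposeKey c.value (.key c)))
  | leadInput (s : State n) (w : Value) (σ : ThresholdSig n) : s.view = some k →
      s.leaderPhase = .suggest →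
      n - t ≤ (suggestions t s.inbox).length →
      suggestedCommit (suggestions t s.inbox) = none →
      suggestedKey (suggestions t s.inbox) = none →
      w = mostCommon (suggestions t s.inbox) →
      σ = tcombine (.input w) ((proposers (suggestions t s.inbox) w).take (t + 1)).toFinset →
      Micro t p v k o s { s with leaderPhase := .checkedKey w }
        (broadcast p k (.proposeKey w (.combine σ)))
  | leadLock (s : State n) (w : Value) (R : List (Fin n)) : s.view = some k →
      s.leaderPhase = .checkedKey w →
      R = responders s.inbox .checkedKey (.key w k) → n - t ≤ R.length →
      Micro t p v k o s { s with leaderPhase := .checkedLock w }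
        (broadcast p k (.proposeLock w (tcombine (.key w k) (R.take (n - t)).toFinset)))
  | leadPropCommit (s : State n) (w : Value) (R : List (Fin n)) : s.view = some k →
      s.leaderPhase = .checkedLock w →
      R = responders s.inbox .checkedLock (.lock w k) → n - t ≤ R.length →
      Micro t p v k o s { s with leaderPhase := .checkedCommit w }
        (broadcast p k (.proposeCommit w (tcombine (.lock w k) (R.take (n - t)).toFinset)))
  | leadSend (s : State n) (w : Value) (R : List (Fin n)) : s.view = some k →
      s.leaderPhase = .checkedCommit w →
      R = responders s.inbox .checkedCommit (.commit w k) → n - t ≤ R.length →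
      Micro t p v k o s { s with leaderPhase := .off }
        (broadcast p k (.sendCommit ⟨w, k, tcombine (.commit w k) (R.take (n - t)).toFinset⟩))

theorem mem_broadcast {p : Fin n} {k : ℕ} {m : Msg n} {x : Packet n} :
    x ∈ broadcast p k m ↔ x.src = p ∧ x.view = k ∧ x.msg = m := by
  unfold broadcast
  simp only [List.mem_map, List.mem_finRange, true_and]
  constructor
  · rintro ⟨q, rfl⟩; simp
  · rintro ⟨rfl, rfl, rfl⟩; exact ⟨x.dst, rfl⟩

theorem length_broadcast {p : Fin n} {k : ℕ} {m : Msg n} : (broadcast p k m).length = n := by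
  simp [broadcast]

theorem firstFrom_some {α : Type} {inbox : List (Fin n × Msg n)} {src : Fin n}
    {check : Msg n → Option α} {a : α} (h : firstFrom inbox src check = some a) :
    ∃ m, (src, m) ∈ inbox ∧ check m = some a := by
  unfold firstFrom at h
  obtain ⟨⟨q, m⟩, hm, h2⟩ := List.exists_of_findSome?_eq_some h
  simp only at h2
  split_ifs at h2 with h3
  subst h3
  exact ⟨m, hm, h2⟩

theorem firstFrom_none {α : Type} {inbox : List (Fin n × Msg n)} {src : Fin n}
    {check : Msg n → Option α} (h : firstFrom inbox src check = none) {m : Msg n}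
    (hm : (src, m) ∈ inbox) : check m = none := by
  unfold firstFrom at h
  rw [List.findSome?_eq_none_iff] at h
  simpa using h _ hm

theorem validProposeKey_some {t : ℕ} {m : Msg n} {w : Value} {pr : Proposal n}
    (h : validProposeKey t m = some (w, pr)) : m = .proposeKey w pr ∧ pr.valid t w = true := by
  unfold validProposeKey at h
  split at h <;> simp at h
  obtain ⟨h, rfl, rfl⟩ := h
  exact ⟨rfl, h⟩

theorem validProposeLock_some {t k : ℕ} {m : Msg n} {w : Value} {σ : ThresholdSig n}
    (h : validProposeLock t k m = some (w, σ)) :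
    m = .proposeLock w σ ∧ tverify (n - t) (.key w k) σ = true := by
  unfold validProposeLock at h
  split at h <;> simp at h
  obtain ⟨h, rfl, rfl⟩ := h
  exact ⟨rfl, h⟩

theorem validProposeCommit_some {t k : ℕ} {m : Msg n} {w : Value} {σ : ThresholdSig n}
    (h : validProposeCommit t k m = some (w, σ)) :
    m = .proposeCommit w σ ∧ tverify (n - t) (.lock w k) σ = true := by
  unfold validProposeCommit at h
  split at h <;> simp at h
  obtain ⟨h, rfl, rfl⟩ := h
  exact ⟨rfl, h⟩

theorem validSuggest_some {t : ℕ} {q : Fin n} {m : Msg n} {x : Suggestion n}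
    (h : validSuggest t q m = some x) : m = .suggest x ∧ x.valid t q = true := by
  unfold validSuggest at h
  split at h <;> simp at h
  obtain ⟨h, rfl⟩ := h
  exact ⟨rfl, h⟩

theorem partyStep_micro (t : ℕ) (p : Fin n) (v : Value) (k : ℕ) (o : Option (Packet n))
    (s : State n) (hs : s.view = some k) :
    (partyStep t p v k s = (s, []) ∨
      Micro t p v k o s (partyStep t p v k s).1 (partyStep t p v k s).2) ∧
    (partyStep t p v k s).1.view = some k := by
  unfold partyStep
  dsimp only
  split
  · rename_i hph
    obtain ⟨view, key, lock, commit, decision, sentTo, inbox, pphase, lphase⟩ := s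
    by_cases hin : (leader n k, Msg.requestSuggestion) ∈ inbox
    · rw [if_pos hin]
      rcases commit with _ | c
      · rcases key with _ | c
        · exact ⟨.inr (.requestInput _ hs hph hin rfl rfl), hs⟩
        · exact ⟨.inr (.requestKey _ c hs hph hin rfl rfl), hs⟩
      · dsimp only
        by_cases hL : leader n k ∈ sentTo
        · rw [if_pos hL]
          exact ⟨.inr (.requestOld _ hs hph hin (by simp) hL), hs⟩
        · rw [if_neg hL]
          exact ⟨.inr (.requestCommit _ c hs hph hin rfl hL), hs⟩
    · rw [if_neg hin]
      exact ⟨.inl rfl, hs⟩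
  · rename_i hph
    split
    · rename_i w pr hw
      obtain ⟨m, hm, h1⟩ := firstFrom_some hw
      obtain ⟨rfl, h2⟩ := validProposeKey_some h1
      split_ifs with hL
      · exact ⟨.inr (.keyAccept s w pr hs hph hm h2 hL), hs⟩
      · exact ⟨.inr (.keyReject s w pr hs hph hm h2 (by simpa using hL)), hs⟩
    · exact ⟨.inl rfl, hs⟩
  · rename_i hph
    split
    · rename_i w pr hw
      obtain ⟨m, hm, h1⟩ := firstFrom_some hw
      obtain ⟨rfl, h2⟩ := validProposeLock_some h1
      exact ⟨.inr (.setKey s w pr hs hph hm h2), hs⟩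
    · exact ⟨.inl rfl, hs⟩
  · rename_i hph
    split
    · rename_i w pr hw
      obtain ⟨m, hm, h1⟩ := firstFrom_some hw
      obtain ⟨rfl, h2⟩ := validProposeCommit_some h1
      exact ⟨.inr (.setLock s w pr hs hph hm h2), hs⟩
    · exact ⟨.inl rfl, hs⟩
  · exact ⟨.inl rfl, hs⟩

theorem leaderStep_micro (t : ℕ) (p : Fin n) (v : Value) (k : ℕ) (o : Option (Packet n))
    (s : State n) (hs : s.view = some k) :
    (leaderStep t p k s = (s, []) ∨
      Micro t p v k o s (leaderStep t p k s).1 (leaderStep t p k s).2) ∧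
    (leaderStep t p k s).1.view = some k := by
  unfold leaderStep
  dsimp only
  split
  · exact ⟨.inl rfl, hs⟩
  · rename_i hph
    split_ifs with hl
    · exact ⟨.inl rfl, hs⟩
    · have hl := not_lt.1 hl
      split
      · rename_i _ _ c hc
        exact ⟨.inr (.leadCommit s c hs hph hl hc), hs⟩
      · rename_i c hc hk
        exact ⟨.inr (.leadKey s c hs hph hl hc hk), hs⟩
      · rename_i hc hk
        exact ⟨.inr (.leadInput s _ _ hs hph hl hc hk rfl rfl), hs⟩
  · rename_i w hph
    split_ifs with hl
    · exact ⟨.inl rfl, hs⟩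
    · exact ⟨.inr (.leadLock s w _ hs hph rfl (not_lt.1 hl)), hs⟩
  · rename_i w hph
    split_ifs with hl
    · exact ⟨.inl rfl, hs⟩
    · exact ⟨.inr (.leadPropCommit s w _ hs hph rfl (not_lt.1 hl)), hs⟩
  · rename_i w hph
    split_ifs with hl
    · exact ⟨.inl rfl, hs⟩
    · exact ⟨.inr (.leadSend s w _ hs hph rfl (not_lt.1 hl)), hs⟩

/-- Induction over the atomic transitions that make up the handling of an event. -/
theorem act_ind {t : ℕ} {p : Fin n} {v : Value} {k : ℕ} {o : Option (Packet n)}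
    {P : State n → List (Packet n) → Prop} {s : State n} (h0 : P s [])
    (hview : ∀ j, s.view = some j → j ≤ k)
    (step : ∀ s l s' l', P s l → Micro t p v k o s s' l' → P s' (l ++ l')) :
    P (act t p v k o s).1 (act t p v k o s).2 ∧ (act t p v k o s).1.view = some k := by
  have run : ∀ (f : State n → State n × List (Packet n)),
      (∀ s, s.view = some k → (f s = (s, []) ∨ Micro t p v k o s (f s).1 (f s).2) ∧
        (f s).1.view = some k) →
      ∀ m s l, P s l → s.view = some k →
        P (runSteps f m s).1 (l ++ (runSteps f m s).2) ∧ (runSteps f m s).1.view = some k := by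
    intro f hf m
    induction m with
    | zero => intro s l hP hs; simpa [runSteps] using ⟨hP, hs⟩
    | succ m ih =>
      intro s l hP hs
      simp only [runSteps]
      rw [← List.append_assoc]
      refine ih _ _ ?_ (hf s hs).2
      rcases (hf s hs).1 with h | h
      · rw [h]; simpa using hP
      · exact step _ _ _ _ hP h
  have enter : P (enterView p k s).1 (enterView p k s).2 ∧
      (enterView p k s).1.view = some k := by
    unfold enterView
    split_ifs with h1 h2
    · exact ⟨h0, h1⟩
    · refine ⟨?_, rfl⟩
      rw [← List.nil_append (broadcast p k .requestSuggestion)]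
      refine step _ _ _ _ h0 (.enterLead s (fun j hj => ?_) h2.1 (by simpa using h2.2))
      exact lt_of_le_of_ne (hview j hj) (by rintro rfl; exact h1 hj)
    · refine ⟨?_, rfl⟩
      rw [← List.nil_append ([] : List (Packet n))]
      refine step _ _ _ _ h0 (.enterIdle s (fun j hj => ?_) (by simpa using h2))
      exact lt_of_le_of_ne (hview j hj) (by rintro rfl; exact h1 hj)
  cases o with
  | none => exact enter
  | some pkt =>
    simp only [act, receive]
    set r₀ := enterView p k s
    have h1 : P (acceptCommit t pkt.msg r₀.1) r₀.2 ∧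
        (acceptCommit t pkt.msg r₀.1).view = some k := by
      unfold acceptCommit
      split
      · rename_i c hc
        split_ifs with h
        · refine ⟨?_, enter.2⟩
          rw [← List.append_nil r₀.2]
          exact step _ _ _ _ enter.1 (.accept _ pkt c enter.2 rfl hc h.1 (by simpa using h.2))
        · exact enter
      · exact enter
    set s₁ := acceptCommit t pkt.msg r₀.1
    have h2 : P (if pkt.view = k then
        { s₁ with inbox := s₁.inbox ++ [(pkt.src, pkt.msg)] } else s₁) r₀.2 ∧
        (if pkt.view = k then
        { s₁ with inbox := s₁.inbox ++ [(pkt.src, pkt.msg)] } else s₁).view = some k := by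
      split_ifs with h
      · refine ⟨?_, h1.2⟩
        rw [← List.append_nil r₀.2]
        exact step _ _ _ _ h1.1 (.recv _ pkt h1.2 rfl h)
      · exact h1
    have h3 := run _ (partyStep_micro t p v k (some pkt)) 4 _ _ h2.1 h2.2
    exact run _ (leaderStep_micro t p v k (some pkt)) 4 _ _ h3.1 h3.2

end Local

/-! ### Counting suggestions, proposers and responders -/

section Lists

variable {n : ℕ} [NeZero n]

theorem mem_suggestions {t : ℕ} {inbox : List (Fin n × Msg n)} {q : Fin n} {x : Suggestion n}
    (h : (q, x) ∈ suggestions t inbox) : (q, Msg.suggest x) ∈ inbox ∧ x.valid t q = true := by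
  unfold suggestions at h
  simp only [List.mem_filterMap, List.mem_finRange, true_and, Option.map_eq_some_iff] at h
  obtain ⟨q', x', hx, h⟩ := h
  obtain ⟨rfl, rfl⟩ := Prod.mk.inj h
  obtain ⟨m, hm, h1⟩ := firstFrom_some hx
  obtain ⟨rfl, h2⟩ := validSuggest_some h1
  exact ⟨hm, h2⟩

theorem nodup_suggestions (t : ℕ) (inbox : List (Fin n × Msg n)) :
    ((suggestions t inbox).map Prod.fst).Nodup := by
  have h : (suggestions t inbox).map Prod.fst = (List.finRange n).filter fun q =>
      (firstFrom inbox q (validSuggest t q)).isSome := by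
    unfold suggestions
    induction List.finRange n with
    | nil => rfl
    | cons a l ih =>
      rcases hq : firstFrom inbox a (validSuggest t a) with _ | x <;> simp_all
  rw [h]
  exact (List.nodup_finRange n).filter _

theorem card_le_suggestions {t : ℕ} {inbox : List (Fin n × Msg n)} (Q : Finset (Fin n))
    (h : ∀ q ∈ Q, ∃ x, (q, Msg.suggest x) ∈ inbox ∧ x.valid t q = true) :
    Q.card ≤ (suggestions t inbox).length := by
  have h1 : Q ⊆ ((suggestions t inbox).map Prod.fst).toFinset := by
    intro q hq
    obtain ⟨x, hx, hv⟩ := h q hq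
    simp only [List.mem_toFinset, List.mem_map]
    -- The suggestion that is counted for `q` may differ from `x`, because only the first valid one
    -- is kept; it matters only that one exists.
    rcases hf : firstFrom inbox q (validSuggest t q) with _ | y
    · have := firstFrom_none hf hx
      simp [validSuggest, hv] at this
    · refine ⟨(q, y), ?_, rfl⟩
      unfold suggestions
      simp only [List.mem_filterMap, List.mem_finRange, true_and]
      exact ⟨q, by rw [hf]; rfl⟩
  refine (Finset.card_le_card h1).trans ((List.toFinset_card_le _).trans ?_)
  simp

theorem suggestedCommit_some {l : List (Fin n × Suggestion n)} {c : Cert n}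
    (h : suggestedCommit l = some c) : ∃ q, (q, Suggestion.commit c) ∈ l := by
  unfold suggestedCommit at h
  obtain ⟨⟨q, x⟩, hm, h2⟩ := List.exists_of_findSome?_eq_some h
  cases x <;> simp at h2
  subst h2
  exact ⟨q, hm⟩

theorem suggestedCommit_none {l : List (Fin n × Suggestion n)} (h : suggestedCommit l = none)
    {q : Fin n} {x : Suggestion n} (hx : (q, x) ∈ l) (c : Cert n) : x ≠ .commit c := by
  unfold suggestedCommit at h
  rw [List.findSome?_eq_none_iff] at h
  have := h _ hx
  rintro rfl
  simp at this

theorem mem_keys {l : List (Fin n × Suggestion n)} {c : Cert n} :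
    (c ∈ l.filterMap fun e => match e.2 with
      | .key c => some c
      | _ => none) ↔ ∃ q, (q, Suggestion.key c) ∈ l := by
  rw [List.mem_filterMap]
  constructor
  · rintro ⟨⟨q, x⟩, hm, h⟩
    cases x <;> simp at h
    subst h
    exact ⟨q, hm⟩
  · rintro ⟨q, hq⟩
    exact ⟨_, hq, rfl⟩

theorem suggestedKey_some {l : List (Fin n × Suggestion n)} {c : Cert n}
    (h : suggestedKey l = some c) : (∃ q, (q, Suggestion.key c) ∈ l) ∧
      ∀ q c', (q, Suggestion.key c') ∈ l → c'.view ≤ c.view := by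
  unfold suggestedKey at h
  have h1 := List.argmax_mem h
  refine ⟨mem_keys.1 h1, fun q c' hc' => ?_⟩
  exact List.le_of_mem_argmax (mem_keys.2 ⟨q, hc'⟩) h

theorem suggestedKey_none {l : List (Fin n × Suggestion n)} (h : suggestedKey l = none)
    (q : Fin n) (c : Cert n) : (q, Suggestion.key c) ∉ l := by
  unfold suggestedKey at h
  rw [List.argmax_eq_none] at h
  intro hc
  exact List.eq_nil_iff_forall_not_mem.1 h c (mem_keys.2 ⟨q, hc⟩)

theorem mem_proposers {l : List (Fin n × Suggestion n)} {w : Value} {q : Fin n}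
    (h : q ∈ proposers l w) : ∃ ρ, (q, Suggestion.input w ρ) ∈ l := by
  unfold proposers at h
  rw [List.mem_filterMap] at h
  obtain ⟨⟨q', x⟩, hm, h⟩ := h
  cases x <;> simp at h
  obtain ⟨rfl, rfl⟩ := h
  exact ⟨_, hm⟩

theorem nodup_proposers {l : List (Fin n × Suggestion n)} (hl : (l.map Prod.fst).Nodup)
    (w : Value) : (proposers l w).Nodup := by
  refine List.Nodup.sublist ?_ hl
  unfold proposers
  induction l with
  | nil => simp
  | cons e l ih =>
    have ih := ih (List.nodup_cons.1 hl).2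
    obtain ⟨q, x⟩ := e
    rcases x with c | c | ⟨w', ρ⟩
    · simpa using ih.cons _
    · simpa using ih.cons _
    · by_cases h : w' = w
      · simpa [h] using ih
      · simpa [h] using ih.cons _

theorem length_proposers {l : List (Fin n × Suggestion n)} (hc : suggestedCommit l = none)
    (hk : suggestedKey l = none) :
    (proposers l false).length + (proposers l true).length = l.length := by
  have h1 : ∀ e ∈ l, ∃ w ρ, e.2 = Suggestion.input w ρ := by
    rintro ⟨q, x⟩ he
    rcases x with c | c | ⟨w, ρ⟩
    · exact absurd rfl (suggestedCommit_none hc he c)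
    · exact absurd he (suggestedKey_none hk q c)
    · exact ⟨w, ρ, rfl⟩
  clear hc hk
  unfold proposers
  induction l with
  | nil => rfl
  | cons e l ih =>
    have ih := ih fun e he => h1 e (List.mem_cons_of_mem _ he)
    obtain ⟨w, ρ, h⟩ := h1 e List.mem_cons_self
    obtain ⟨q, x⟩ := e
    simp only at h
    subst h
    cases w <;> simp <;> omega

theorem tverify_iff {k : ℕ} {m : Content} {σ : ThresholdSig n} :
    tverify k m σ = true ↔ σ.content = m ∧ σ.signers.card = k := by
  simp [tverify]

theorem tverify_take {k : ℕ} {m : Content} {R : List (Fin n)} (hR : R.Nodup) (h : k ≤ R.length) :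
    tverify k m (tcombine m (R.take k).toFinset) = true := by
  rw [tverify_iff]
  refine ⟨rfl, ?_⟩
  simp only [tcombine]
  rw [List.toFinset_card_of_nodup (hR.sublist (List.take_sublist _ _)), List.length_take]
  omega

/-- Without commits and keys all suggestions are inputs. There are at least `n - t ≥ 2 * t + 1` of
them and only two values, so the more frequent value has at least `t + 1`. -/
theorem lt_length_mostCommon {t : ℕ} {l : List (Fin n × Suggestion n)} (ht : 3 * t < n)
    (hl : n - t ≤ l.length) (hc : suggestedCommit l = none) (hk : suggestedKey l = none) :
    t + 1 ≤ (proposers l (mostCommon l)).length := by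
  have h := length_proposers hc hk
  unfold mostCommon
  by_cases h1 : (proposers l false).length ≤ (proposers l true).length
  · simp only [h1, decide_true]; omega
  · simp only [h1, decide_false]; omega

theorem mem_responders {inbox : List (Fin n × Msg n)} {wrap : PartialSig n → Msg n} {m : Content}
    {q : Fin n} : q ∈ responders inbox wrap m ↔ (q, wrap (tsign q m)) ∈ inbox := by
  simp [responders]

theorem nodup_responders (inbox : List (Fin n × Msg n)) (wrap : PartialSig n → Msg n)
    (m : Content) : (responders inbox wrap m).Nodup :=
  (List.nodup_finRange n).filter _

theorem card_le_responders {inbox : List (Fin n × Msg n)} {wrap : PartialSig n → Msg n}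
    {m : Content} (Q : Finset (Fin n)) (h : ∀ q ∈ Q, (q, wrap (tsign q m)) ∈ inbox) :
    Q.card ≤ (responders inbox wrap m).length := by
  have h1 : Q ⊆ (responders inbox wrap m).toFinset := fun q hq =>
    List.mem_toFinset.2 (mem_responders.2 (h q hq))
  exact (Finset.card_le_card h1).trans (List.toFinset_card_le _)

end Lists

/-! ### After every event both sub-protocols are blocked -/

section Idle

variable {n : ℕ} [NeZero n]

/-- The message that the party protocol awaits in view `k` has not arrived. -/
structure PartyIdle (t k : ℕ) (s : State n) : Prop where
  request : s.partyPhase = .request → (leader n k, Msg.requestSuggestion) ∉ s.inbox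
  proposeKey : s.partyPhase = .proposeKey → ∀ w pr, (leader n k, Msg.proposeKey w pr) ∈ s.inbox →
    pr.valid t w = false
  proposeLock : s.partyPhase = .proposeLock → ∀ w σ,
    (leader n k, Msg.proposeLock w σ) ∈ s.inbox → tverify (n - t) (.key w k) σ = false
  proposeCommit : s.partyPhase = .proposeCommit → ∀ w σ,
    (leader n k, Msg.proposeCommit w σ) ∈ s.inbox → tverify (n - t) (.lock w k) σ = false

/-- The leader protocol awaits more messages in view `k`. -/
structure LeaderIdle (t k : ℕ) (s : State n) : Prop where
  suggest : s.leaderPhase = .suggest → (suggestions t s.inbox).length < n - t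
  checkedKey : ∀ w, s.leaderPhase = .checkedKey w →
    (responders s.inbox .checkedKey (.key w k)).length < n - t
  checkedLock : ∀ w, s.leaderPhase = .checkedLock w →
    (responders s.inbox .checkedLock (.lock w k)).length < n - t
  checkedCommit : ∀ w, s.leaderPhase = .checkedCommit w →
    (responders s.inbox .checkedCommit (.commit w k)).length < n - t

def PartyPhase.rank : PartyPhase → ℕ
  | .request => 4
  | .proposeKey => 3
  | .proposeLock => 2
  | .proposeCommit => 1
  | .rest => 0

def LeaderPhase.rank : LeaderPhase → ℕ
  | .suggest => 4
  | .checkedKey _ => 3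
  | .checkedLock _ => 2
  | .checkedCommit _ => 1
  | .off => 0

theorem partyStep_idle (t : ℕ) (p : Fin n) (v : Value) (k : ℕ) (s : State n) :
    (PartyIdle t k s ∧ partyStep t p v k s = (s, [])) ∨
      (partyStep t p v k s).1.partyPhase.rank < s.partyPhase.rank := by
  obtain ⟨view, key, lock, commit, decision, sentTo, inbox, pphase, lphase⟩ := s
  cases pphase
  · by_cases h : (leader n k, Msg.requestSuggestion) ∈ inbox
    · right
      rcases commit with _ | c <;> rcases key with _ | c' <;>
        simp only [partyStep, h, if_true] <;> (try split_ifs) <;> simp [PartyPhase.rank]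
    · left
      refine ⟨⟨fun _ => h, ?_, ?_, ?_⟩, ?_⟩ <;> simp [partyStep, h]
  · rcases hf : firstFrom inbox (leader n k) (validProposeKey t) with _ | ⟨w, pr⟩
    · left
      refine ⟨⟨by simp, fun _ w pr hm => ?_, by simp, by simp⟩, by simp [partyStep, hf]⟩
      have := firstFrom_none hf hm
      simpa [validProposeKey] using this
    · right
      simp only [partyStep, hf]
      split_ifs <;> simp [PartyPhase.rank]
  · rcases hf : firstFrom inbox (leader n k) (validProposeLock t k) with _ | ⟨w, pr⟩
    · left
      refine ⟨⟨by simp, by simp, fun _ w pr hm => ?_, by simp⟩, by simp [partyStep, hf]⟩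
      have := firstFrom_none hf hm
      simpa [validProposeLock] using this
    · right
      simp [partyStep, hf, PartyPhase.rank]
  · rcases hf : firstFrom inbox (leader n k) (validProposeCommit t k) with _ | ⟨w, pr⟩
    · left
      refine ⟨⟨by simp, by simp, by simp, fun _ w pr hm => ?_⟩, by simp [partyStep, hf]⟩
      have := firstFrom_none hf hm
      simpa [validProposeCommit] using this
    · right
      simp [partyStep, hf, PartyPhase.rank]
  · left
    refine ⟨⟨?_, ?_, ?_, ?_⟩, ?_⟩ <;> simp [partyStep]

theorem leaderStep_idle (t : ℕ) (p : Fin n) (k : ℕ) (s : State n) :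
    (LeaderIdle t k s ∧ leaderStep t p k s = (s, [])) ∨
      (leaderStep t p k s).1.leaderPhase.rank < s.leaderPhase.rank := by
  obtain ⟨view, key, lock, commit, decision, sentTo, inbox, pphase, lphase⟩ := s
  rcases lphase with _ | _ | w | w | w
  · left
    refine ⟨⟨?_, ?_, ?_, ?_⟩, ?_⟩ <;> simp [leaderStep]
  · by_cases h : (suggestions t inbox).length < n - t
    · left
      refine ⟨⟨fun _ => h, ?_, ?_, ?_⟩, ?_⟩ <;> simp [leaderStep, h]
    · right
      simp only [leaderStep, h, if_false]
      split <;> simp [LeaderPhase.rank]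
  · by_cases h : (responders inbox .checkedKey (.key w k)).length < n - t
    · left
      refine ⟨⟨by simp, fun w' hw => ?_, by simp, by simp⟩, by simp [leaderStep, h]⟩
      cases hw; exact h
    · right
      simp [leaderStep, h, LeaderPhase.rank]
  · by_cases h : (responders inbox .checkedLock (.lock w k)).length < n - t
    · left
      refine ⟨⟨by simp, by simp, fun w' hw => ?_, by simp⟩, by simp [leaderStep, h]⟩
      cases hw; exact h
    · right
      simp [leaderStep, h, LeaderPhase.rank]
  · by_cases h : (responders inbox .checkedCommit (.commit w k)).length < n - t
    · left
      refine ⟨⟨by simp, by simp, by simp, fun w' hw => ?_⟩, by simp [leaderStep, h]⟩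
      cases hw; exact h
    · right
      simp [leaderStep, h, LeaderPhase.rank]

theorem runSteps_fix {f : State n → State n × List (Packet n)} {s : State n} (h : f s = (s, []))
    (m : ℕ) : (runSteps f m s).1 = s := by
  induction m with
  | zero => rfl
  | succ m ih => simp [runSteps, h, ih]

/-- A step that does anything lowers the rank, so as many iterations as the initial rank reach a
blocked state. With ranks at most 4 this is why four steps per event are enough. -/
theorem runSteps_idle {f : State n → State n × List (Packet n)} {I : State n → Prop}
    {rank : State n → ℕ} (hf : ∀ s, (I s ∧ f s = (s, [])) ∨ rank (f s).1 < rank s) :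
    ∀ m s, rank s ≤ m → I (runSteps f m s).1 := by
  intro m
  induction m with
  | zero =>
    intro s hs
    rcases hf s with h | h
    · exact h.1
    · omega
  | succ m ih =>
    intro s hs
    rcases hf s with h | h
    · rw [runSteps_fix h.2]; exact h.1
    · simp only [runSteps]; exact ih _ (by omega)

theorem leaderStep_frame (t : ℕ) (p : Fin n) (k : ℕ) (s : State n) :
    (leaderStep t p k s).1.partyPhase = s.partyPhase ∧ (leaderStep t p k s).1.inbox = s.inbox := by
  unfold leaderStep
  dsimp only
  split <;> (try split_ifs) <;> (try split) <;> simp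

theorem PartyIdle.congr {t k : ℕ} {s s' : State n} (h : PartyIdle t k s)
    (h1 : s'.partyPhase = s.partyPhase) (h2 : s'.inbox = s.inbox) : PartyIdle t k s' := by
  obtain ⟨a, b, c, d⟩ := h
  rw [← h1, ← h2] at a b c d
  exact ⟨a, b, c, d⟩

theorem act_idle {t : ℕ} (ht : 3 * t < n) (p : Fin n) (v : Value) (k : ℕ) (o : Option (Packet n))
    (s : State n) (hs : s.view = some k → PartyIdle t k s ∧ LeaderIdle t k s) :
    PartyIdle t k (act t p v k o s).1 ∧ LeaderIdle t k (act t p v k o s).1 := by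
  cases o with
  | none =>
    simp only [act, enterView]
    split_ifs with h1 h2
    · exact hs h1
    -- A new leader has an empty inbox, and it is blocked because `0 < n - t`.
    · refine ⟨⟨?_, ?_, ?_, ?_⟩, ⟨?_, ?_, ?_, ?_⟩⟩ <;> simp [suggestions, firstFrom]
      omega
    · refine ⟨⟨?_, ?_, ?_, ?_⟩, ⟨?_, ?_, ?_, ?_⟩⟩ <;> simp
  | some pkt =>
    simp only [act, receive]
    generalize acceptCommit t pkt.msg _ = s₁
    generalize (if pkt.view = k then _ else _ : State n) = s₂
    refine ⟨?_, ?_⟩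
    · have h := runSteps_idle (rank := fun s => s.partyPhase.rank) (partyStep_idle t p v k) 4 s₂
        (by cases s₂.partyPhase <;> simp [PartyPhase.rank])
      generalize (runSteps (partyStep t p v k) 4 s₂).1 = s₃ at h
      -- The leader steps run after the party steps but touch neither the party phase nor the inbox,
      -- so they cannot unblock the party.
      have : ∀ m s, PartyIdle t k s → PartyIdle t k (runSteps (leaderStep t p k) m s).1 := by
        intro m
        induction m with
        | zero => intro s h; exact h
        | succ m ih =>
          intro s h
          simp only [runSteps]
          have hF := leaderStep_frame t p k s
          exact ih _ (h.congr hF.1 hF.2)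
      exact this _ _ h
    · refine runSteps_idle (rank := fun s => s.leaderPhase.rank) (leaderStep_idle t p k) 4 _ ?_
      generalize State.leaderPhase _ = x
      cases x <;> simp [LeaderPhase.rank]

end Idle

/-! ### Provenance of signatures and shape of messages -/

section Certificates

variable {n : ℕ} [NeZero n]

/-- The partial signature is available to the adversary that has corrupted `D`, when `S` has been
sent. -/
def Known (D : Finset (Fin n)) (S : Set (Packet n)) (ρ : PartialSig n) : Prop :=
  ρ.signer ∈ D ∨ ∃ x ∈ S, x.msg.partialSig = some ρ

def KnownSig (D : Finset (Fin n)) (S : Set (Packet n)) (σ : ThresholdSig n) : Prop :=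
  ∀ q ∈ σ.signers, Known D S (tsign q σ.content)

theorem KnownSig.mono {D D' : Finset (Fin n)} {S S' : Set (Packet n)} {σ : ThresholdSig n}
    (h : KnownSig D S σ) (hD : D ⊆ D') (hS : S ⊆ S') : KnownSig D' S' σ := fun q hq =>
  (h q hq).imp (fun h => hD h) fun ⟨x, hx, hm⟩ => ⟨x, hS hx, hm⟩

/-- What the protocol guarantees about a message sent by `p` to `q` in view `b`. -/
def Shape (t : ℕ) (p : Fin n) (v : Value) (q : Fin n) (b : ℕ) : Msg n → Prop
  | .requestSuggestion => True
  | .suggest x => q = leader n b ∧ x.valid t p = true ∧ ∀ w ρ, x = .input w ρ → w = v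
  | .proposeKey w pr => pr.valid t w = true
  | .checkedKey ρ => q = leader n b ∧ ∃ w, ρ = tsign p (.key w b)
  | .proposeLock w σ => tverify (n - t) (.key w b) σ = true
  | .checkedLock ρ => q = leader n b ∧ ∃ w, ρ = tsign p (.lock w b)
  | .proposeCommit w σ => tverify (n - t) (.lock w b) σ = true
  | .checkedCommit ρ => q = leader n b ∧ ∃ w, ρ = tsign p (.commit w b)
  | .sendCommit c => c.isCommit t = true

/-- Well-formedness of the state of `p` and of the messages that `p` has sent. -/
structure WellFormed (t : ℕ) (p : Fin n) (v : Value) (D : Finset (Fin n)) (S : Set (Packet n))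
    (s : State n) : Prop where
  view_le : ∀ x ∈ S, x.src = p → ∃ j, s.view = some j ∧ x.view ≤ j
  shape : ∀ x ∈ S, x.src = p → Shape t p v x.dst x.view x.msg
  known : ∀ x ∈ S, x.src = p → ∀ σ, x.msg.thresholdSig = some σ → KnownSig D S σ
  key : ∀ c, s.key = some c → c.isKey t = true ∧ KnownSig D S c.proof
  lock : ∀ c, s.lock = some c →
    tverify (n - t) (.lock c.value c.view) c.proof = true ∧ KnownSig D S c.proof
  commit : ∀ c, s.commit = some c → c.isCommit t = true ∧ KnownSig D S c.proof
  decision : s.decision = s.commit.map Cert.value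
  inbox : ∀ q m, (q, m) ∈ s.inbox → (∃ k, s.view = some k ∧ (q ∈ D ∨ ⟨q, p, k, m⟩ ∈ S)) ∧
    ∀ σ, m.thresholdSig = some σ → KnownSig D S σ

/-- A received packet is authentic. -/
def Authentic (p : Fin n) (D : Finset (Fin n)) (S : Set (Packet n)) (o : Option (Packet n)) :
    Prop :=
  ∀ x, o = some x → x.dst = p ∧ (x.src ∈ D ∨ x ∈ S) ∧
    ∀ σ, x.msg.thresholdSig = some σ → KnownSig D S σ

variable {t : ℕ} {p : Fin n} {v : Value} {k : ℕ} {o : Option (Packet n)}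
  {D : Finset (Fin n)} {S : Set (Packet n)} {s s' : State n} {l : List (Packet n)}

theorem Micro.out (h : Micro t p v k o s s' l) :
    s'.view = some k ∧ ∀ x ∈ l, x.src = p ∧ x.view = k := by
  cases h
  all_goals refine ⟨by first | rfl | assumption, ?_⟩
  all_goals intro x hx
  all_goals first
    | exact absurd hx (List.not_mem_nil)
    | (rw [mem_broadcast] at hx; exact ⟨hx.1, hx.2.1⟩)
    | (rw [List.mem_singleton] at hx; subst hx; exact ⟨rfl, rfl⟩)

theorem WellFormed.knownSig_responders (hs : WellFormed t p v D S s)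
    {wrap : PartialSig n → Msg n} (hw : ∀ ρ, (wrap ρ).partialSig = some ρ) (m : Content) (j : ℕ) :
    KnownSig D S (tcombine m ((responders s.inbox wrap m).take j).toFinset) := by
  intro q hq
  have h1 := mem_responders.1 (List.mem_of_mem_take (List.mem_toFinset.1 hq))
  obtain ⟨⟨k, -, h2⟩, -⟩ := hs.inbox _ _ h1
  exact h2.imp id fun h => ⟨_, h, hw _⟩

/-- A certificate that leaves a party is either one that it stores or has received, and these are
valid with known shares, or it is combined from shares in the inbox, each of which was sent in the
clear or belongs to a corrupted party. -/
theorem Micro.wellFormed_out (ht : 3 * t < n) (hs : WellFormed t p v D S s)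
    (h : Micro t p v k o s s' l) :
    ∀ x ∈ l, Shape t p v x.dst x.view x.msg ∧
      ∀ σ, x.msg.thresholdSig = some σ → KnownSig D S σ := by
  intro x hx
  cases h with
  | enterLead h1 h2 h3 =>
    rw [mem_broadcast] at hx
    simp [hx, Shape, Msg.thresholdSig]
  | enterIdle | accept | recv | requestOld | keyReject => simp at hx
  | requestCommit c h1 h2 h3 h4 =>
    rw [List.mem_singleton] at hx; subst hx
    simpa [Shape, Suggestion.valid, Msg.thresholdSig] using hs.commit _ h4
  | requestKey c h1 h2 h3 h4 h5 =>
    rw [List.mem_singleton] at hx; subst hx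
    simpa [Shape, Suggestion.valid, Msg.thresholdSig] using hs.key _ h5
  | requestInput =>
    rw [List.mem_singleton] at hx; subst hx
    simp [Shape, Suggestion.valid, Msg.thresholdSig]
  | keyAccept w pr =>
    rw [List.mem_singleton] at hx; subst hx
    exact ⟨⟨rfl, w, rfl⟩, by simp [Msg.thresholdSig]⟩
  | setKey w pr =>
    rw [List.mem_singleton] at hx; subst hx
    exact ⟨⟨rfl, w, rfl⟩, by simp [Msg.thresholdSig]⟩
  | setLock w pr =>
    rw [List.mem_singleton] at hx; subst hx
    exact ⟨⟨rfl, w, rfl⟩, by simp [Msg.thresholdSig]⟩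
  | leadCommit c h1 h2 h3 h4 =>
    rw [mem_broadcast] at hx
    obtain ⟨q, hq⟩ := suggestedCommit_some h4
    obtain ⟨h5, h6⟩ := mem_suggestions hq
    have h7 := (hs.inbox _ _ h5).2
    simpa [hx, Shape, Msg.thresholdSig, Suggestion.valid] using And.intro h6 h7
  | leadKey c h1 h2 h3 h4 h8 =>
    rw [mem_broadcast] at hx
    obtain ⟨⟨q, hq⟩, -⟩ := suggestedKey_some h8
    obtain ⟨h5, h6⟩ := mem_suggestions hq
    have h7 := (hs.inbox _ _ h5).2
    simpa [hx, Shape, Msg.thresholdSig, Suggestion.valid, Proposal.valid] using And.intro h6 h7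
  | leadInput w σ h1 h2 h3 h4 h5 h6 h7 =>
    rw [mem_broadcast] at hx
    have hn := nodup_proposers (nodup_suggestions t s.inbox) w
    have hk : KnownSig D S σ := by
      intro q hq
      rw [h7] at hq ⊢
      simp only [tcombine, List.mem_toFinset] at hq ⊢
      obtain ⟨ρ, hρ⟩ := mem_proposers (List.mem_of_mem_take hq)
      obtain ⟨h8, h9⟩ := mem_suggestions hρ
      obtain ⟨⟨j, -, h10⟩, -⟩ := hs.inbox _ _ h8
      simp only [Suggestion.valid, decide_eq_true_eq] at h9
      subst h9
      exact h10.imp id fun h => ⟨_, h, rfl⟩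
    have hv : tverify (t + 1) (.input w) σ = true := by
      rw [h7]
      refine tverify_take hn ?_
      rw [h6]
      exact lt_length_mostCommon ht h3 h4 h5
    simpa [hx, Shape, Msg.thresholdSig, Proposal.valid] using And.intro hv hk
  | leadLock w R h1 h2 h3 h4 =>
    rw [mem_broadcast] at hx
    subst h3
    simpa [hx, Shape, Msg.thresholdSig] using
      And.intro (tverify_take (nodup_responders _ _ _) h4)
        (hs.knownSig_responders (wrap := .checkedKey) (fun _ => rfl) _ _)
  | leadPropCommit w R h1 h2 h3 h4 =>
    rw [mem_broadcast] at hx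
    subst h3
    simpa [hx, Shape, Msg.thresholdSig] using
      And.intro (tverify_take (nodup_responders _ _ _) h4)
        (hs.knownSig_responders (wrap := .checkedLock) (fun _ => rfl) _ _)
  | leadSend w R h1 h2 h3 h4 =>
    rw [mem_broadcast] at hx
    subst h3
    simpa [hx, Shape, Msg.thresholdSig, Cert.isCommit] using
      And.intro (tverify_take (nodup_responders _ _ _) h4)
        (hs.knownSig_responders (wrap := .checkedCommit) (fun _ => rfl) _ _)

theorem WellFormed.mono {S' : Set (Packet n)} {D' : Finset (Fin n)}
    (hs : WellFormed t p v D S s) (hD : D ⊆ D') (hS : S ⊆ S')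
    (hnew : ∀ x ∈ S', x.src = p → x ∈ S) : WellFormed t p v D' S' s where
  view_le x hx hp := hs.view_le x (hnew x hx hp) hp
  shape x hx hp := hs.shape x (hnew x hx hp) hp
  known x hx hp σ hσ := (hs.known x (hnew x hx hp) hp σ hσ).mono hD hS
  key c hc := (hs.key c hc).imp id fun h => h.mono hD hS
  lock c hc := (hs.lock c hc).imp id fun h => h.mono hD hS
  commit c hc := (hs.commit c hc).imp id fun h => h.mono hD hS
  decision := hs.decision
  inbox q m hm := ⟨(hs.inbox q m hm).1.imp fun _ h => ⟨h.1, h.2.imp (fun h => hD h) fun h => hS h⟩,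
    fun σ hσ => ((hs.inbox q m hm).2 σ hσ).mono hD hS⟩

theorem Micro.wellFormed (ht : 3 * t < n) (ho : Authentic p D S o) (hs : WellFormed t p v D S s)
    (h : Micro t p v k o s s' l) : WellFormed t p v D (S ∪ {x | x ∈ l}) s' := by
  have hS : S ⊆ S ∪ {x | x ∈ l} := Set.subset_union_left
  have hout := h.wellFormed_out ht hs
  have hview := h.out
  have hle : ∀ j, s.view = some j → j ≤ k := by
    intro j hj
    cases h with
    | enterLead h1 => exact (h1 j hj).le
    | enterIdle h1 => exact (h1 j hj).le
    | _ => simp_all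
  refine ⟨?_, ?_, ?_, ?_, ?_, ?_, ?_, ?_⟩
  · rintro x (hx | hx) hp
    · obtain ⟨j, hj, hxj⟩ := hs.view_le x hx hp
      exact ⟨k, hview.1, hxj.trans (hle j hj)⟩
    · exact ⟨k, hview.1, (hview.2 x hx).2.le⟩
  · rintro x (hx | hx) hp
    · exact hs.shape x hx hp
    · exact (hout x hx).1
  · rintro x (hx | hx) hp σ hσ
    · exact (hs.known x hx hp σ hσ).mono subset_rfl hS
    · exact ((hout x hx).2 σ hσ).mono subset_rfl hS
  · intro c hc
    suffices c.isKey t = true ∧ KnownSig D S c.proof from ⟨this.1, this.2.mono subset_rfl hS⟩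
    cases h with
    | setKey w σ h1 h2 h3 h4 =>
      cases hc
      exact ⟨h4, (hs.inbox _ _ h3).2 _ rfl⟩
    | _ => exact hs.key c hc
  · intro c hc
    suffices tverify (n - t) (.lock c.value c.view) c.proof = true ∧ KnownSig D S c.proof from
      ⟨this.1, this.2.mono subset_rfl hS⟩
    cases h with
    | setLock w σ h1 h2 h3 h4 =>
      cases hc
      exact ⟨h4, (hs.inbox _ _ h3).2 _ rfl⟩
    | _ => exact hs.lock c hc
  · intro c hc
    suffices c.isCommit t = true ∧ KnownSig D S c.proof from ⟨this.1, this.2.mono subset_rfl hS⟩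
    cases h with
    | accept pkt c' h1 h2 h3 h4 h5 =>
      cases hc
      refine ⟨h4, (ho _ h2).2.2 _ ?_⟩
      unfold Msg.carriedCommit at h3
      split at h3 <;> cases h3 <;> simp_all [Msg.thresholdSig]
    | _ => exact hs.commit c hc
  · cases h with
    | accept pkt c' h1 h2 h3 h4 h5 => rfl
    | _ => exact hs.decision
  · intro q m hm
    suffices (∃ k, s'.view = some k ∧ (q ∈ D ∨ ⟨q, p, k, m⟩ ∈ S)) ∧
        ∀ σ, m.thresholdSig = some σ → KnownSig D S σ from
      ⟨this.1.imp fun _ h => ⟨h.1, h.2.imp id fun h => hS h⟩,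
        fun σ hσ => (this.2 σ hσ).mono subset_rfl hS⟩
    cases h with
    | enterLead | enterIdle => simp at hm
    | recv pkt h1 h2 h3 =>
      simp only [List.mem_append, List.mem_singleton] at hm
      rcases hm with hm | hm
      · exact hs.inbox q m hm
      · obtain ⟨rfl, rfl⟩ := Prod.mk.inj hm
        obtain ⟨h4, h5, h6⟩ := ho _ h2
        refine ⟨⟨k, h1, h5.imp id fun h => ?_⟩, h6⟩
        subst h4 h3
        exact h
    | _ => exact hs.inbox q m hm

end Certificates

/-! ### Invariant of the party protocol -/

section PartyInvariant

variable {n : ℕ} [NeZero n]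

/-- The message is one of those by which a party answers the leader. -/
def Msg.isReply : Msg n → Bool
  | .suggest _ => true
  | .checkedKey _ => true
  | .checkedLock _ => true
  | .checkedCommit _ => true
  | _ => false

def Suggestion.isCommit : Suggestion n → Bool
  | .commit _ => true
  | _ => false

/-- The party protocol of `p`: how its phase and variables relate to what it has sent. -/
structure PartyInv (t : ℕ) (p : Fin n) (D : Finset (Fin n)) (S : Set (Packet n))
    (s : State n) : Prop where
  key_phase : ∀ b, s.view = some b → ∀ q ρ, ⟨p, q, b, .checkedKey ρ⟩ ∈ S →
    s.partyPhase ≠ .request ∧ s.partyPhase ≠ .proposeKey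
  key_unique : ∀ b q ρ, ⟨p, q, b, .checkedKey ρ⟩ ∈ S → ∀ q' ρ', ⟨p, q', b, .checkedKey ρ'⟩ ∈ S →
    ρ = ρ'
  lock_cert : ∀ b q w, ⟨p, q, b, .checkedLock (tsign p (.lock w b))⟩ ∈ S →
    (∃ σ, tverify (n - t) (.key w b) σ = true ∧ KnownSig D S σ)
  lock_key : ∀ b q ρ, ⟨p, q, b, .checkedLock ρ⟩ ∈ S → ∃ c, s.key = some c ∧ b ≤ c.view
  commit_cert : ∀ b q w, ⟨p, q, b, .checkedCommit (tsign p (.commit w b))⟩ ∈ S →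
    (∃ σ, tverify (n - t) (.lock w b) σ = true ∧ KnownSig D S σ)
  commit_lock : ∀ b q ρ, ⟨p, q, b, .checkedCommit ρ⟩ ∈ S → ∃ c, s.lock = some c ∧ b ≤ c.view
  -- This clause makes proposals of an uncorrupted leader compatible with locks: whoever has signed
  -- a lock holds a key of at least that view, and shows it to later leaders unless it has a commit.
  suggest_key : ∀ b q x, ⟨p, q, b, .suggest x⟩ ∈ S → x.isCommit = false →
    ∀ b' q' ρ, ⟨p, q', b', .checkedLock ρ⟩ ∈ S → b' < b → ∃ c, x = .key c ∧ b' ≤ c.view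
  lock_le : ∀ c, s.lock = some c → ∃ j, s.view = some j ∧ c.view ≤ j
  lock_lt : ∀ c, s.lock = some c → (s.partyPhase = .request ∨ s.partyPhase = .proposeKey) →
    ∀ b, s.view = some b → c.view < b
  suggest_phase : ∀ b, s.view = some b → ∀ q x, ⟨p, q, b, .suggest x⟩ ∈ S →
    s.partyPhase ≠ .request
  suggest_kind : ∀ b q x, ⟨p, q, b, .suggest x⟩ ∈ S → ∀ q' x', ⟨p, q', b, .suggest x'⟩ ∈ S →
    x.isCommit = x'.isCommit
  suggested : ∀ b, s.view = some b → s.partyPhase ≠ .request → s.partyPhase ≠ .rest →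
    ∃ x : Suggestion n, x.isCommit = false ∧ ⟨p, leader n b, b, .suggest x⟩ ∈ S
  rest : ∀ b, s.view = some b → s.partyPhase = .rest →
    (∃ x : Suggestion n, x.isCommit = false ∧ ⟨p, leader n b, b, .suggest x⟩ ∈ S) ∨
    leader n b ∈ s.commitSentTo
  sent_to : ∀ q, q ∈ s.commitSentTo → ∃ c b, ⟨p, q, b, .suggest (.commit c)⟩ ∈ S
  sent_commit : ∀ b q c, ⟨p, q, b, .suggest (.commit c)⟩ ∈ S → s.commit ≠ none
  phase_key : ∀ b, s.view = some b →
    (s.partyPhase = .proposeLock ∨ s.partyPhase = .proposeCommit) →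
    ∃ ρ, ⟨p, leader n b, b, .checkedKey ρ⟩ ∈ S
  phase_lock : ∀ b, s.view = some b → s.partyPhase = .proposeCommit →
    ∃ ρ, ⟨p, leader n b, b, .checkedLock ρ⟩ ∈ S
  lock_sent : ∀ b q ρ, ⟨p, q, b, .checkedLock ρ⟩ ∈ S → ∃ ρ, ⟨p, leader n b, b, .checkedKey ρ⟩ ∈ S
  commit_sent : ∀ b q ρ, ⟨p, q, b, .checkedCommit ρ⟩ ∈ S →
    ∃ ρ, ⟨p, leader n b, b, .checkedLock ρ⟩ ∈ S
  key_cause : ∀ b q w, ⟨p, q, b, .checkedKey (tsign p (.key w b))⟩ ∈ S →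
    leader n b ∈ D ∨ ∃ pr, ⟨leader n b, p, b, .proposeKey w pr⟩ ∈ S
  lock_cause : ∀ b q w, ⟨p, q, b, .checkedLock (tsign p (.lock w b))⟩ ∈ S →
    leader n b ∈ D ∨ ∃ σ, ⟨leader n b, p, b, .proposeLock w σ⟩ ∈ S
  commit_cause : ∀ b q w, ⟨p, q, b, .checkedCommit (tsign p (.commit w b))⟩ ∈ S →
    leader n b ∈ D ∨ ∃ σ, ⟨leader n b, p, b, .proposeCommit w σ⟩ ∈ S
  phase_cause : ∀ b, s.view = some b → s.partyPhase ≠ .request →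
    leader n b ∈ D ∨ ⟨leader n b, p, b, .requestSuggestion⟩ ∈ S
  cause : ∀ b q m, ⟨p, q, b, m⟩ ∈ S → m.isReply = true →
    leader n b ∈ D ∨ ⟨leader n b, p, b, .requestSuggestion⟩ ∈ S
  -- A party that has suggested a key or an input stops for one of two reasons only: its lock
  -- rejected a proposal, or it went through all four stages. The liveness argument excludes the
  -- first.
  rest_suggested : ∀ b, s.view = some b → s.partyPhase = .rest →
    ∀ q x, ⟨p, q, b, .suggest x⟩ ∈ S → x.isCommit = false →
    (∃ w pr c, (leader n b, Msg.proposeKey w pr) ∈ s.inbox ∧ pr.valid t w = true ∧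
      s.lock = some c ∧ c.view < b ∧ lockAllows (some c) pr = false) ∨
    ∃ ρ, ⟨p, leader n b, b, .checkedCommit ρ⟩ ∈ S

variable {t : ℕ} {p : Fin n} {v : Value} {k : ℕ} {o : Option (Packet n)}
  {D : Finset (Fin n)} {S : Set (Packet n)} {s s' : State n} {l : List (Packet n)}

/-- Where a packet of `p` is a hypothesis of a clause, it is a reply; all other occurrences are
conclusions and survive enlarging `S` and `D`. So packets of other parties and leader broadcasts of
`p` itself are harmless. -/
theorem PartyInv.mono {S' : Set (Packet n)} {D' : Finset (Fin n)}
    (h : PartyInv t p D S s) (hD : D ⊆ D') (hS : S ⊆ S')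
    (hnew : ∀ q b m, ⟨p, q, b, m⟩ ∈ S' → m.isReply = true → ⟨p, q, b, m⟩ ∈ S) :
    PartyInv t p D' S' s where
  key_phase b hb q ρ hx := h.key_phase b hb q ρ (hnew _ _ _ hx rfl)
  key_unique b q ρ hx q' ρ' hx' := h.key_unique b q ρ (hnew _ _ _ hx rfl) q' ρ' (hnew _ _ _ hx' rfl)
  lock_cert b q w hx := (h.lock_cert b q w (hnew _ _ _ hx rfl)).imp fun _ h => ⟨h.1, h.2.mono hD hS⟩
  lock_key b q ρ hx := h.lock_key b q ρ (hnew _ _ _ hx rfl)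
  commit_cert b q w hx :=
    (h.commit_cert b q w (hnew _ _ _ hx rfl)).imp fun _ h => ⟨h.1, h.2.mono hD hS⟩
  commit_lock b q ρ hx := h.commit_lock b q ρ (hnew _ _ _ hx rfl)
  suggest_key b q x hx hc b' q' ρ hx' :=
    h.suggest_key b q x (hnew _ _ _ hx rfl) hc b' q' ρ (hnew _ _ _ hx' rfl)
  lock_le := h.lock_le
  lock_lt := h.lock_lt
  suggest_phase b hb q x hx := h.suggest_phase b hb q x (hnew _ _ _ hx rfl)
  suggest_kind b q x hx q' x' hx' :=
    h.suggest_kind b q x (hnew _ _ _ hx rfl) q' x' (hnew _ _ _ hx' rfl)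
  suggested b hb h1 h2 := (h.suggested b hb h1 h2).imp fun _ h => ⟨h.1, hS h.2⟩
  rest b hb h1 := (h.rest b hb h1).imp (fun ⟨x, h1, h2⟩ => ⟨x, h1, hS h2⟩) id
  sent_to q hq := let ⟨c, b, h⟩ := h.sent_to q hq; ⟨c, b, hS h⟩
  sent_commit b q c hx := h.sent_commit b q c (hnew _ _ _ hx rfl)
  phase_key b hb h1 := (h.phase_key b hb h1).imp fun _ h => hS h
  phase_lock b hb h1 := (h.phase_lock b hb h1).imp fun _ h => hS h
  lock_sent b q ρ hx := (h.lock_sent b q ρ (hnew _ _ _ hx rfl)).imp fun _ h => hS h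
  commit_sent b q ρ hx := (h.commit_sent b q ρ (hnew _ _ _ hx rfl)).imp fun _ h => hS h
  key_cause b q w hx := (h.key_cause b q w (hnew _ _ _ hx rfl)).imp (fun h => hD h)
    fun ⟨x, h⟩ => ⟨x, hS h⟩
  lock_cause b q w hx := (h.lock_cause b q w (hnew _ _ _ hx rfl)).imp (fun h => hD h)
    fun ⟨x, h⟩ => ⟨x, hS h⟩
  commit_cause b q w hx := (h.commit_cause b q w (hnew _ _ _ hx rfl)).imp (fun h => hD h)
    fun ⟨x, h⟩ => ⟨x, hS h⟩
  phase_cause b hb h1 := (h.phase_cause b hb h1).imp (fun h => hD h) fun h => hS h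
  cause b q m hx hm := (h.cause b q m (hnew _ _ _ hx hm) hm).imp (fun h => hD h) fun h => hS h
  rest_suggested b hb h1 q x hx hc := (h.rest_suggested b hb h1 q x (hnew _ _ _ hx rfl) hc).imp id
    fun ⟨ρ, h⟩ => ⟨ρ, hS h⟩

theorem PartyInv.congr (h : PartyInv t p D S s) (h1 : s'.view = s.view) (h2 : s'.key = s.key)
    (h3 : s'.lock = s.lock) (h4 : s.commit ≠ none → s'.commit ≠ none)
    (h5 : s'.commitSentTo = s.commitSentTo) (h6 : s.inbox ⊆ s'.inbox)
    (h7 : s'.partyPhase = s.partyPhase) : PartyInv t p D S s' := by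
  constructor <;> (try rw [h1]) <;> (try rw [h2]) <;> (try rw [h3]) <;> (try rw [h5]) <;>
    (try rw [h7])
  any_goals first
    | exact h.1 | exact h.2 | exact h.3 | exact h.4 | exact h.5 | exact h.6 | exact h.7 | exact h.8
    | exact h.9 | exact h.10 | exact h.11 | exact h.12 | exact h.13 | exact h.14
    | exact h.16 | exact h.17 | exact h.18 | exact h.19 | exact h.20 | exact h.21
    | exact h.22 | exact h.23 | exact h.24
  · exact fun b q c hx => h4 (h.sent_commit b q c hx)
  · exact fun b hb hr q x hx hc => (h.rest_suggested b hb hr q x hx hc).imp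
      (fun ⟨w, pr, c, h⟩ => ⟨w, pr, c, h6 h.1, h.2⟩) id

end PartyInvariant

/-! ### The party invariant under each transition -/

section PartyInvariantSteps

variable {n : ℕ} [NeZero n]

variable {t : ℕ} {p : Fin n} {v : Value} {k : ℕ} {o : Option (Packet n)}
  {D : Finset (Fin n)} {S : Set (Packet n)} {s s' : State n} {l : List (Packet n)}

theorem mem_insert_packet {q r : Fin n} {b b' : ℕ} {m m' : Msg n} :
    (⟨p, q, b, m⟩ : Packet n) ∈ insert (⟨p, r, b', m'⟩ : Packet n) S ↔
      (q = r ∧ b = b' ∧ m = m') ∨ (⟨p, q, b, m⟩ : Packet n) ∈ S := by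
  simp [Set.mem_insert_iff]

theorem PartyInv.enter (hv : ∀ q b m, ⟨p, q, b, m⟩ ∈ S → ∃ j, s.view = some j ∧ b ≤ j)
    (h : PartyInv t p D S s) (hk : ∀ j, s.view = some j → j < k) (ph : LeaderPhase) :
    PartyInv t p D S
      { s with view := some k, inbox := [], partyPhase := .request, leaderPhase := ph } := by
  -- Nothing has been sent yet in the view that is entered, so what the clauses say about messages
  -- of the current view is vacuous.
  have hlt : ∀ q m, ⟨p, q, k, m⟩ ∉ S := fun q m hx => by
    obtain ⟨j, hj, hkj⟩ := hv _ _ _ hx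
    exact absurd (hk j hj) (by omega)
  obtain ⟨a1, a2, a3, a4, a5, a6, a7, a8, a9, a10, a11, a12, a13, a14, a15, a16, a17, a18, a19,
    a20, a21, a22, a23, a24, a25⟩ := h
  constructor
  all_goals try dsimp only
  all_goals first | assumption | grind

theorem PartyInv.requestOld (hin : ∀ q m, (q, m) ∈ s.inbox → q ∈ D ∨ ⟨q, p, k, m⟩ ∈ S)
    (h : PartyInv t p D S s) (h1 : s.view = some k) (h2 : s.partyPhase = .request)
    (h3 : (leader n k, Msg.requestSuggestion) ∈ s.inbox) (h5 : leader n k ∈ s.commitSentTo) :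
    PartyInv t p D S { s with partyPhase := .rest } := by
  have hr := hin _ _ h3
  obtain ⟨a1, a2, a3, a4, a5, a6, a7, a8, a9, a10, a11, a12, a13, a14, a15, a16, a17, a18, a19,
    a20, a21, a22, a23, a24, a25⟩ := h
  constructor
  all_goals try dsimp only
  all_goals first | assumption | grind

theorem PartyInv.requestCommit (_hv : ∀ q b m, ⟨p, q, b, m⟩ ∈ S → b ≤ k)
    (hin : ∀ q m, (q, m) ∈ s.inbox → q ∈ D ∨ ⟨q, p, k, m⟩ ∈ S)
    (h : PartyInv t p D S s) (h1 : s.view = some k) (h2 : s.partyPhase = .request)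
    (h3 : (leader n k, Msg.requestSuggestion) ∈ s.inbox) {c : Cert n} (h4 : s.commit = some c) :
    PartyInv t p D (insert ⟨p, leader n k, k, .suggest (.commit c)⟩ S)
      { s with partyPhase := .rest, commitSentTo := insert (leader n k) s.commitSentTo } := by
  have hr := hin _ _ h3
  have hS := Set.subset_insert (⟨p, leader n k, k, .suggest (.commit c)⟩ : Packet n) S
  have hK : ∀ σ, KnownSig D S σ → KnownSig D (insert _ S) σ := fun σ h => h.mono subset_rfl hS
  obtain ⟨a1, a2, a3, a4, a5, a6, a7, a8, a9, a10, a11, a12, a13, a14, a15, a16, a17, a18, a19,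
    a20, a21, a22, a23, a24, a25⟩ := h
  constructor
  all_goals try dsimp only
  all_goals try simp only [mem_insert_packet]
  all_goals grind [Msg.isReply, Suggestion.isCommit]

/-- Suggesting a key and suggesting an input are treated together; `h5` says that an existing key
takes precedence. -/
theorem PartyInv.requestSuggest (_hv : ∀ q b m, ⟨p, q, b, m⟩ ∈ S → b ≤ k)
    (hin : ∀ q m, (q, m) ∈ s.inbox → q ∈ D ∨ ⟨q, p, k, m⟩ ∈ S)
    (h : PartyInv t p D S s) (h1 : s.view = some k) (h2 : s.partyPhase = .request)
    (h3 : (leader n k, Msg.requestSuggestion) ∈ s.inbox) {x : Suggestion n}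
    (h4 : x.isCommit = false) (h5 : ∀ c, s.key = some c → x = .key c) :
    PartyInv t p D (insert ⟨p, leader n k, k, .suggest x⟩ S)
      { s with partyPhase := .proposeKey } := by
  have hr := hin _ _ h3
  have hS := Set.subset_insert (⟨p, leader n k, k, .suggest x⟩ : Packet n) S
  have hK : ∀ σ, KnownSig D S σ → KnownSig D (insert _ S) σ := fun σ h => h.mono subset_rfl hS
  obtain ⟨a1, a2, a3, a4, a5, a6, a7, a8, a9, a10, a11, a12, a13, a14, a15, a16, a17, a18, a19,
    a20, a21, a22, a23, a24, a25⟩ := h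
  constructor
  all_goals try dsimp only
  all_goals try simp only [mem_insert_packet]
  all_goals grind [Msg.isReply, Suggestion.isCommit]

theorem PartyInv.keyReject
    (h : PartyInv t p D S s) (h1 : s.view = some k) (h2 : s.partyPhase = .proposeKey)
    {w : Value} {pr : Proposal n} (h3 : (leader n k, Msg.proposeKey w pr) ∈ s.inbox)
    (h4 : pr.valid t w = true) (h5 : lockAllows s.lock pr = false) :
    PartyInv t p D S { s with partyPhase := .rest } := by
  obtain ⟨c, hc⟩ : ∃ c, s.lock = some c := by
    rcases hc : s.lock with _ | c
    · simp [hc, lockAllows] at h5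
    · exact ⟨c, rfl⟩
  obtain ⟨a1, a2, a3, a4, a5, a6, a7, a8, a9, a10, a11, a12, a13, a14, a15, a16, a17, a18, a19,
    a20, a21, a22, a23, a24, a25⟩ := h
  constructor
  all_goals try dsimp only
  all_goals first | assumption | grind

theorem tsign_key_inj {w w' : Value} {b b' : ℕ}
    (h : tsign p (.key w b) = tsign p (.key w' b')) : w = w' ∧ b = b' := by
  simpa [tsign] using h

theorem tsign_lock_inj {w w' : Value} {b b' : ℕ}
    (h : tsign p (.lock w b) = tsign p (.lock w' b')) : w = w' ∧ b = b' := by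
  simpa [tsign] using h

theorem tsign_commit_inj {w w' : Value} {b b' : ℕ}
    (h : tsign p (.commit w b) = tsign p (.commit w' b')) : w = w' ∧ b = b' := by
  simpa [tsign] using h

theorem PartyInv.keyAccept (_hv : ∀ q b m, ⟨p, q, b, m⟩ ∈ S → b ≤ k)
    (hin : ∀ q m, (q, m) ∈ s.inbox → q ∈ D ∨ ⟨q, p, k, m⟩ ∈ S)
    (h : PartyInv t p D S s) (h1 : s.view = some k) (h2 : s.partyPhase = .proposeKey)
    {w : Value} {pr : Proposal n} (h3 : (leader n k, Msg.proposeKey w pr) ∈ s.inbox) :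
    PartyInv t p D (insert ⟨p, leader n k, k, .checkedKey (tsign p (.key w k))⟩ S)
      { s with partyPhase := .proposeLock } := by
  have hr := hin _ _ h3
  have hS := Set.subset_insert
    (⟨p, leader n k, k, .checkedKey (tsign p (.key w k))⟩ : Packet n) S
  have hK : ∀ σ, KnownSig D S σ → KnownSig D (insert _ S) σ := fun σ h => h.mono subset_rfl hS
  have hi := @tsign_key_inj n _ p
  obtain ⟨a1, a2, a3, a4, a5, a6, a7, a8, a9, a10, a11, a12, a13, a14, a15, a16, a17, a18, a19,
    a20, a21, a22, a23, a24, a25⟩ := h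
  constructor
  all_goals try dsimp only
  all_goals try simp only [mem_insert_packet]
  all_goals grind [Msg.isReply, Suggestion.isCommit]

theorem PartyInv.setKey (hv : ∀ q b m, ⟨p, q, b, m⟩ ∈ S → b ≤ k)
    (hin : ∀ q m, (q, m) ∈ s.inbox → q ∈ D ∨ ⟨q, p, k, m⟩ ∈ S)
    (hin' : ∀ q m, (q, m) ∈ s.inbox → ∀ σ, m.thresholdSig = some σ → KnownSig D S σ)
    (h : PartyInv t p D S s) (h1 : s.view = some k) (h2 : s.partyPhase = .proposeLock)
    {w : Value} {σ : ThresholdSig n} (h3 : (leader n k, Msg.proposeLock w σ) ∈ s.inbox)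
    (h4 : tverify (n - t) (.key w k) σ = true) :
    PartyInv t p D (insert ⟨p, leader n k, k, .checkedLock (tsign p (.lock w k))⟩ S)
      { s with partyPhase := .proposeCommit, key := some ⟨w, k, σ⟩ } := by
  have hr := hin _ _ h3
  have hS := Set.subset_insert
    (⟨p, leader n k, k, .checkedLock (tsign p (.lock w k))⟩ : Packet n) S
  have hK : ∀ σ, KnownSig D S σ → KnownSig D (insert _ S) σ := fun σ h => h.mono subset_rfl hS
  have hσ := hin' _ _ h3 _ rfl
  have hi := @tsign_lock_inj n _ p
  obtain ⟨a1, a2, a3, a4, a5, a6, a7, a8, a9, a10, a11, a12, a13, a14, a15, a16, a17, a18, a19,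
    a20, a21, a22, a23, a24, a25⟩ := h
  constructor
  all_goals try dsimp only
  all_goals try simp only [mem_insert_packet]
  all_goals grind [Msg.isReply, Suggestion.isCommit]

theorem PartyInv.setLock (hv : ∀ q b m, ⟨p, q, b, m⟩ ∈ S → b ≤ k)
    (hin : ∀ q m, (q, m) ∈ s.inbox → q ∈ D ∨ ⟨q, p, k, m⟩ ∈ S)
    (hin' : ∀ q m, (q, m) ∈ s.inbox → ∀ σ, m.thresholdSig = some σ → KnownSig D S σ)
    (h : PartyInv t p D S s) (h1 : s.view = some k) (h2 : s.partyPhase = .proposeCommit)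
    {w : Value} {σ : ThresholdSig n} (h3 : (leader n k, Msg.proposeCommit w σ) ∈ s.inbox)
    (h4 : tverify (n - t) (.lock w k) σ = true) :
    PartyInv t p D (insert ⟨p, leader n k, k, .checkedCommit (tsign p (.commit w k))⟩ S)
      { s with partyPhase := .rest, lock := some ⟨w, k, σ⟩ } := by
  have hr := hin _ _ h3
  have hS := Set.subset_insert
    (⟨p, leader n k, k, .checkedCommit (tsign p (.commit w k))⟩ : Packet n) S
  have hK : ∀ σ, KnownSig D S σ → KnownSig D (insert _ S) σ := fun σ h => h.mono subset_rfl hS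
  have hσ := hin' _ _ h3 _ rfl
  have hi := @tsign_commit_inj n _ p
  obtain ⟨a1, a2, a3, a4, a5, a6, a7, a8, a9, a10, a11, a12, a13, a14, a15, a16, a17, a18, a19,
    a20, a21, a22, a23, a24, a25⟩ := h
  constructor
  all_goals try dsimp only
  all_goals try simp only [mem_insert_packet]
  all_goals grind [Msg.isReply, Suggestion.isCommit]

end PartyInvariantSteps

/-! ### Invariant of the leader protocol -/

section LeaderInvariant

variable {n : ℕ} [NeZero n]

/-- The message `m` of view `b` has been sent by `p` to all. -/
def SentToAll (S : Set (Packet n)) (p : Fin n) (b : ℕ) (m : Msg n) : Prop :=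
  ∀ q, ⟨p, q, b, m⟩ ∈ S

/-- The leader protocol of `p`: how its phase relates to what it has sent. -/
structure LeaderInv (t : ℕ) (p : Fin n) (D : Finset (Fin n)) (S : Set (Packet n))
    (s : State n) : Prop where
  active : ∀ b, s.view = some b → s.leaderPhase ≠ .off →
    p = leader n b ∧ SentToAll S p b .requestSuggestion
  request_progress : ∀ b, s.view = some b → ∀ q, ⟨p, q, b, .requestSuggestion⟩ ∈ S →
    s.leaderPhase = .suggest ∨ (∃ w pr, SentToAll S p b (.proposeKey w pr)) ∨
      ∃ c, SentToAll S p b (.sendCommit c)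
  key_phase : ∀ b, s.view = some b → ∀ q w pr, ⟨p, q, b, .proposeKey w pr⟩ ∈ S →
    s.leaderPhase ≠ .suggest
  key_progress : ∀ b, s.view = some b → ∀ q w pr, ⟨p, q, b, .proposeKey w pr⟩ ∈ S →
    s.leaderPhase = .checkedKey w ∨ ∃ σ, SentToAll S p b (.proposeLock w σ)
  lock_progress : ∀ b, s.view = some b → ∀ q w σ, ⟨p, q, b, .proposeLock w σ⟩ ∈ S →
    s.leaderPhase = .checkedLock w ∨ ∃ σ, SentToAll S p b (.proposeCommit w σ)
  commit_progress : ∀ b, s.view = some b → ∀ q w σ, ⟨p, q, b, .proposeCommit w σ⟩ ∈ S →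
    s.leaderPhase = .checkedCommit w ∨ ∃ c, SentToAll S p b (.sendCommit c)
  key_unique : ∀ b q w pr, ⟨p, q, b, .proposeKey w pr⟩ ∈ S →
    ∀ q' w' pr', ⟨p, q', b, .proposeKey w' pr'⟩ ∈ S → w = w'
  lock_key : ∀ b q w σ, ⟨p, q, b, .proposeLock w σ⟩ ∈ S →
    ∃ pr, SentToAll S p b (.proposeKey w pr)
  commit_key : ∀ b q w σ, ⟨p, q, b, .proposeCommit w σ⟩ ∈ S →
    ∃ pr, SentToAll S p b (.proposeKey w pr)
  phase_key : ∀ b, s.view = some b → ∀ w, (s.leaderPhase = .checkedKey w ∨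
    s.leaderPhase = .checkedLock w ∨ s.leaderPhase = .checkedCommit w) →
    ∃ pr, SentToAll S p b (.proposeKey w pr)
  proposal : ∀ b q w pr, ⟨p, q, b, .proposeKey w pr⟩ ∈ S →
    ∃ Q : Finset (Fin n), n - t ≤ Q.card ∧ ∀ q ∈ Q, ∃ x : Suggestion n, x.isCommit = false ∧
      (q ∈ D ∨ ⟨q, p, b, .suggest x⟩ ∈ S) ∧
      ∀ c, x = .key c → ∃ c', pr = .key c' ∧ c.view ≤ c'.view
  request_sent : ∀ b q m, ⟨p, q, b, m⟩ ∈ S → m.isReply = false →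
    p = leader n b ∧ SentToAll S p b .requestSuggestion

variable {t : ℕ} {p : Fin n} {v : Value} {k : ℕ} {o : Option (Packet n)}
  {D : Finset (Fin n)} {S : Set (Packet n)} {s s' : State n} {l : List (Packet n)}

theorem LeaderInv.mono {S' : Set (Packet n)} {D' : Finset (Fin n)}
    (h : LeaderInv t p D S s) (hD : D ⊆ D') (hS : S ⊆ S')
    (hnew : ∀ q b m, ⟨p, q, b, m⟩ ∈ S' → m.isReply = false → ⟨p, q, b, m⟩ ∈ S) :
    LeaderInv t p D' S' s where
  active b hb h1 := (h.active b hb h1).imp id fun h q => hS (h q)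
  request_progress b hb q hx := (h.request_progress b hb q (hnew _ _ _ hx rfl)).imp id
    (Or.imp (fun ⟨w, pr, h⟩ => ⟨w, pr, fun q => hS (h q)⟩) fun ⟨c, h⟩ => ⟨c, fun q => hS (h q)⟩)
  key_phase b hb q w pr hx := h.key_phase b hb q w pr (hnew _ _ _ hx rfl)
  key_progress b hb q w pr hx := (h.key_progress b hb q w pr (hnew _ _ _ hx rfl)).imp id
    fun ⟨c, h⟩ => ⟨c, fun q => hS (h q)⟩
  lock_progress b hb q w σ hx := (h.lock_progress b hb q w σ (hnew _ _ _ hx rfl)).imp id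
    fun ⟨c, h⟩ => ⟨c, fun q => hS (h q)⟩
  commit_progress b hb q w σ hx := (h.commit_progress b hb q w σ (hnew _ _ _ hx rfl)).imp id
    fun ⟨c, h⟩ => ⟨c, fun q => hS (h q)⟩
  key_unique b q w pr hx q' w' pr' hx' :=
    h.key_unique b q w pr (hnew _ _ _ hx rfl) q' w' pr' (hnew _ _ _ hx' rfl)
  lock_key b q w σ hx :=
    let ⟨pr, h⟩ := h.lock_key b q w σ (hnew _ _ _ hx rfl)
    ⟨pr, fun q => hS (h q)⟩
  commit_key b q w σ hx :=
    let ⟨pr, h⟩ := h.commit_key b q w σ (hnew _ _ _ hx rfl); ⟨pr, fun q => hS (h q)⟩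
  phase_key b hb w hw := let ⟨pr, h⟩ := h.phase_key b hb w hw; ⟨pr, fun q => hS (h q)⟩
  proposal b q w pr hx :=
    let ⟨Q, h1, h2⟩ := h.proposal b q w pr (hnew _ _ _ hx rfl)
    ⟨Q, h1, fun q hq => let ⟨x, h3, h4, h5⟩ := h2 q hq
      ⟨x, h3, h4.imp (fun h => hD h) fun h => hS h, h5⟩⟩
  request_sent b q m hx hm := (h.request_sent b q m (hnew _ _ _ hx hm) hm).imp id
    fun h q => hS (h q)

theorem LeaderInv.congr (h : LeaderInv t p D S s) (h1 : s'.view = s.view)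
    (h2 : s'.leaderPhase = s.leaderPhase) : LeaderInv t p D S s' := by
  constructor <;> (try rw [h1]) <;> (try rw [h2])
  exacts [h.1, h.2, h.3, h.4, h.5, h.6, h.7, h.8, h.9, h.10, h.11, h.12]

theorem mem_union_broadcast {q : Fin n} {b b' : ℕ} {m m' : Msg n} :
    (⟨p, q, b, m⟩ : Packet n) ∈ S ∪ {x | x ∈ broadcast p b' m'} ↔
      (b = b' ∧ m = m') ∨ (⟨p, q, b, m⟩ : Packet n) ∈ S := by
  simp [mem_broadcast, or_comm]

theorem sentToAll_union_broadcast {b b' : ℕ} {m m' : Msg n} :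
    SentToAll (S ∪ {x | x ∈ broadcast p b' m'}) p b m ↔
      (b = b' ∧ m = m') ∨ SentToAll S p b m := by
  simp only [SentToAll, mem_union_broadcast, forall_or_left]

theorem LeaderInv.enter (hv : ∀ q b m, ⟨p, q, b, m⟩ ∈ S → ∃ j, s.view = some j ∧ b ≤ j)
    (h : LeaderInv t p D S s) (hk : ∀ j, s.view = some j → j < k) :
    LeaderInv t p D S
      { s with view := some k, inbox := [], partyPhase := .request, leaderPhase := .off } := by
  have hlt : ∀ q m, ⟨p, q, k, m⟩ ∉ S := fun q m hx => by
    obtain ⟨j, hj, hkj⟩ := hv _ _ _ hx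
    exact absurd (hk j hj) (by omega)
  obtain ⟨a1, a2, a3, a4, a5, a6, a7, a8, a9, a10, a11, a12⟩ := h
  constructor
  all_goals try dsimp only
  all_goals first | assumption | grind

theorem LeaderInv.request (hv : ∀ q b m, ⟨p, q, b, m⟩ ∈ S → ∃ j, s.view = some j ∧ b ≤ j)
    (h : LeaderInv t p D S s) (hk : ∀ j, s.view = some j → j < k) (hp : p = leader n k) :
    LeaderInv t p D (S ∪ {x | x ∈ broadcast p k .requestSuggestion})
      { s with view := some k, inbox := [], partyPhase := .request, leaderPhase := .suggest } := by
  have hlt : ∀ q m, ⟨p, q, k, m⟩ ∉ S := fun q m hx => by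
    obtain ⟨j, hj, hkj⟩ := hv _ _ _ hx
    exact absurd (hk j hj) (by omega)
  have hP : ∀ q b w pr, (⟨p, q, b, .proposeKey w pr⟩ : Packet n) ∈
      S ∪ {x | x ∈ broadcast p k .requestSuggestion} → ⟨p, q, b, .proposeKey w pr⟩ ∈ S := by
    intro q b w pr hx
    simpa using mem_union_broadcast.1 hx
  obtain ⟨a1, a2, a3, a4, a5, a6, a7, a8, a9, a10, a11, a12⟩ := h
  constructor
  -- The suggestions in this clause are packets of other parties, so the rewriting rules for packets
  -- of `p` do not apply to them and the clause is handled separately.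
  case proposal =>
    intro b q w pr hx
    obtain ⟨Q, h1, h2⟩ := a11 b q w pr (hP _ _ _ _ hx)
    exact ⟨Q, h1, fun q hq => let ⟨x, h3, h4, h5⟩ := h2 q hq
      ⟨x, h3, h4.imp id fun h => Or.inl h, h5⟩⟩
  all_goals try dsimp only
  all_goals simp only [mem_union_broadcast, sentToAll_union_broadcast]
  all_goals grind

/-- Every leader transition after the request is a change of phase together with one broadcast. The
five alternatives of `hm` list them, with proposals of keys and of inputs merged; a proposal must
come with the quorum of suggestions on which it is based. -/
theorem LeaderInv.lead (h : LeaderInv t p D S s) (h1 : s.view = some k) {m : Msg n}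
    {ph : LeaderPhase}
    (hm : (s.leaderPhase = .suggest ∧ ∃ c, m = .sendCommit c ∧ ph = .off) ∨
      (s.leaderPhase = .suggest ∧ ∃ w pr, m = .proposeKey w pr ∧ ph = .checkedKey w ∧
        ∃ Q : Finset (Fin n), n - t ≤ Q.card ∧ ∀ q ∈ Q, ∃ x : Suggestion n, x.isCommit = false ∧
          (q ∈ D ∨ ⟨q, p, k, .suggest x⟩ ∈ S) ∧
          ∀ c, x = .key c → ∃ c', pr = .key c' ∧ c.view ≤ c'.view) ∨
      (∃ w σ, s.leaderPhase = .checkedKey w ∧ m = .proposeLock w σ ∧ ph = .checkedLock w) ∨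
      (∃ w σ, s.leaderPhase = .checkedLock w ∧ m = .proposeCommit w σ ∧ ph = .checkedCommit w) ∨
      (∃ w c, s.leaderPhase = .checkedCommit w ∧ m = .sendCommit c ∧ ph = .off)) :
    LeaderInv t p D (S ∪ {x | x ∈ broadcast p k m}) { s with leaderPhase := ph } := by
  have hne : s.leaderPhase ≠ .off := by
    rcases hm with ⟨hm, -⟩ | ⟨hm, -⟩ | ⟨w, σ, hm, -⟩ | ⟨w, σ, hm, -⟩ | ⟨w, σ, hm, -⟩ <;> simp [hm]
  obtain ⟨hp, hreq⟩ := h.active k h1 hne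
  constructor
  case proposal =>
    have key : ∀ b (pr : Proposal n) (Q : Finset (Fin n)), (n - t ≤ Q.card ∧ ∀ q ∈ Q,
        ∃ x : Suggestion n, x.isCommit = false ∧ (q ∈ D ∨ ⟨q, p, b, .suggest x⟩ ∈ S) ∧
          ∀ c, x = .key c → ∃ c', pr = .key c' ∧ c.view ≤ c'.view) →
        n - t ≤ Q.card ∧ ∀ q ∈ Q, ∃ x : Suggestion n, x.isCommit = false ∧
          (q ∈ D ∨ ⟨q, p, b, .suggest x⟩ ∈ S ∪ {x | x ∈ broadcast p k m}) ∧
          ∀ c, x = .key c → ∃ c', pr = .key c' ∧ c.view ≤ c'.view :=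
      fun b pr Q ⟨h1, h2⟩ => ⟨h1, fun q hq => let ⟨x, h3, h4, h5⟩ := h2 q hq
        ⟨x, h3, h4.imp id fun h => Or.inl h, h5⟩⟩
    intro b q w pr hx
    rw [mem_union_broadcast] at hx
    refine Exists.imp (key b pr) ?_
    rcases hx with ⟨rfl, rfl⟩ | hx
    · grind
    · exact h.proposal b q w pr hx
  all_goals obtain ⟨a1, a2, a3, a4, a5, a6, a7, a8, a9, a10, a11, a12⟩ := h
  all_goals try dsimp only
  all_goals simp only [mem_union_broadcast, sentToAll_union_broadcast, exists_or]
  all_goals have hAll : ∀ b m, SentToAll S p b m → ⟨p, p, b, m⟩ ∈ S := fun b m h => h p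
  all_goals clear a11
  all_goals rcases hm with ⟨hm, c, rfl, rfl⟩ | ⟨hm, w₀, pr₀, rfl, rfl, -⟩ | ⟨w₀, σ₀, hm, rfl, rfl⟩ |
    ⟨w₀, σ₀, hm, rfl, rfl⟩ | ⟨w₀, c₀, hm, rfl, rfl⟩
  all_goals try simp only [reduceCtorEq, Msg.proposeKey.injEq, Msg.proposeLock.injEq,
    Msg.proposeCommit.injEq, Msg.sendCommit.injEq, and_false, false_or, exists_false,
    exists_and_left, exists_eq, and_true]
  all_goals first
    | grind
    -- The later broadcasts refer back to the key proposal of the same value, which the phase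
    -- remembers.
    | (obtain ⟨pr₁, hpr₁⟩ := a10 k h1 w₀ (by simp [hm]); grind)

end LeaderInvariant

/-! ### The combined local invariant -/

section LocalInvariant

variable {n : ℕ} [NeZero n]

variable {t : ℕ} {p : Fin n} {v : Value} {k : ℕ} {o : Option (Packet n)}
  {D : Finset (Fin n)} {S : Set (Packet n)} {s s' : State n} {l : List (Packet n)}

theorem union_nil : S ∪ {x | x ∈ ([] : List (Packet n))} = S := by simp

theorem union_singleton (y : Packet n) : S ∪ {x | x ∈ [y]} = insert y S := by
  ext x; simp [or_comm]

theorem Micro.party (h : Micro t p v k o s s' l) (hw : WellFormed t p v D S s)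
    (hs : PartyInv t p D S s) : PartyInv t p D (S ∪ {x | x ∈ l}) s' := by
  have hv : ∀ q b m, ⟨p, q, b, m⟩ ∈ S → ∃ j, s.view = some j ∧ b ≤ j :=
    fun q b m hx => hw.view_le _ hx rfl
  have hv' : s.view = some k → ∀ q b m, ⟨p, q, b, m⟩ ∈ S → b ≤ k := fun h1 q b m hx => by
    obtain ⟨j, hj, hb⟩ := hv q b m hx
    rw [h1] at hj
    cases hj
    exact hb
  have hin : s.view = some k → ∀ q m, (q, m) ∈ s.inbox → q ∈ D ∨ ⟨q, p, k, m⟩ ∈ S :=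
    fun h1 q m hm => by
      obtain ⟨⟨j, hj, hb⟩, -⟩ := hw.inbox q m hm
      rw [h1] at hj
      cases hj
      exact hb
  have hin' := fun q m hm => (hw.inbox q m hm).2
  have hlead : ∀ (m : Msg n) (ph : LeaderPhase), m.isReply = false →
      PartyInv t p D (S ∪ {x | x ∈ broadcast p k m}) { s with leaderPhase := ph } := by
    intro m ph hm
    refine (hs.congr (s' := { s with leaderPhase := ph }) rfl rfl rfl id rfl
      (List.Subset.refl _) rfl).mono subset_rfl Set.subset_union_left ?_
    intro q b m' hx hm'
    rcases mem_union_broadcast.1 hx with ⟨-, rfl⟩ | hx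
    · simp [hm] at hm'
    · exact hx
  cases h with
  | enterLead h1 h2 h3 =>
    refine (hs.enter hv h1 .suggest).mono subset_rfl Set.subset_union_left ?_
    intro q b m' hx hm'
    rcases mem_union_broadcast.1 hx with ⟨-, rfl⟩ | hx
    · simp [Msg.isReply] at hm'
    · exact hx
  | enterIdle h1 h2 => rw [union_nil]; exact hs.enter hv h1 .off
  | accept pkt c h1 h2 h3 h4 h5 =>
    rw [union_nil]
    exact hs.congr rfl rfl rfl (by simp) rfl (List.Subset.refl _) rfl
  | recv pkt h1 h2 h3 =>
    rw [union_nil]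
    exact hs.congr rfl rfl rfl id rfl (by simp) rfl
  | requestOld h1 h2 h3 h4 h5 => rw [union_nil]; exact hs.requestOld (hin h1) h1 h2 h3 h5
  | requestCommit c h1 h2 h3 h4 h5 =>
    rw [union_singleton]; exact hs.requestCommit (hv' h1) (hin h1) h1 h2 h3 h4
  | requestKey c h1 h2 h3 h4 h5 =>
    rw [union_singleton]
    exact hs.requestSuggest (hv' h1) (hin h1) h1 h2 h3 rfl (by simp [h5])
  | requestInput h1 h2 h3 h4 h5 =>
    rw [union_singleton]
    exact hs.requestSuggest (hv' h1) (hin h1) h1 h2 h3 rfl (by simp [h5])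
  | keyAccept w pr h1 h2 h3 h4 h5 =>
    rw [union_singleton]; exact hs.keyAccept (hv' h1) (hin h1) h1 h2 h3
  | keyReject w pr h1 h2 h3 h4 h5 => rw [union_nil]; exact hs.keyReject h1 h2 h3 h4 h5
  | setKey w σ h1 h2 h3 h4 =>
    rw [union_singleton]; exact hs.setKey (hv' h1) (hin h1) hin' h1 h2 h3 h4
  | setLock w σ h1 h2 h3 h4 =>
    rw [union_singleton]; exact hs.setLock (hv' h1) (hin h1) hin' h1 h2 h3 h4
  | leadCommit | leadKey | leadInput | leadLock | leadPropCommit | leadSend => exact hlead _ _ rfl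

theorem exists_suggesters {inbox : List (Fin n × Msg n)}
    (h1 : n - t ≤ (suggestions t inbox).length)
    (h2 : suggestedCommit (suggestions t inbox) = none) :
    ∃ Q : Finset (Fin n), n - t ≤ Q.card ∧ ∀ q ∈ Q, ∃ x : Suggestion n, x.isCommit = false ∧
      (q, Msg.suggest x) ∈ inbox ∧ (q, x) ∈ suggestions t inbox := by
  refine ⟨((suggestions t inbox).map Prod.fst).toFinset, ?_, ?_⟩
  · rw [List.toFinset_card_of_nodup (nodup_suggestions t inbox), List.length_map]
    exact h1
  · intro q hq
    simp only [List.mem_toFinset, List.mem_map] at hq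
    obtain ⟨⟨q', x⟩, hx, rfl⟩ := hq
    refine ⟨x, ?_, (mem_suggestions hx).1, hx⟩
    have := suggestedCommit_none h2 hx
    cases x <;> simp_all [Suggestion.isCommit]

theorem Micro.leader (h : Micro t p v k o s s' l) (hw : WellFormed t p v D S s)
    (hs : LeaderInv t p D S s) : LeaderInv t p D (S ∪ {x | x ∈ l}) s' := by
  have hv : ∀ q b m, ⟨p, q, b, m⟩ ∈ S → ∃ j, s.view = some j ∧ b ≤ j :=
    fun q b m hx => hw.view_le _ hx rfl
  have hin : s.view = some k → ∀ q m, (q, m) ∈ s.inbox → q ∈ D ∨ ⟨q, p, k, m⟩ ∈ S :=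
    fun h1 q m hm => by
      obtain ⟨⟨j, hj, hb⟩, -⟩ := hw.inbox q m hm
      rw [h1] at hj
      cases hj
      exact hb
  have hreply : ∀ (y : Packet n) (s' : State n), y.msg.isReply = true → s'.view = s.view →
      s'.leaderPhase = s.leaderPhase → LeaderInv t p D (S ∪ {x | x ∈ [y]}) s' := by
    intro y s' hy h1 h2
    refine (hs.congr h1 h2).mono subset_rfl Set.subset_union_left ?_
    rintro q b m (hx | hx) hm
    · exact hx
    · replace hx := List.mem_singleton.1 hx
      subst hx
      simp [hm] at hy
  cases h with
  | enterLead h1 h2 h3 => exact hs.request hv h1 h2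
  | enterIdle h1 h2 => rw [union_nil]; exact hs.enter hv h1
  | accept | recv | requestOld | keyReject =>
    rw [union_nil]
    exact hs.congr rfl rfl
  | requestCommit | requestKey | requestInput | keyAccept | setKey | setLock =>
    exact hreply _ _ rfl rfl rfl
  | leadCommit c h1 h2 h3 h4 => exact hs.lead h1 (.inl ⟨h2, c, rfl, rfl⟩)
  | leadKey c h1 h2 h3 h4 h5 =>
    refine hs.lead h1 (.inr (.inl ⟨h2, _, _, rfl, rfl, ?_⟩))
    obtain ⟨Q, hQ, hx⟩ := exists_suggesters h3 h4
    refine ⟨Q, hQ, fun q hq => ?_⟩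
    obtain ⟨x, hx1, hx2, hx3⟩ := hx q hq
    refine ⟨x, hx1, hin h1 _ _ hx2, ?_⟩
    rintro c' rfl
    exact ⟨c, rfl, (suggestedKey_some h5).2 q c' hx3⟩
  | leadInput w σ h1 h2 h3 h4 h5 h6 h7 =>
    refine hs.lead h1 (.inr (.inl ⟨h2, _, _, rfl, rfl, ?_⟩))
    obtain ⟨Q, hQ, hx⟩ := exists_suggesters h3 h4
    refine ⟨Q, hQ, fun q hq => ?_⟩
    obtain ⟨x, hx1, hx2, hx3⟩ := hx q hq
    refine ⟨x, hx1, hin h1 _ _ hx2, ?_⟩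
    rintro c' rfl
    exact absurd hx3 (suggestedKey_none h5 q c')
  | leadLock w R h1 h2 h3 h4 => exact hs.lead h1 (.inr (.inr (.inl ⟨w, _, h2, rfl, rfl⟩)))
  | leadPropCommit w R h1 h2 h3 h4 =>
    exact hs.lead h1 (.inr (.inr (.inr (.inl ⟨w, _, h2, rfl, rfl⟩))))
  | leadSend w R h1 h2 h3 h4 =>
    exact hs.lead h1 (.inr (.inr (.inr (.inr ⟨w, _, h2, rfl, rfl⟩))))

/-- All that is known of the state of `p` in relation to the messages sent. -/
structure LocalInv (t : ℕ) (p : Fin n) (v : Value) (D : Finset (Fin n)) (S : Set (Packet n))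
    (s : State n) : Prop where
  wf : WellFormed t p v D S s
  party : PartyInv t p D S s
  lead : LeaderInv t p D S s

theorem LocalInv.mono {S' : Set (Packet n)} {D' : Finset (Fin n)}
    (h : LocalInv t p v D S s) (hD : D ⊆ D') (hS : S ⊆ S')
    (hnew : ∀ x ∈ S', x.src = p → x ∈ S) : LocalInv t p v D' S' s :=
  ⟨h.wf.mono hD hS hnew, h.party.mono hD hS fun _ _ _ hx _ => hnew _ hx rfl,
    h.lead.mono hD hS fun _ _ _ hx _ => hnew _ hx rfl⟩

theorem LocalInv.start : LocalInv t p v D ∅ (State.start n) := by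
  refine ⟨?_, ?_, ?_⟩
  · constructor <;> simp [State.start]
  · constructor <;> simp [State.start]
  · constructor <;> simp [State.start]

theorem Authentic.mono {S' : Set (Packet n)} (h : Authentic p D S o) (hS : S ⊆ S') :
    Authentic p D S' o := fun x hx =>
  let ⟨h1, h2, h3⟩ := h x hx
  ⟨h1, h2.imp id fun h => hS h, fun σ hσ => (h3 σ hσ).mono subset_rfl hS⟩

theorem Micro.localInv (ht : 3 * t < n) (ho : Authentic p D S o) (h : Micro t p v k o s s' l)
    (hs : LocalInv t p v D S s) : LocalInv t p v D (S ∪ {x | x ∈ l}) s' :=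
  ⟨h.wellFormed ht ho hs.wf, h.party hs.wf hs.party, h.leader hs.wf hs.lead⟩

theorem union_append (l l' : List (Packet n)) :
    S ∪ {x | x ∈ l ++ l'} = (S ∪ {x | x ∈ l}) ∪ {x | x ∈ l'} := by
  ext x; simp [or_assoc]

theorem act_localInv (ht : 3 * t < n) (ho : Authentic p D S o)
    (hview : ∀ j, s.view = some j → j ≤ k) (hs : LocalInv t p v D S s) :
    LocalInv t p v D (S ∪ {x | x ∈ (act t p v k o s).2}) (act t p v k o s).1 := by
  refine (act_ind (P := fun s l => LocalInv t p v D (S ∪ {x | x ∈ l}) s) ?_ hview ?_).1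
  · simpa using hs
  · intro s l s' l' h hm
    rw [union_append]
    exact hm.localInv ht (ho.mono Set.subset_union_left) h

theorem act_out (hview : ∀ j, s.view = some j → j ≤ k) :
    (act t p v k o s).1.view = some k ∧
      ∀ x ∈ (act t p v k o s).2, x.src = p ∧ x.view = k := by
  have h := act_ind (t := t) (p := p) (v := v) (o := o)
    (P := fun _ l => ∀ x ∈ l, x.src = p ∧ x.view = k) (s := s) (by simp) hview ?_
  · exact ⟨h.2, h.1⟩
  · intro s l s' l' h hm x hx
    rcases List.mem_append.1 hx with hx | hx
    · exact h x hx
    · exact hm.out.2 x hx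

end LocalInvariant

/-! ### From local transitions to timed executions -/

namespace Execution

section Steps

variable {n : ℕ} [NeZero n] (E : Execution n) (t : ℕ)

/-- The uncorrupted party `p` handles event `i`, which delivers the packet `o` or is a tick. -/
def Acts (i : ℕ) (p : Fin n) (o : Option (Packet n)) : Prop :=
  p ∉ (E.config t i).corrupted ∧
    ((o = none ∧ E.event i = .tick p) ∨ ∃ x, o = some x ∧ E.event i = .deliver x ∧ x.dst = p)

/-- The local state of `p` just before event `i`. -/
noncomputable def st (i : ℕ) (p : Fin n) : State n := (E.config t i).state p

/-- The outcome of event `i` at `p`. -/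
noncomputable def outcome (i : ℕ) (p : Fin n) (o : Option (Packet n)) :
    State n × List (Packet n) :=
  act t p (E.input p) (E.viewAt (E.time i) p) o (E.st t i p)

variable {E t}

theorem Acts.step {i : ℕ} {p : Fin n} {o : Option (Packet n)} (h : E.Acts t i p o) :
    (E.config t (i + 1)).state = Function.update (E.config t i).state p (E.outcome t i p o).1 ∧
    (E.config t (i + 1)).sent = (E.config t i).sent ∪ {x | x ∈ (E.outcome t i p o).2} ∧
    (E.config t (i + 1)).corrupted = (E.config t i).corrupted ∧
    E.sends t i = (E.outcome t i p o).2 := by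
  obtain ⟨h1, ⟨rfl, h2⟩ | ⟨x, rfl, h2, rfl⟩⟩ := h
  · simp only [config, sends, h2, Config.next, h1, if_false]
    exact ⟨rfl, rfl, rfl, rfl⟩
  · simp only [config, sends, h2, Config.next, h1, if_false]
    exact ⟨rfl, rfl, rfl, rfl⟩

theorem step_of_not_acts {i : ℕ} (h : ∀ p o, ¬ E.Acts t i p o) :
    (E.config t (i + 1)).state = (E.config t i).state ∧
    (E.config t (i + 1)).sent = (E.config t i).sent ∧
    (E.config t i).corrupted ⊆ (E.config t (i + 1)).corrupted ∧
    E.sends t i = [] := by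
  rcases he : E.event i with p | x | p
  · have h1 : p ∈ (E.config t i).corrupted := by
      by_contra h1
      exact h p none ⟨h1, .inl ⟨rfl, he⟩⟩
    simp [config, sends, he, Config.next, h1]
  · have h1 : x.dst ∈ (E.config t i).corrupted := by
      by_contra h1
      exact h x.dst (some x) ⟨h1, .inr ⟨x, rfl, he, rfl⟩⟩
    simp [config, sends, he, Config.next, h1]
  · simp [config, sends, he, Config.next]

theorem sent_succ (i : ℕ) :
    (E.config t (i + 1)).sent = (E.config t i).sent ∪ {x | x ∈ E.sends t i} := by
  by_cases h : ∃ p o, E.Acts t i p o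
  · obtain ⟨p, o, h⟩ := h
    rw [h.step.2.1, h.step.2.2.2]
  · push Not at h
    rw [(step_of_not_acts h).2.1, (step_of_not_acts h).2.2.2]
    simp

theorem corrupted_succ (i : ℕ) :
    (E.config t i).corrupted ⊆ (E.config t (i + 1)).corrupted := by
  by_cases h : ∃ p o, E.Acts t i p o
  · obtain ⟨p, o, h⟩ := h
    rw [h.step.2.2.1]
  · push Not at h
    exact (step_of_not_acts h).2.2.1

theorem sent_mono {i j : ℕ} (h : i ≤ j) : (E.config t i).sent ⊆ (E.config t j).sent :=
  monotone_nat_of_le_succ (f := fun i => (E.config t i).sent)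
    (fun i => by rw [sent_succ]; exact Set.subset_union_left) h

theorem corrupted_mono {i j : ℕ} (h : i ≤ j) :
    (E.config t i).corrupted ⊆ (E.config t j).corrupted :=
  monotone_nat_of_le_succ (f := fun i => (E.config t i).corrupted)
    (fun i => corrupted_succ i) h

theorem mem_sent {i : ℕ} {x : Packet n} (h : x ∈ (E.config t i).sent) :
    ∃ e < i, x ∈ E.sends t e := by
  induction i with
  | zero => simp [config, Config.start] at h
  | succ i ih =>
    rw [sent_succ] at h
    rcases h with h | h
    · obtain ⟨e, he, hx⟩ := ih h
      exact ⟨e, by omega, hx⟩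
    · exact ⟨i, by omega, h⟩

theorem sent_of_sends {i e : ℕ} {x : Packet n} (h : x ∈ E.sends t e) (hi : e < i) :
    x ∈ (E.config t i).sent := by
  refine sent_mono (i := e + 1) hi ?_
  rw [sent_succ]
  exact .inr h

theorem mem_faulty {i : ℕ} {p : Fin n} (h : p ∈ (E.config t i).corrupted) : p ∈ E.faulty := by
  induction i with
  | zero => simp [config, Config.start] at h
  | succ i ih =>
    rcases he : E.event i with q | x | q
    · simp only [config, he, Config.next] at h
      split_ifs at h
      · exact ih h
      · exact ih h
    · simp only [config, he, Config.next] at h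
      split_ifs at h
      · exact ih h
      · exact ih h
    · simp only [config, he, Config.next, Finset.mem_insert] at h
      rcases h with rfl | h
      · exact ⟨i, he⟩
      · exact ih h

theorem Honest.not_corrupted {p : Fin n} (h : E.Honest p) (i : ℕ) :
    p ∉ (E.config t i).corrupted := fun hp => h (mem_faulty hp)

end Steps

section Views

variable {n : ℕ} [NeZero n] {E : Execution n} {t : ℕ}

theorem viewAt_spec (H : E.ViewsSynchronized) {τ : ℝ} (hτ : 0 ≤ τ) (p : Fin n) :
    E.enter p (E.viewAt τ p) ≤ τ ∧ τ < E.enter p (E.viewAt τ p + 1) := by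
  have hb : BddAbove {k | E.enter p k ≤ τ} := by
    obtain ⟨K, hK⟩ := (Filter.tendsto_atTop.1 (H.unbounded p) (τ + 1)).exists
    refine ⟨K, fun k hk => ?_⟩
    by_contra h
    have := H.strictMono p (not_le.1 h)
    have hk : E.enter p k ≤ τ := hk
    linarith
  have hne : {k | E.enter p k ≤ τ}.Nonempty := ⟨0, by simpa [H.enter_zero p] using hτ⟩
  refine ⟨Nat.sSup_mem hne hb, ?_⟩
  by_contra h
  have := le_csSup hb (a := E.viewAt τ p + 1) (not_lt.1 h)
  unfold viewAt at this
  omega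

theorem viewAt_eq (H : E.ViewsSynchronized) {τ : ℝ} (hτ : 0 ≤ τ) {p : Fin n} {k : ℕ}
    (h1 : E.enter p k ≤ τ) (h2 : τ < E.enter p (k + 1)) : E.viewAt τ p = k := by
  obtain ⟨h3, h4⟩ := viewAt_spec H hτ p
  have h5 := (H.strictMono p).lt_iff_lt.1 (h1.trans_lt h4)
  have h6 := (H.strictMono p).lt_iff_lt.1 (h3.trans_lt h2)
  omega

theorem viewAt_mono (H : E.ViewsSynchronized) {τ τ' : ℝ} (hτ : 0 ≤ τ) (h : τ ≤ τ') (p : Fin n) :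
    E.viewAt τ p ≤ E.viewAt τ' p := by
  have h1 := (viewAt_spec H hτ p).1
  have h2 := (viewAt_spec H (hτ.trans h) p).2
  have := (H.strictMono p).lt_iff_lt.1 ((h1.trans h).trans_lt h2)
  omega

/-- The view of `p` at event `i`. -/
noncomputable def view (E : Execution n) (i : ℕ) (p : Fin n) : ℕ := E.viewAt (E.time i) p

theorem Admissible.view_mono (H : E.Admissible t) {i j : ℕ} (h : i ≤ j) (p : Fin n) :
    E.view i p ≤ E.view j p :=
  viewAt_mono H.views (H.time_nonneg i) (H.time_mono h) p

end Views

section Invariants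

variable {n : ℕ} [NeZero n] {E : Execution n} {t : ℕ}

theorem Acts.st_succ {i : ℕ} {p : Fin n} {o : Option (Packet n)} (h : E.Acts t i p o) :
    E.st t (i + 1) p = (E.outcome t i p o).1 := by
  simp [st, h.step.1]

theorem st_succ_of_not_acts {i : ℕ} {p : Fin n} (h : ∀ o, ¬ E.Acts t i p o) :
    E.st t (i + 1) p = E.st t i p := by
  by_cases h' : ∃ q o, E.Acts t i q o
  · obtain ⟨q, o, hq⟩ := h'
    have : p ≠ q := by rintro rfl; exact h o hq
    simp [st, hq.step.1, this]
  · push Not at h'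
    simp [st, (step_of_not_acts h').1]

/-- The induction treats all parties at once, because the certificates in a delivered packet are
known by the invariant of its sender. The last clause, that the stored view was shown by the clock
at an earlier event, bounds it by the current view; this is what the induction over atomic
transitions requires. -/
theorem Admissible.inv (H : E.Admissible t) (ht : 3 * t < n) (i : ℕ) :
    ∀ p, LocalInv t p (E.input p) (E.config t i).corrupted (E.config t i).sent (E.st t i p) ∧
      (∀ k, (E.st t i p).view = some k →
        PartyIdle t k (E.st t i p) ∧ LeaderIdle t k (E.st t i p)) ∧
      ∀ k, (E.st t i p).view = some k → ∃ e < i, E.view e p = k := by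
  induction i with
  | zero =>
    intro p
    refine ⟨LocalInv.start, ?_, ?_⟩ <;> simp [st, config, Config.start, State.start]
  | succ i ih =>
    have hle : ∀ p j, (E.st t i p).view = some j → j ≤ E.viewAt (E.time i) p := by
      intro p j hj
      obtain ⟨e, he, rfl⟩ := (ih p).2.2 j hj
      exact H.view_mono he.le p
    intro p
    by_cases h : ∃ o, E.Acts t i p o
    · obtain ⟨o, ho⟩ := h
      have hauth : Authentic p (E.config t i).corrupted (E.config t i).sent o := by
        rintro x rfl
        obtain ⟨-, ⟨h1, -⟩ | ⟨x', hx', h2, h3⟩⟩ := ho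
        · cases h1
        cases hx'
        refine ⟨h3, ?_⟩
        rcases H.authentic i x h2 with hx | hx
        · exact ⟨.inr hx, (ih x.src).1.wf.known x hx rfl⟩
        · exact ⟨.inl hx.1, hx.2.2⟩
      rw [ho.st_succ, ho.step.2.1, ho.step.2.2.1]
      refine ⟨act_localInv ht hauth (hle p) (ih p).1, ?_, ?_⟩
      · have hout := act_out (t := t) (p := p) (v := E.input p) (o := o) (hle p)
        intro k hk
        have : E.viewAt (E.time i) p = k := by
          have := hout.1.symm.trans hk
          simpa using this
        subst this
        exact act_idle ht p _ _ o _ ((ih p).2.1 _)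
      · have hout := act_out (t := t) (p := p) (v := E.input p) (o := o) (hle p)
        intro k hk
        refine ⟨i, by omega, ?_⟩
        have := hout.1.symm.trans hk
        simpa [view] using this
    · push Not at h
      rw [st_succ_of_not_acts h]
      refine ⟨(ih p).1.mono (corrupted_succ i) (sent_mono (by omega)) ?_, (ih p).2.1, ?_⟩
      · intro x hx hp
        rw [sent_succ] at hx
        rcases hx with hx | hx
        · exact hx
        -- If `p` does not act at event `i`, no packet sent there has source `p`.
        · exfalso
          by_cases h' : ∃ q o, E.Acts t i q o
          · obtain ⟨q, o, hq⟩ := h'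
            have hx : x ∈ E.sends t i := hx
            rw [hq.step.2.2.2] at hx
            have := ((act_out (t := t) (p := q) (v := E.input q) (o := o) (hle q)).2 x hx).1
            rw [hp] at this
            subst this
            exact h o hq
          · push Not at h'
            have hx : x ∈ E.sends t i := hx
            rw [(step_of_not_acts h').2.2.2] at hx
            simp at hx
      · intro k hk
        obtain ⟨e, he, h1⟩ := (ih p).2.2 k hk
        exact ⟨e, by omega, h1⟩

variable (H : E.Admissible t) (ht : 3 * t < n)
include H ht

theorem Admissible.st_view_le {i : ℕ} {p : Fin n} {k : ℕ} (h : (E.st t i p).view = some k) :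
    k ≤ E.view i p := by
  obtain ⟨e, he, rfl⟩ := (H.inv ht i p).2.2 k h
  exact H.view_mono he.le p

theorem Admissible.sends_acts {e : ℕ} {x : Packet n} (h : x ∈ E.sends t e) :
    ∃ o, E.Acts t e x.src o ∧ x ∈ (E.outcome t e x.src o).2 ∧ x.view = E.view e x.src := by
  by_cases h' : ∃ q o, E.Acts t e q o
  · obtain ⟨q, o, hq⟩ := h'
    rw [hq.step.2.2.2] at h
    have := (act_out (t := t) (p := q) (v := E.input q) (o := o)
      (fun j hj => H.st_view_le ht hj)).2 x h
    obtain ⟨rfl, h2⟩ := this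
    exact ⟨o, hq, h, h2⟩
  · push Not at h'
    rw [(step_of_not_acts h').2.2.2] at h
    simp at h

theorem Admissible.acts_view {i : ℕ} {p : Fin n} {o : Option (Packet n)} (h : E.Acts t i p o) :
    (E.st t (i + 1) p).view = some (E.view i p) := by
  rw [h.st_succ]
  exact (act_out (fun j hj => H.st_view_le ht hj)).1

/-- Induction over the atomic transitions at an event. -/
theorem Admissible.acts_ind {i : ℕ} {p : Fin n} {o : Option (Packet n)} (h : E.Acts t i p o)
    {P : State n → List (Packet n) → Prop} (h0 : P (E.st t i p) [])
    (step : ∀ s l s' l', P s l → Micro t p (E.input p) (E.view i p) o s s' l' → P s' (l ++ l')) :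
    P (E.st t (i + 1) p) (E.sends t i) := by
  rw [h.st_succ, h.step.2.2.2]
  exact (act_ind h0 (fun j hj => H.st_view_le ht hj) step).1

end Invariants

end Execution

namespace Execution

/-! ### Agreement and strong unanimity -/

section Safety

variable {n : ℕ} [NeZero n] {E : Execution n} {t : ℕ}

/-- A threshold signature all of whose uncorrupted signers have signed before event `i`. -/
def KnownAt (E : Execution n) (t i : ℕ) (σ : ThresholdSig n) : Prop :=
  KnownSig (E.config t i).corrupted (E.config t i).sent σ

theorem KnownAt.mono {i j : ℕ} {σ : ThresholdSig n} (h : E.KnownAt t i σ) (hij : i ≤ j) :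
    E.KnownAt t j σ :=
  KnownSig.mono h (corrupted_mono hij) (sent_mono hij)

theorem Admissible.exists_honest (H : E.Admissible t) {A : Finset (Fin n)} (h : t < A.card) :
    ∃ q ∈ A, E.Honest q := by
  by_contra hA
  push Not at hA
  have h1 : (A : Set (Fin n)) ⊆ E.faulty := fun q hq => by
    by_contra h2
    exact hA q hq h2
  have h2 := Set.ncard_le_ncard h1 (Set.toFinite _)
  rw [Set.ncard_coe_finset] at h2
  have := H.faulty_le
  unfold f at this
  omega

/-- Two sets of size `n - t` meet in at least `n - 2 * t > t` parties, not all of which are faulty.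
-/
theorem Admissible.exists_honest_inter (H : E.Admissible t) (ht : 3 * t < n)
    {A B : Finset (Fin n)} (hA : n - t ≤ A.card) (hB : n - t ≤ B.card) :
    ∃ q, q ∈ A ∧ q ∈ B ∧ E.Honest q := by
  have h1 := Finset.card_union_add_card_inter A B
  have h2 : (A ∪ B).card ≤ n := by simpa using Finset.card_le_univ (A ∪ B)
  obtain ⟨q, hq, hh⟩ := H.exists_honest (A := A ∩ B) (by omega)
  rw [Finset.mem_inter] at hq
  exact ⟨q, hq.1, hq.2, hh⟩

variable (H : E.Admissible t) (ht : 3 * t < n)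
include H ht

/-- A partial signature in the clear is always one of its sender, by `Shape`. Hence a known
signature of an uncorrupted party was sent by that party itself, in the reply of that kind and view,
or with its own input. -/
theorem Admissible.signed {i : ℕ} {q : Fin n} {m : Content} (hq : q ∉ (E.config t i).corrupted)
    (h : Known (E.config t i).corrupted (E.config t i).sent (tsign q m)) :
    match m with
    | .input w => w = E.input q
    | .key _ b => ∃ r, ⟨q, r, b, .checkedKey (tsign q m)⟩ ∈ (E.config t i).sent
    | .lock _ b => ∃ r, ⟨q, r, b, .checkedLock (tsign q m)⟩ ∈ (E.config t i).sent
    | .commit _ b => ∃ r, ⟨q, r, b, .checkedCommit (tsign q m)⟩ ∈ (E.config t i).sent := by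
  rcases h with h | ⟨⟨p, r, b, msg⟩, hx, hm⟩
  · exact absurd h hq
  have hs := (H.inv ht i p).1.wf.shape _ hx rfl
  rcases msg with _ | ⟨_ | _ | ⟨w, ρ⟩⟩ | _ | ρ | _ | ρ | _ | ρ | _ <;>
    simp only [Msg.partialSig, reduceCtorEq, Option.some.injEq] at hm <;> subst hm
  · simp only [Shape, Suggestion.valid, decide_eq_true_eq] at hs
    obtain ⟨-, h1, h2⟩ := hs
    have h3 := h2 _ _ rfl
    simp only [tsign, PartialSig.mk.injEq] at h1
    obtain ⟨rfl, rfl⟩ := h1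
    exact h3
  all_goals
    obtain ⟨-, w, h1⟩ := hs
    simp only [tsign, PartialSig.mk.injEq] at h1
    obtain ⟨rfl, rfl⟩ := h1
    exact ⟨r, hx⟩

theorem Admissible.authentic_acts {i : ℕ} {p : Fin n} {o : Option (Packet n)}
    (h : E.Acts t i p o) : Authentic p (E.config t i).corrupted (E.config t i).sent o := by
  rintro x rfl
  obtain ⟨-, ⟨h1, -⟩ | ⟨x', hx', h2, h3⟩⟩ := h
  · cases h1
  cases hx'
  refine ⟨h3, ?_⟩
  rcases H.authentic i x h2 with hx | hx
  · exact ⟨.inr hx, (H.inv ht i x.src).1.wf.known x hx rfl⟩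
  · exact ⟨.inl hx.1, hx.2.2⟩

/-- A party that signs a key has received a proposal that is compatible with its lock. -/
theorem Admissible.key_justified {e : ℕ} {q r : Fin n} {b : ℕ} {w : Value}
    (h : ⟨q, r, b, .checkedKey (tsign q (.key w b))⟩ ∈ E.sends t e) :
    ∃ pr : Proposal n, pr.valid t w = true ∧
      (∀ σ, (Msg.proposeKey w pr).thresholdSig = some σ → E.KnownAt t e σ) ∧
      ∀ a r' ρ, ⟨q, r', a, .checkedCommit ρ⟩ ∈ (E.config t e).sent →
        ∃ c, pr = .key c ∧ a ≤ c.view := by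
  obtain ⟨o, ho, -, hb⟩ := H.sends_acts ht h
  have hauth := H.authentic_acts ht ho
  dsimp only at ho hb hauth
  have hle : ∀ a r' ρ, ⟨q, r', a, .checkedCommit ρ⟩ ∈ (E.config t e).sent → a ≤ E.view e q := by
    intro a r' ρ hx
    obtain ⟨j, hj, ha⟩ := (H.inv ht e q).1.wf.view_le _ hx rfl
    exact ha.trans (H.st_view_le ht hj)
  -- One event can comprise several transitions, so the state at the moment of signing is not the
  -- state before the event. The predicate therefore carries along that certificates in the inbox
  -- are known and that the lock is at least as recent as every commit share sent before the event.
  have key := H.acts_ind ht ho (P := fun s l =>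
    (∀ q m, (q, m) ∈ s.inbox → ∀ σ, m.thresholdSig = some σ → E.KnownAt t e σ) ∧
    (∀ a r' ρ, ⟨q, r', a, .checkedCommit ρ⟩ ∈ (E.config t e).sent →
      ∃ c, s.lock = some c ∧ a ≤ c.view) ∧
    ∀ x ∈ l, ∀ w, x.msg = .checkedKey (tsign q (.key w (E.view e q))) →
      ∃ pr : Proposal n, pr.valid t w = true ∧
        (∀ σ, (Msg.proposeKey w pr).thresholdSig = some σ → E.KnownAt t e σ) ∧
        ∀ a r' ρ, ⟨q, r', a, .checkedCommit ρ⟩ ∈ (E.config t e).sent →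
          ∃ c, pr = .key c ∧ a ≤ c.view) ?_ ?_
  · exact key.2.2 _ h w (by rw [hb])
  · exact ⟨fun q' m hm => ((H.inv ht e q).1.wf.inbox q' m hm).2,
      (H.inv ht e q).1.party.commit_lock, by simp⟩
  · rintro s l s' l' ⟨h1, h2, h3⟩ hm
    refine ⟨?_, ?_, ?_⟩
    · cases hm with
      | enterLead | enterIdle => simp
      | recv x g1 g2 g3 =>
        intro q' m hm
        simp only [List.mem_append, List.mem_singleton] at hm
        rcases hm with hm | hm
        · exact h1 q' m hm
        · cases hm
          exact (hauth _ g2).2.2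
      | _ => exact h1
    · cases hm with
      -- The new lock has the current view, which bounds the views of all earlier messages of `q`.
      | setLock w σ => exact fun a r' ρ hx => ⟨_, rfl, hle a r' ρ hx⟩
      | _ => exact h2
    · intro x hx w hw
      rcases List.mem_append.1 hx with hx | hx
      · exact h3 x hx w hw
      cases hm with
      | enterLead | leadCommit | leadKey | leadInput | leadLock | leadPropCommit | leadSend =>
        rw [(mem_broadcast.1 hx).2.2] at hw
        cases hw
      | keyAccept w' pr g1 g2 g3 g4 g5 =>
        rw [List.mem_singleton] at hx
        subst hx
        simp only [Msg.checkedKey.injEq] at hw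
        obtain ⟨rfl, -⟩ := tsign_key_inj hw
        refine ⟨pr, g4, h1 _ _ g3, fun a r' ρ hx => ?_⟩
        obtain ⟨c, hc, ha⟩ := h2 a r' ρ hx
        rw [hc] at g5
        rcases pr with c' | σ
        · exact ⟨c', rfl, ha.trans (by simpa [lockAllows] using g5)⟩
        · simp [lockAllows] at g5
      | enterIdle | accept | recv | requestOld | keyReject => simp at hx
      | _ =>
        rw [List.mem_singleton] at hx
        subst hx
        cases hw

/-- A common honest signer would have signed both values in the same view, but it signs only one key
per view. -/
theorem Admissible.key_unique {i j : ℕ} {w w' : Value} {b : ℕ} {σ σ' : ThresholdSig n}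
    (h1 : tverify (n - t) (.key w b) σ = true) (h2 : E.KnownAt t i σ)
    (h3 : tverify (n - t) (.key w' b) σ' = true) (h4 : E.KnownAt t j σ') : w = w' := by
  rw [tverify_iff] at h1 h3
  obtain ⟨q, hq1, hq2, hq⟩ := H.exists_honest_inter ht h1.2.ge h3.2.ge
  have k1 := (h2.mono (le_max_left i j)) q hq1
  have k2 := (h4.mono (le_max_right i j)) q hq2
  rw [h1.1] at k1
  rw [h3.1] at k2
  obtain ⟨r, hr⟩ := H.signed ht (hq.not_corrupted _) k1
  obtain ⟨r', hr'⟩ := H.signed ht (hq.not_corrupted _) k2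
  exact (tsign_key_inj ((H.inv ht _ q).1.party.key_unique b r _ hr r' _ hr')).1

/-- An honest signer of the lock (`n - t > t`) has received a key proof for the same value and view.
-/
theorem Admissible.key_of_lock {i : ℕ} {w : Value} {b : ℕ} {σ : ThresholdSig n}
    (h1 : tverify (n - t) (.lock w b) σ = true) (h2 : E.KnownAt t i σ) :
    ∃ σ', tverify (n - t) (.key w b) σ' = true ∧ E.KnownAt t i σ' := by
  rw [tverify_iff] at h1
  obtain ⟨q, hq1, hq⟩ := H.exists_honest (A := σ.signers) (by omega)
  have k1 := h2 q hq1
  rw [h1.1] at k1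
  obtain ⟨r, hr⟩ := H.signed ht (hq.not_corrupted _) k1
  exact (H.inv ht _ q).1.party.lock_cert _ _ _ hr

theorem Admissible.key_of_commit {i : ℕ} {c : Cert n} (h1 : c.isCommit t = true)
    (h2 : E.KnownAt t i c.proof) :
    ∃ σ', tverify (n - t) (.key c.value c.view) σ' = true ∧ E.KnownAt t i σ' := by
  rw [Cert.isCommit, tverify_iff] at h1
  obtain ⟨q, hq1, hq⟩ := H.exists_honest (A := c.proof.signers) (by omega)
  have k1 := h2 q hq1
  rw [h1.1] at k1
  obtain ⟨r, hr⟩ := H.signed ht (hq.not_corrupted _) k1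
  obtain ⟨σ, h3, h4⟩ := (H.inv ht _ q).1.party.commit_cert _ _ _ hr
  exact H.key_of_lock ht h3 h4

/-- Once a commit exists, every key of the same or a later view has its value. -/
theorem Admissible.key_after_commit {I : ℕ} {c : Cert n} (h1 : c.isCommit t = true)
    (h2 : E.KnownAt t I c.proof) : ∀ i w b σ, tverify (n - t) (.key w b) σ = true →
    E.KnownAt t i σ → c.view ≤ b → w = c.value := by
  obtain ⟨σ₀, h3, h4⟩ := H.key_of_commit ht h1 h2
  rw [Cert.isCommit, tverify_iff] at h1
  intro i
  -- The induction is over the event by which the key is known, not over its view: a proposal is not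
  -- required to carry a key of an earlier view, but its key was certainly known before the new
  -- signature was made.
  induction i using Nat.strong_induction_on with
  | _ i ih =>
    intro w b σ h5 h6 hb
    rcases hb.eq_or_lt with rfl | hb
    · exact H.key_unique ht h5 h6 h3 h4
    have h5' := tverify_iff.1 h5
    obtain ⟨q, hq1, hq2, hq⟩ := H.exists_honest_inter ht h1.2.ge h5'.2.ge
    have k1 := h2 q hq1
    have k2 := h6 q hq2
    rw [h1.1] at k1
    rw [h5'.1] at k2
    obtain ⟨r, hr⟩ := H.signed ht (hq.not_corrupted _) k1
    obtain ⟨r', hr'⟩ := H.signed ht (hq.not_corrupted _) k2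
    obtain ⟨e, he, hx⟩ := mem_sent hr
    obtain ⟨e', he', hx'⟩ := mem_sent hr'
    -- The views of a party only grow, so the share for view `c.view` was sent before the one for
    -- the later view `b`.
    have hee : e < e' := by
      obtain ⟨-, -, -, hv⟩ := H.sends_acts ht hx
      obtain ⟨-, -, -, hv'⟩ := H.sends_acts ht hx'
      dsimp only at hv hv'
      by_contra hcon
      have := H.view_mono (not_lt.1 hcon) q
      omega
    obtain ⟨pr, hpr, hk, hl⟩ := H.key_justified ht hx'
    obtain ⟨c', rfl, hc'⟩ := hl _ _ _ (sent_of_sends hx hee)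
    simp only [Proposal.valid, Bool.and_eq_true, decide_eq_true_eq] at hpr
    obtain ⟨rfl, hkey⟩ := hpr
    exact ih e' he' _ _ _ hkey (hk _ rfl) hc'

theorem Admissible.decided {i : ℕ} {p : Fin n} {v : Value} (h : E.Decides t p i v) :
    ∃ c, (E.st t i p).commit = some c ∧ c.value = v ∧ c.isCommit t = true ∧
      E.KnownAt t i c.proof := by
  have hd : (E.st t i p).decision = some v := h
  rw [(H.inv ht i p).1.wf.decision] at hd
  rcases hc : (E.st t i p).commit with _ | c
  · simp [hc] at hd
  · rw [hc] at hd
    exact ⟨c, rfl, by simpa using hd, (H.inv ht i p).1.wf.commit c hc⟩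

theorem Admissible.agreement : E.Agreement t := by
  intro p q i j v w _ _ hv hw
  obtain ⟨c, -, rfl, h1, h2⟩ := H.decided ht hv
  obtain ⟨c', -, rfl, h1', h2'⟩ := H.decided ht hw
  rcases le_total c.view c'.view with h | h
  · obtain ⟨σ, h3, h4⟩ := H.key_of_commit ht h1' h2'
    exact (H.key_after_commit ht h1 h2 _ _ _ _ h3 h4 h).symm
  · obtain ⟨σ, h3, h4⟩ := H.key_of_commit ht h1 h2
    exact H.key_after_commit ht h1' h2' _ _ _ _ h3 h4 h

theorem Admissible.strongUnanimity : E.StrongUnanimity t := by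
  intro v hv p i w hp hw
  -- Walking from a key to the proposal that justified an honest signature on it ends at a
  -- combination of `t + 1` input signatures, and an honest party among their signers has input `v`.
  have key : ∀ i w b σ, tverify (n - t) (.key w b) σ = true → E.KnownAt t i σ → w = v := by
    intro i
    induction i using Nat.strong_induction_on with
    | _ i ih =>
      intro w b σ h5 h6
      have h5' := tverify_iff.1 h5
      obtain ⟨q, hq2, hq⟩ := H.exists_honest (A := σ.signers) (by omega)
      have k2 := h6 q hq2
      rw [h5'.1] at k2
      obtain ⟨r', hr'⟩ := H.signed ht (hq.not_corrupted _) k2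
      obtain ⟨e', he', hx'⟩ := mem_sent hr'
      obtain ⟨pr, hpr, hk, -⟩ := H.key_justified ht hx'
      rcases pr with c | σ'
      · simp only [Proposal.valid, Bool.and_eq_true, decide_eq_true_eq] at hpr
        obtain ⟨rfl, hkey⟩ := hpr
        exact ih e' he' _ _ _ hkey (hk _ rfl)
      · simp only [Proposal.valid, tverify_iff] at hpr
        obtain ⟨q', hq', hh⟩ := H.exists_honest (A := σ'.signers) (by omega)
        have k3 := hk _ rfl q' hq'
        rw [hpr.1] at k3
        exact (H.signed ht (hh.not_corrupted _) k3).trans (hv q' hh)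
  obtain ⟨c, -, rfl, h1, h2⟩ := H.decided ht hw
  obtain ⟨σ, h3, h4⟩ := H.key_of_commit ht h1 h2
  exact key _ _ _ _ h3 h4

end Safety

end Execution

/-! ### What the protocol steps leave unchanged -/

section Frames

variable {n : ℕ} [NeZero n]

theorem partyStep_frame (t : ℕ) (p : Fin n) (v : Value) (k : ℕ) (s : State n) :
    (partyStep t p v k s).1.inbox = s.inbox ∧ (partyStep t p v k s).1.commit = s.commit := by
  unfold partyStep
  dsimp only
  split <;> (try split_ifs) <;> (try split) <;> (try split_ifs) <;> simp_all

theorem leaderStep_commit (t : ℕ) (p : Fin n) (k : ℕ) (s : State n) :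
    (leaderStep t p k s).1.commit = s.commit := by
  unfold leaderStep
  dsimp only
  split <;> (try split_ifs) <;> (try split) <;> simp

theorem runSteps_preserves {f : State n → State n × List (Packet n)} {I : State n → Prop}
    (hf : ∀ s, I s → I (f s).1) : ∀ m s, I s → I (runSteps f m s).1 := by
  intro m
  induction m with
  | zero => exact fun s h => h
  | succ m ih => exact fun s h => ih _ (hf s h)

theorem receive_inbox (t : ℕ) (p : Fin n) (v : Value) (x : Packet n) (s : State n) :
    (x.src, x.msg) ∈ (receive t p v x.view x s).1.inbox := by
  simp only [receive, if_true]
  refine runSteps_preserves (I := fun s => (x.src, x.msg) ∈ s.inbox)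
    (fun s h => by rw [(leaderStep_frame t p x.view s).2]; exact h) _ _ ?_
  refine runSteps_preserves (I := fun s => (x.src, x.msg) ∈ s.inbox)
    (fun s h => by rw [(partyStep_frame t p v x.view s).1]; exact h) _ _ ?_
  simp

theorem receive_commit {t : ℕ} (p : Fin n) (v : Value) (k : ℕ) {x : Packet n} (s : State n)
    {c : Cert n} (h : x.msg.carriedCommit = some c) (hc : c.isCommit t = true) :
    (receive t p v k x s).1.commit ≠ none := by
  simp only [receive]
  refine runSteps_preserves (I := fun s => s.commit ≠ none)
    (fun s h => by rw [leaderStep_commit]; exact h) _ _ ?_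
  refine runSteps_preserves (I := fun s => s.commit ≠ none)
    (fun s h => by rw [(partyStep_frame t p v k s).2]; exact h) _ _ ?_
  have : (acceptCommit t x.msg (enterView p k s).1).commit ≠ none := by
    simp only [acceptCommit, h, hc, true_and]
    split_ifs with h1
    · simp
    · simpa using h1
  split_ifs <;> exact this

theorem Micro.commit_ne_none {t : ℕ} {p : Fin n} {v : Value} {k : ℕ} {o : Option (Packet n)}
    {s s' : State n} {l : List (Packet n)} (h : Micro t p v k o s s' l) (hs : s.commit ≠ none) :
    s'.commit ≠ none := by
  cases h with
  | accept => simp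
  | _ => exact hs

end Frames

namespace Execution

/-! ### Event indices, times and views after GST -/

section Timing

variable {n : ℕ} {E : Execution n} {t : ℕ}

/-- The index of the first event later than `τ`. -/
noncomputable def after (E : Execution n) (τ : ℝ) : ℕ := sInf {i | τ < E.time i}

/-- The index of the first event not earlier than `τ`. -/
noncomputable def upto (E : Execution n) (τ : ℝ) : ℕ := sInf {i | τ ≤ E.time i}

/-- The time at which the first party, and after GST every party, enters view `k`. -/
noncomputable def start [NeZero n] (E : Execution n) (k : ℕ) : ℝ := E.enter 0 k

variable [NeZero n]

theorem Admissible.lt_after (H : E.Admissible t) {i : ℕ} {τ : ℝ} :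
    i < E.after τ ↔ E.time i ≤ τ := by
  have hne : {i | τ < E.time i}.Nonempty := by
    obtain ⟨i, hi⟩ := (Filter.tendsto_atTop.1 H.time_unbounded (τ + 1)).exists
    exact ⟨i, by simp only [Set.mem_ofPred_eq]; linarith⟩
  constructor
  · intro h
    by_contra h'
    exact absurd (Nat.sInf_le (not_le.1 h' : i ∈ {i | τ < E.time i})) (not_le.2 h)
  · intro h
    by_contra h'
    have h1 : τ < E.time (E.after τ) := Nat.sInf_mem hne
    have := H.time_mono (not_lt.1 h')
    linarith

theorem Admissible.lt_upto (H : E.Admissible t) {i : ℕ} {τ : ℝ} :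
    i < E.upto τ ↔ E.time i < τ := by
  have hne : {i | τ ≤ E.time i}.Nonempty := (Filter.tendsto_atTop.1 H.time_unbounded τ).exists
  constructor
  · intro h
    by_contra h'
    exact absurd (Nat.sInf_le (not_lt.1 h' : i ∈ {i | τ ≤ E.time i})) (not_le.2 h)
  · intro h
    by_contra h'
    have h1 : τ ≤ E.time (E.upto τ) := Nat.sInf_mem hne
    have := H.time_mono (not_lt.1 h')
    linarith

theorem Admissible.after_mono (H : E.Admissible t) {τ τ' : ℝ} (h : τ ≤ τ') :
    E.after τ ≤ E.after τ' := by
  by_contra hc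
  have h1 := H.lt_after.1 (not_le.1 hc)
  have h2 := H.lt_after.2 (h1.trans h)
  omega

theorem Admissible.after_le_upto (H : E.Admissible t) {τ τ' : ℝ} (h : τ < τ') :
    E.after τ ≤ E.upto τ' := by
  by_contra hc
  have h1 := H.lt_after.1 (not_le.1 hc)
  have h2 := H.lt_upto.2 (h1.trans_lt h)
  omega

theorem Admissible.upto_le_after (H : E.Admissible t) {τ τ' : ℝ} (h : τ ≤ τ') :
    E.upto τ ≤ E.after τ' := by
  by_contra hc
  have h1 := H.lt_upto.1 (not_le.1 hc)
  have h2 := H.lt_after.2 (h1.le.trans h)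
  omega

theorem Admissible.upto_mono (H : E.Admissible t) {τ τ' : ℝ} (h : τ ≤ τ') :
    E.upto τ ≤ E.upto τ' := by
  by_contra hc
  have h1 := H.lt_upto.1 (not_le.1 hc)
  have h2 := H.lt_upto.2 (h1.trans_le h)
  omega

theorem Admissible.start_strictMono (H : E.Admissible t) : StrictMono E.start :=
  H.views.strictMono 0

theorem Admissible.enter_eq (H : E.Admissible t) {k : ℕ} (hk : E.gst ≤ E.start k) (p : Fin n) :
    E.enter p k = E.start k := H.views.common 0 p k hk

theorem Admissible.start_succ (H : E.Admissible t) {k : ℕ} (hk : E.gst ≤ E.start k) :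
    E.start k + 9 * E.delta ≤ E.start (k + 1) := H.views.duration 0 k hk

theorem Admissible.gst_le_start (H : E.Admissible t) {k j : ℕ} (hk : E.gst ≤ E.start k)
    (h : k ≤ j) : E.gst ≤ E.start j :=
  hk.trans (H.start_strictMono.monotone h)

theorem Admissible.view_eq (H : E.Admissible t) {k : ℕ} (hk : E.gst ≤ E.start k) {i : ℕ}
    (h1 : E.start k ≤ E.time i) (h2 : E.time i < E.start (k + 1)) (p : Fin n) :
    E.view i p = k :=
  viewAt_eq H.views (H.time_nonneg i) (by rwa [H.enter_eq hk])
    (by rwa [H.enter_eq (H.gst_le_start hk (by omega))])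

theorem Admissible.start_le_time (H : E.Admissible t) {k : ℕ} (hk : E.gst ≤ E.start k) {i : ℕ}
    {p : Fin n} (h : k ≤ E.view i p) : E.start k ≤ E.time i := by
  have h1 := (viewAt_spec H.views (H.time_nonneg i) p).1
  rw [← H.enter_eq hk p]
  exact ((H.views.strictMono p).monotone h).trans h1

theorem Admissible.time_lt_start (H : E.Admissible t) {k : ℕ} (hk : E.gst ≤ E.start k) {i : ℕ}
    {p : Fin n} (h : E.view i p < k) : E.time i < E.start k := by
  have h1 := (viewAt_spec H.views (H.time_nonneg i) p).2
  rw [← H.enter_eq hk p]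
  exact h1.trans_le ((H.views.strictMono p).monotone h)

end Timing

/-! ### Delivery and persistence within a view -/

section Progress

variable {n : ℕ} [NeZero n] {E : Execution n} {t : ℕ} (H : E.Admissible t) (ht : 3 * t < n)
include H ht

theorem Admissible.commit_mono {i j : ℕ} (hij : i ≤ j) {p : Fin n}
    (h : (E.st t i p).commit ≠ none) : (E.st t j p).commit ≠ none := by
  induction j, hij using Nat.le_induction with
  | base => exact h
  | succ j _ ih =>
    by_cases ha : ∃ o, E.Acts t j p o
    · obtain ⟨o, ho⟩ := ha
      exact H.acts_ind ht ho (P := fun s _ => s.commit ≠ none) ih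
        fun s l s' l' h hm => hm.commit_ne_none h
    · push Not at ha
      rwa [st_succ_of_not_acts ha]

/-- The clock event at the start of the view moves `p` to view `k`, and every event before the next
start finds the clock at `k`. -/
theorem Admissible.st_view {k : ℕ} (hk : E.gst ≤ E.start k) {j : ℕ} {p : Fin n}
    (h1 : E.after (E.start k) ≤ j) (h2 : j ≤ E.upto (E.start (k + 1)))
    (hp : p ∉ (E.config t j).corrupted) : (E.st t j p).view = some k := by
  obtain ⟨i, hi, htick⟩ := H.tick p k
  rw [H.enter_eq hk] at hi
  have hij : i + 1 ≤ j := (H.lt_after.2 hi.le).trans_le h1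
  clear h1
  induction j, hij using Nat.le_induction with
  | base =>
    have hp' : p ∉ (E.config t i).corrupted := fun h => hp (corrupted_succ i h)
    rw [H.acts_view ht (i := i) (o := none) ⟨hp', .inl ⟨rfl, htick⟩⟩]
    congr
    exact H.view_eq hk hi.ge (hi.trans_lt (H.start_strictMono (by omega))) p
  | succ j hij ih =>
    have ih := ih (by omega) fun h => hp (corrupted_succ j h)
    by_cases ha : ∃ o, E.Acts t j p o
    · obtain ⟨o, ho⟩ := ha
      rw [H.acts_view ht ho]
      congr
      refine H.view_eq hk ?_ (H.lt_upto.1 h2) p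
      rw [← hi]
      exact H.time_mono (by omega)
    · push Not at ha
      rwa [st_succ_of_not_acts ha]

/-- As long as `p` stays in view `k` only transitions of view `k` occur, and a view that has been
left is never entered again; so being in view `k` at both ends excludes any excursion. -/
theorem Admissible.stable {k : ℕ} {p : Fin n} {Q : State n → Prop}
    (hQ : ∀ o s s' l, Q s → s.view = some k → Micro t p (E.input p) k o s s' l → Q s')
    {i j : ℕ} (hij : i ≤ j) (h : Q (E.st t i p)) (hi : (E.st t i p).view = some k)
    (hj : (E.st t j p).view = some k) : Q (E.st t j p) := by
  have key : (Q (E.st t j p) ∧ (E.st t j p).view = some k) ∨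
      ∃ k', (E.st t j p).view = some k' ∧ k < k' := by
    clear hj
    induction j, hij using Nat.le_induction with
    | base => exact .inl ⟨h, hi⟩
    | succ j hij ih =>
      by_cases ha : ∃ o, E.Acts t j p o
      · obtain ⟨o, ho⟩ := ha
        rcases ih with ⟨h1, h2⟩ | ⟨k', h2, h3⟩
        · rcases (H.st_view_le ht h2).eq_or_lt with h4 | h4
          · left
            refine ⟨?_, by rw [H.acts_view ht ho, ← h4]⟩
            refine (H.acts_ind ht ho (P := fun s _ => Q s ∧ s.view = some k) ⟨h1, h2⟩ ?_).1
            intro s l s' l' hs hm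
            rw [← h4] at hm
            exact ⟨hQ o s s' l' hs.1 hs.2 hm, hm.out.1⟩
          · exact .inr ⟨_, H.acts_view ht ho, h4⟩
        · exact .inr ⟨_, H.acts_view ht ho, h3.trans_le (H.st_view_le ht h2)⟩
      · push Not at ha
        rwa [st_succ_of_not_acts ha]
  rcases key with h | ⟨k', h2, h3⟩
  · exact h.1
  · rw [hj] at h2
    cases h2
    omega

theorem Admissible.inbox_stable {k : ℕ} {p : Fin n} {e : Fin n × Msg n} {i j : ℕ} (hij : i ≤ j)
    (h : e ∈ (E.st t i p).inbox) (hi : (E.st t i p).view = some k)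
    (hj : (E.st t j p).view = some k) : e ∈ (E.st t j p).inbox := by
  refine H.stable ht (Q := fun s => e ∈ s.inbox) ?_ hij h hi hj
  intro o s s' l h hs hm
  cases hm with
  | enterLead h1 => exact absurd (h1 k hs) (by omega)
  | enterIdle h1 => exact absurd (h1 k hs) (by omega)
  | recv => simp [h]
  | _ => exact h

/-- A message sent by time `τ` in view `k` has arrived by time `τ + Δ`. -/
theorem Admissible.arrived {k : ℕ} (hk : E.gst ≤ E.start k) {τ : ℝ} (h1 : E.start k ≤ τ)
    (h2 : τ + E.delta < E.start (k + 1)) {q p : Fin n} {m : Msg n}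
    (hx : ⟨q, p, k, m⟩ ∈ (E.config t (E.after τ)).sent)
    (hp : p ∉ (E.config t (E.after (τ + E.delta))).corrupted) :
    (q, m) ∈ (E.st t (E.after (τ + E.delta)) p).inbox := by
  have hd := H.delta_pos
  obtain ⟨e, he, hx⟩ := mem_sent hx
  obtain ⟨-, -, -, hv⟩ := H.sends_acts ht hx
  obtain ⟨j, hej, hj, hτj⟩ := H.delivery e _ hx
  have he' := H.lt_after.1 he
  have h3 : E.start k ≤ E.time e := H.start_le_time hk (p := q) hv.le
  rw [max_eq_left (hk.trans h3)] at hτj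
  have h4 : E.time j ≤ τ + E.delta := by linarith
  have hja := H.lt_after.2 h4
  have h5 : E.start k ≤ E.time j := h3.trans (H.time_mono hej.le)
  have hvj := H.view_eq hk h5 (by linarith) p
  have hacts : E.Acts t j p (some ⟨q, p, k, m⟩) :=
    ⟨fun h => hp (corrupted_mono hja.le h), .inr ⟨_, rfl, hj, rfl⟩⟩
  have hin : (q, m) ∈ (E.st t (j + 1) p).inbox := by
    rw [hacts.st_succ]
    have := receive_inbox t p (E.input p) ⟨q, p, k, m⟩ (E.st t j p)
    unfold view at hvj
    simp only [outcome, act, hvj]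
    exact this
  refine H.inbox_stable ht (k := k) hja hin ?_ ?_
  · rw [H.acts_view ht hacts, hvj]
  · exact H.st_view ht hk (H.after_mono (by linarith)) (H.after_le_upto h2) hp

/-- A commit sent by time `τ` after GST has been adopted by time `τ + Δ`. -/
theorem Admissible.commit_arrived {e j : ℕ} {x : Packet n} {c : Cert n}
    (hx : x ∈ E.sends t e) (hc : x.msg.carriedCommit = some c) (hv : c.isCommit t = true)
    (hj : ∀ j', E.time j' ≤ max (E.time e) E.gst + E.delta → j' < j)
    (hp : x.dst ∉ (E.config t j).corrupted) : (E.st t j x.dst).commit ≠ none := by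
  obtain ⟨j', -, hj', hτ⟩ := H.delivery e _ hx
  have h1 := hj j' hτ
  refine H.commit_mono ht (i := j' + 1) h1 ?_
  have hacts : E.Acts t j' x.dst (some x) :=
    ⟨fun h => hp (corrupted_mono h1.le h), .inr ⟨_, rfl, hj', rfl⟩⟩
  rw [hacts.st_succ]
  exact receive_commit _ _ _ _ hc hv

/-- Requests and suggestions of keys or inputs come only from parties without a commit. -/
theorem Admissible.commit_eq_none {e : ℕ} {x : Packet n} (hx : x ∈ E.sends t e)
    (hm : x.msg = .requestSuggestion ∨ ∃ y : Suggestion n, x.msg = .suggest y ∧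
      y.isCommit = false) : (E.st t e x.src).commit = none := by
  obtain ⟨o, ho, -, -⟩ := H.sends_acts ht hx
  by_contra hne
  have key := H.acts_ind ht ho (P := fun s l => s.commit ≠ none ∧ ∀ x ∈ l,
    ¬ (x.msg = .requestSuggestion ∨ ∃ y : Suggestion n, x.msg = .suggest y ∧
      y.isCommit = false)) ⟨hne, by simp⟩ ?_
  · exact key.2 x hx hm
  · rintro s l s' l' ⟨h1, h2⟩ hm
    refine ⟨hm.commit_ne_none h1, fun x hx => ?_⟩
    rcases List.mem_append.1 hx with hx | hx
    · exact h2 x hx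
    cases hm with
    | enterLead _ _ h => exact absurd h h1
    | requestKey _ _ _ _ h => exact absurd h h1
    | requestInput _ _ _ h => exact absurd h h1
    | leadCommit | leadKey | leadInput | leadLock | leadPropCommit | leadSend =>
      simp [(mem_broadcast.1 hx).2.2]
    | enterIdle | accept | recv | requestOld | keyReject => simp at hx
    | _ =>
      rw [List.mem_singleton] at hx
      subst hx
      simp [Suggestion.isCommit]

/-- Such a message is sent at or after the start of view `k`, by a party that has no commit at that
time; since commits are never given up, it had none just before the view. -/
theorem Admissible.commit_eq_none_upto {k : ℕ} (hk : E.gst ≤ E.start k) {i : ℕ} {p q : Fin n}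
    {m : Msg n} (hx : ⟨p, q, k, m⟩ ∈ (E.config t i).sent)
    (hm : m = .requestSuggestion ∨ ∃ y : Suggestion n, m = .suggest y ∧ y.isCommit = false) :
    (E.st t (E.upto (E.start k)) p).commit = none := by
  obtain ⟨e, he, hx⟩ := mem_sent hx
  have h1 := H.commit_eq_none ht hx hm
  obtain ⟨-, -, -, hv⟩ := H.sends_acts ht hx
  by_contra h2
  refine H.commit_mono ht ?_ h2 h1
  by_contra h3
  have := H.lt_upto.1 (not_le.1 h3)
  have := H.start_le_time hk (p := p) hv.le
  linarith

end Progress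

end Execution

/-! ### Honest parties answer an uncorrupted leader -/

section LocalProgress

variable {n : ℕ} [NeZero n] {t : ℕ} {p : Fin n} {v vL : Value} {k : ℕ}
  {D : Finset (Fin n)} {S : Set (Packet n)} {s sL : State n}

/-- The lock of `p` does not stand against the proposals made by the leader of view `k`. -/
def LockCompatible (n k : ℕ) [NeZero n] (S : Set (Packet n)) (p : Fin n) (s : State n) : Prop :=
  ∀ w pr, ⟨leader n k, p, k, .proposeKey w pr⟩ ∈ S → ∀ c, s.lock = some c → c.view < k →
    lockAllows (some c) pr = true

variable (hp : LocalInv t p v D S s) (hidle : PartyIdle t k s) (hv : s.view = some k)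
  (hL : LocalInv t (leader n k) vL D S sL) (hLD : leader n k ∉ D)
  (hlock : LockCompatible n k S p s)
  {q : Fin n} {x : Suggestion n} (hx : ⟨p, q, k, .suggest x⟩ ∈ S) (hxc : x.isCommit = false)
  (hreq : (leader n k, Msg.requestSuggestion) ∈ s.inbox)
  {w : Value} {pr : Proposal n} (hkey : (leader n k, Msg.proposeKey w pr) ∈ s.inbox)
include hp hidle hv hL hLD hreq

theorem LocalInv.mem_of_inbox {m : Msg n} (h : (leader n k, m) ∈ s.inbox) :
    ⟨leader n k, p, k, m⟩ ∈ S := by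
  obtain ⟨⟨j, hj, h1⟩, -⟩ := hp.wf.inbox _ _ h
  rw [hv] at hj
  cases hj
  exact h1.resolve_left hLD

include hlock hx hxc

theorem LocalInv.commit_of_rest (h : s.partyPhase = .rest) :
    ∃ ρ, ⟨p, leader n k, k, .checkedCommit ρ⟩ ∈ S := by
  refine (hp.party.rest_suggested k hv h q x hx hxc).resolve_left ?_
  rintro ⟨w, pr, c, h1, h2, h3, h4, h5⟩
  have := hlock w pr (hp.mem_of_inbox hidle hv hL hLD hreq h1) c h3 h4
  simp [h5] at this

include hkey

/-- An idle party cannot be waiting for a message that is in its inbox. In every remaining phase it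
has already signed a key, and the value is `w` because the uncorrupted leader proposes only one
value per view. The next two lemmas follow the same pattern. -/
theorem LocalInv.checkedKey :
    ⟨p, leader n k, k, .checkedKey (tsign p (.key w k))⟩ ∈ S := by
  have hk := hp.mem_of_inbox hidle hv hL hLD hreq hkey
  have hval : pr.valid t w = true := hL.wf.shape _ hk rfl
  have h : ∃ ρ, ⟨p, leader n k, k, .checkedKey ρ⟩ ∈ S := by
    rcases hph : s.partyPhase
    · exact absurd hreq (hidle.request hph)
    · have := hidle.proposeKey hph _ _ hkey
      simp [hval] at this
    · exact hp.party.phase_key k hv (.inl hph)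
    · exact hp.party.phase_key k hv (.inr hph)
    · obtain ⟨ρ, h1⟩ := hp.commit_of_rest hidle hv hL hLD hlock hx hxc hreq hph
      obtain ⟨ρ', h2⟩ := hp.party.commit_sent _ _ _ h1
      exact hp.party.lock_sent _ _ _ h2
  obtain ⟨ρ, h1⟩ := h
  obtain ⟨-, w', hρ⟩ := hp.wf.shape _ h1 rfl
  replace hρ : ρ = tsign p (.key w' k) := hρ
  subst hρ
  obtain ⟨pr', h2⟩ := (hp.party.key_cause _ _ _ h1).resolve_left hLD
  rw [hL.lead.key_unique _ _ _ _ hk _ _ _ h2]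
  exact h1

variable {σ : ThresholdSig n} (hplock : (leader n k, Msg.proposeLock w σ) ∈ s.inbox)
include hplock

theorem LocalInv.checkedLock :
    ⟨p, leader n k, k, .checkedLock (tsign p (.lock w k))⟩ ∈ S := by
  have hk := hp.mem_of_inbox hidle hv hL hLD hreq hkey
  have hl := hp.mem_of_inbox hidle hv hL hLD hreq hplock
  have hval : pr.valid t w = true := hL.wf.shape _ hk rfl
  have hval' : tverify (n - t) (.key w k) σ = true := hL.wf.shape _ hl rfl
  have h : ∃ ρ, ⟨p, leader n k, k, .checkedLock ρ⟩ ∈ S := by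
    rcases hph : s.partyPhase
    · exact absurd hreq (hidle.request hph)
    · have := hidle.proposeKey hph _ _ hkey
      simp [hval] at this
    · have := hidle.proposeLock hph _ _ hplock
      simp [hval'] at this
    · exact hp.party.phase_lock k hv hph
    · obtain ⟨ρ, h1⟩ := hp.commit_of_rest hidle hv hL hLD hlock hx hxc hreq hph
      exact hp.party.commit_sent _ _ _ h1
  obtain ⟨ρ, h1⟩ := h
  obtain ⟨-, w', hρ⟩ := hp.wf.shape _ h1 rfl
  replace hρ : ρ = tsign p (.lock w' k) := hρ
  subst hρ
  obtain ⟨σ', h2⟩ := (hp.party.lock_cause _ _ _ h1).resolve_left hLD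
  obtain ⟨pr', h3⟩ := hL.lead.lock_key _ _ _ _ h2
  rw [hL.lead.key_unique _ _ _ _ hk _ _ _ (h3 p)]
  exact h1

variable {σ' : ThresholdSig n} (hpcommit : (leader n k, Msg.proposeCommit w σ') ∈ s.inbox)
include hpcommit

theorem LocalInv.checkedCommit :
    ⟨p, leader n k, k, .checkedCommit (tsign p (.commit w k))⟩ ∈ S := by
  have hk := hp.mem_of_inbox hidle hv hL hLD hreq hkey
  have hl := hp.mem_of_inbox hidle hv hL hLD hreq hplock
  have hc := hp.mem_of_inbox hidle hv hL hLD hreq hpcommit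
  have hval : pr.valid t w = true := hL.wf.shape _ hk rfl
  have hval' : tverify (n - t) (.key w k) σ = true := hL.wf.shape _ hl rfl
  have hval'' : tverify (n - t) (.lock w k) σ' = true := hL.wf.shape _ hc rfl
  have h : ∃ ρ, ⟨p, leader n k, k, .checkedCommit ρ⟩ ∈ S := by
    rcases hph : s.partyPhase
    · exact absurd hreq (hidle.request hph)
    · have := hidle.proposeKey hph _ _ hkey
      simp [hval] at this
    · have := hidle.proposeLock hph _ _ hplock
      simp [hval'] at this
    · have := hidle.proposeCommit hph _ _ hpcommit
      simp [hval''] at this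
    · exact hp.commit_of_rest hidle hv hL hLD hlock hx hxc hreq hph
  obtain ⟨ρ, h1⟩ := h
  obtain ⟨-, w', hρ⟩ := hp.wf.shape _ h1 rfl
  replace hρ : ρ = tsign p (.commit w' k) := hρ
  subst hρ
  obtain ⟨σ', h2⟩ := (hp.party.commit_cause _ _ _ h1).resolve_left hLD
  obtain ⟨pr', h3⟩ := hL.lead.commit_key _ _ _ _ h2
  rw [hL.lead.key_unique _ _ _ _ hk _ _ _ (h3 p)]
  exact h1

end LocalProgress

namespace Execution

/-! ### The course of a view after GST -/

section ViewOutcome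

variable {n : ℕ} [NeZero n] {E : Execution n} {t : ℕ} (H : E.Admissible t) (ht : 3 * t < n)
include H ht

/-- Among the signers of the lock and the parties whose suggestions the proposal used there is a
common honest party. It signed the lock while holding a key of at least that view, hence suggested
such a key, and the leader chose one at least as recent. -/
theorem Admissible.lockCompatible {i k : ℕ} {p : Fin n} :
    LockCompatible n k (E.config t i).sent p (E.st t i p) := by
  intro w pr hx c hc hck
  obtain ⟨Q, hQ, hQx⟩ := (H.inv ht i (leader n k)).1.lead.proposal _ _ _ _ hx
  obtain ⟨h1, h2⟩ := (H.inv ht i p).1.wf.lock c hc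
  rw [tverify_iff] at h1
  obtain ⟨q, hq1, hq2, hq⟩ := H.exists_honest_inter ht hQ h1.2.ge
  obtain ⟨x, h3, h4, h5⟩ := hQx q hq1
  have h4 := h4.resolve_left (hq.not_corrupted _)
  have h6 := h2 q hq2
  rw [h1.1] at h6
  obtain ⟨r, hr⟩ := H.signed ht (hq.not_corrupted _) h6
  obtain ⟨c1, rfl, h7⟩ := (H.inv ht i q).1.party.suggest_key _ _ _ h4 h3 _ _ _ hr hck
  obtain ⟨c', rfl, h8⟩ := h5 c1 rfl
  simpa [lockAllows] using h7.trans h8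

/-- A leader without a commit sends its request as soon as the view starts. -/
theorem Admissible.request_sent {k : ℕ} (hk : E.gst ≤ E.start k)
    (hL : leader n k ∉ (E.config t (E.after (E.start k))).corrupted)
    (hc : (E.st t (E.upto (E.start k)) (leader n k)).commit = none) :
    SentToAll (E.config t (E.after (E.start k))).sent (leader n k) k .requestSuggestion := by
  have hend := H.st_view ht hk le_rfl
    (H.after_le_upto (H.start_strictMono (Nat.lt_succ_self k))) hL
  set L := leader n k with hLdef
  set s₀ := E.st t (E.upto (E.start k)) L with hs₀
  have hview₀ : ∀ j, s₀.view = some j → j < k := by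
    intro j hj
    obtain ⟨e, he, rfl⟩ := (H.inv ht _ L).2.2 j hj
    by_contra h
    have := H.start_le_time hk (not_lt.1 h)
    have := H.lt_upto.1 he
    linarith
  have hle := H.upto_le_after (le_refl (E.start k))
  -- Among the events at the very instant at which the view starts, the first one at which the
  -- leader acts makes it enter the view, and until then it still has no commit. This matters
  -- because a commit may arrive at the same instant.
  have key : ∀ j, E.upto (E.start k) ≤ j → j ≤ E.after (E.start k) →
      E.st t j L = s₀ ∨ SentToAll (E.config t j).sent L k .requestSuggestion := by
    intro j hj
    induction j, hj using Nat.le_induction with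
    | base => exact fun _ => .inl rfl
    | succ j hj ih =>
      intro hja
      rcases ih (by omega) with h | h
      · by_cases ha : ∃ o, E.Acts t j L o
        · obtain ⟨o, ho⟩ := ha
          right
          have hvj : E.view j L = k := by
            refine H.view_eq hk ?_ ((H.lt_after.1 hja).trans_lt
              (H.start_strictMono (Nat.lt_succ_self k))) L
            by_contra h
            have := H.lt_upto.2 (not_le.1 h)
            omega
          have key := H.acts_ind ht ho (P := fun s l => (s = s₀ ∧ l = []) ∨
            (s.view = some k ∧ ∀ q, ⟨L, q, k, .requestSuggestion⟩ ∈ l)) (.inl ⟨h, rfl⟩) ?_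
          · rcases key with ⟨h1, -⟩ | ⟨-, h1⟩
            · exfalso
              have := H.acts_view ht ho
              rw [h1, hvj] at this
              exact absurd (hview₀ k this) (by omega)
            · intro q
              rw [sent_succ]
              exact .inr (h1 q)
          · rintro s l s' l' hs hm
            rw [hvj] at hm
            right
            refine ⟨hm.out.1, fun q => ?_⟩
            rcases hs with ⟨rfl, rfl⟩ | ⟨h1, h2⟩
            · have hnv : s₀.view ≠ some k := fun h => absurd (hview₀ k h) (by omega)
              cases hm with
              | enterLead => simp [mem_broadcast]
              | enterIdle _ h2 => exact absurd ⟨hLdef, hc⟩ h2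
              | _ => exact absurd (by assumption) hnv
            · exact List.mem_append_left _ (h2 q)
        · push Not at ha
          left
          rw [st_succ_of_not_acts ha, h]
      · exact .inr fun q => sent_mono (Nat.le_succ j) (h q)
  rcases key _ hle le_rfl with h | h
  · rw [h] at hend
    exact absurd (hview₀ k hend) (by omega)
  · exact h

end ViewOutcome

end Execution

namespace Execution

section ViewOutcome

variable {n : ℕ} [NeZero n] {E : Execution n} {t : ℕ}

/-- The first event later than `m Δ` after the start of view `k`. -/
noncomputable def checkpoint (E : Execution n) (k m : ℕ) : ℕ :=
  E.after (E.start k + m * E.delta)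

/-- The party `p` has answered the leader of view `k` with a key or an input before event `i`. -/
def Suggested (E : Execution n) (t k i : ℕ) (p : Fin n) : Prop :=
  ∃ x : Suggestion n, x.isCommit = false ∧
    ⟨p, leader n k, k, .suggest x⟩ ∈ (E.config t i).sent

variable (H : E.Admissible t)
include H

theorem Admissible.checkpoint_mono {k m m' : ℕ} (h : m ≤ m') :
    E.checkpoint k m ≤ E.checkpoint k m' := by
  refine H.after_mono ?_
  have : (m : ℝ) * E.delta ≤ m' * E.delta :=
    mul_le_mul_of_nonneg_right (by exact_mod_cast h) H.delta_pos.le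
  linarith

/-- Eight message delays fit strictly into a view, which lasts at least nine. -/
theorem Admissible.checkpoint_lt {k m : ℕ} (hk : E.gst ≤ E.start k) (hm : m ≤ 8) :
    E.start k + m * E.delta < E.start (k + 1) := by
  have h1 := H.start_succ hk
  have hd := H.delta_pos
  have : (m : ℝ) * E.delta ≤ 8 * E.delta :=
    mul_le_mul_of_nonneg_right (by exact_mod_cast hm) hd.le
  linarith

theorem Admissible.checkpoint_le_upto {k m : ℕ} (hk : E.gst ≤ E.start k) (hm : m ≤ 8) :
    E.checkpoint k m ≤ E.upto (E.start (k + 1)) :=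
  H.after_le_upto (H.checkpoint_lt hk hm)

variable (ht : 3 * t < n)
include ht

theorem Admissible.view_checkpoint {k m : ℕ} (hk : E.gst ≤ E.start k) (hm : m ≤ 8) {p : Fin n}
    (hp : p ∉ (E.config t (E.checkpoint k m)).corrupted) :
    (E.st t (E.checkpoint k m) p).view = some k := by
  refine H.st_view ht hk ?_ (H.checkpoint_le_upto hk hm) hp
  have := H.checkpoint_mono (k := k) (Nat.zero_le m)
  simpa [checkpoint] using this

theorem Admissible.arrived_checkpoint {k m m' : ℕ} (hk : E.gst ≤ E.start k) (hmm : m < m')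
    (hm : m' ≤ 8) {q p : Fin n} {msg : Msg n}
    (hx : ⟨q, p, k, msg⟩ ∈ (E.config t (E.checkpoint k m)).sent)
    (hp : p ∉ (E.config t (E.checkpoint k m')).corrupted) :
    (q, msg) ∈ (E.st t (E.checkpoint k m') p).inbox := by
  have h1 : E.checkpoint k (m + 1) = E.after (E.start k + m * E.delta + E.delta) := by
    unfold checkpoint; congr 1; push_cast; ring
  have hp1 : p ∉ (E.config t (E.checkpoint k (m + 1))).corrupted :=
    fun h => hp (corrupted_mono (H.checkpoint_mono hmm) h)
  have h2 := H.checkpoint_lt hk (m := m + 1) (by omega)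
  have hv := H.view_checkpoint ht hk (m := m + 1) (by omega) hp1
  refine H.inbox_stable ht (H.checkpoint_mono hmm) ?_ hv (H.view_checkpoint ht hk hm hp)
  rw [h1] at hp1 ⊢
  refine H.arrived ht hk ?_ ?_ hx hp1
  · have := mul_nonneg (Nat.cast_nonneg (α := ℝ) m) H.delta_pos.le
    linarith
  · push_cast at h2
    linarith

/-- If `n - t` honest parties answer an honest leader with keys or inputs, then it succeeds. -/
theorem Admissible.sendCommit_of_suggested {k : ℕ} (hk : E.gst ≤ E.start k)
    (hL : leader n k ∉ (E.config t (E.checkpoint k 8)).corrupted)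
    (hreq : SentToAll (E.config t (E.checkpoint k 0)).sent (leader n k) k .requestSuggestion)
    (G : Finset (Fin n)) (hG : ∀ p ∈ G, E.Honest p) (hcard : n - t ≤ G.card)
    (hsug : ∀ p ∈ G, E.Suggested t k (E.checkpoint k 1) p) :
    ∃ c, SentToAll (E.config t (E.checkpoint k 8)).sent (leader n k) k (.sendCommit c) := by
  have hL' : ∀ m, m ≤ 8 → leader n k ∉ (E.config t (E.checkpoint k m)).corrupted :=
    fun m hm h => hL (corrupted_mono (H.checkpoint_mono hm) h)
  have hvL := fun m hm => H.view_checkpoint ht hk (m := m) hm (hL' m hm)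
  have hinv := fun m p => H.inv ht (E.checkpoint k m) p
  have hle : ∀ m m', m ≤ m' → (E.config t (E.checkpoint k m)).sent ⊆
      (E.config t (E.checkpoint k m')).sent := fun m m' h => sent_mono (H.checkpoint_mono h)
  have hGv := fun m hm p (hp : p ∈ G) =>
    H.view_checkpoint ht hk (m := m) hm ((hG p hp).not_corrupted _)
  have arr : ∀ m m' q p msg, m < m' → m' ≤ 8 → p ∈ G ∨ p = leader n k →
      ⟨q, p, k, msg⟩ ∈ (E.config t (E.checkpoint k m)).sent →
      (q, msg) ∈ (E.st t (E.checkpoint k m') p).inbox := by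
    intro m m' q p msg hmm hm hp hx
    refine H.arrived_checkpoint ht hk hmm hm hx ?_
    rcases hp with hp | rfl
    · exact (hG p hp).not_corrupted _
    · exact hL' m' hm
  have done : ∀ m, m ≤ 8 →
      (∃ c, SentToAll (E.config t (E.checkpoint k m)).sent (leader n k) k (.sendCommit c)) →
      ∃ c, SentToAll (E.config t (E.checkpoint k 8)).sent (leader n k) k (.sendCommit c) :=
    fun m hm ⟨c, h⟩ => ⟨c, fun q => hle m 8 hm (h q)⟩
  -- suggestions
  have h2 : (E.st t (E.checkpoint k 2) (leader n k)).leaderPhase ≠ .suggest := by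
    intro hph
    have := ((hinv 2 (leader n k)).2.1 k (hvL 2 (by norm_num))).2.suggest hph
    have hc := card_le_suggestions (t := t)
      (inbox := (E.st t (E.checkpoint k 2) (leader n k)).inbox) G fun p hp => by
        obtain ⟨x, -, hx⟩ := hsug p hp
        exact ⟨x, arr 1 2 _ _ _ (by norm_num) (by norm_num) (.inr rfl) hx,
          ((hinv 1 p).1.wf.shape _ hx rfl).2.1⟩
    omega
  rcases ((hinv 2 (leader n k)).1.lead.request_progress k (hvL 2 (by norm_num)) (leader n k)
    (hle 0 2 (by norm_num) (hreq _))).resolve_left h2 with ⟨w, pr, hkey⟩ | h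
  swap
  · exact done 2 (by norm_num) h
  have hprem : ∀ m p, 3 ≤ m → m ≤ 8 → p ∈ G →
      (leader n k, Msg.requestSuggestion) ∈ (E.st t (E.checkpoint k m) p).inbox ∧
      (leader n k, Msg.proposeKey w pr) ∈ (E.st t (E.checkpoint k m) p).inbox :=
    fun m p h3 h8 hp => ⟨arr 0 m _ _ _ (by omega) h8 (.inl hp) (hreq p),
      arr 2 m _ _ _ (by omega) h8 (.inl hp) (hkey p)⟩
  -- keys
  have h3 : ∀ p ∈ G, ⟨p, leader n k, k, .checkedKey (tsign p (.key w k))⟩ ∈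
      (E.config t (E.checkpoint k 3)).sent := by
    intro p hp
    obtain ⟨x, hxc, hx⟩ := hsug p hp
    have hv := hGv 3 (by norm_num) p hp
    obtain ⟨g1, g2⟩ := hprem 3 p (by norm_num) (by norm_num) hp
    exact (hinv 3 p).1.checkedKey ((hinv 3 p).2.1 k hv).1 hv (hinv 3 (leader n k)).1
      (hL' 3 (by norm_num)) (H.lockCompatible ht) (hle 1 3 (by norm_num) hx) hxc g1 g2
  have h4 : ∃ σ, SentToAll (E.config t (E.checkpoint k 4)).sent (leader n k) k
      (.proposeLock w σ) := by
    -- Either the leader has moved on or it still waits for key signatures; but those of the `n - t`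
    -- parties in `G` have arrived, so waiting would contradict idleness. The other stages of the
    -- leader work in the same way.
    refine ((hinv 4 (leader n k)).1.lead.key_progress k (hvL 4 (by norm_num)) (leader n k) w pr
      (hle 2 4 (by norm_num) (hkey _))).resolve_left fun hph => ?_
    have := ((hinv 4 (leader n k)).2.1 k (hvL 4 (by norm_num))).2.checkedKey w hph
    have hc := card_le_responders (wrap := .checkedKey) (m := .key w k)
      (inbox := (E.st t (E.checkpoint k 4) (leader n k)).inbox) G fun p hp =>
        arr 3 4 _ _ _ (by norm_num) (by norm_num) (.inr rfl) (h3 p hp)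
    omega
  obtain ⟨σ, hplock⟩ := h4
  -- locks
  have h5 : ∀ p ∈ G, ⟨p, leader n k, k, .checkedLock (tsign p (.lock w k))⟩ ∈
      (E.config t (E.checkpoint k 5)).sent := by
    intro p hp
    obtain ⟨x, hxc, hx⟩ := hsug p hp
    have hv := hGv 5 (by norm_num) p hp
    obtain ⟨g1, g2⟩ := hprem 5 p (by norm_num) (by norm_num) hp
    exact (hinv 5 p).1.checkedLock ((hinv 5 p).2.1 k hv).1 hv (hinv 5 (leader n k)).1
      (hL' 5 (by norm_num)) (H.lockCompatible ht) (hle 1 5 (by norm_num) hx) hxc g1 g2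
      (arr 4 5 _ _ _ (by norm_num) (by norm_num) (.inl hp) (hplock p))
  have h6 : ∃ σ, SentToAll (E.config t (E.checkpoint k 6)).sent (leader n k) k
      (.proposeCommit w σ) := by
    refine ((hinv 6 (leader n k)).1.lead.lock_progress k (hvL 6 (by norm_num)) (leader n k) w σ
      (hle 4 6 (by norm_num) (hplock _))).resolve_left fun hph => ?_
    have := ((hinv 6 (leader n k)).2.1 k (hvL 6 (by norm_num))).2.checkedLock w hph
    have hc := card_le_responders (wrap := .checkedLock) (m := .lock w k)
      (inbox := (E.st t (E.checkpoint k 6) (leader n k)).inbox) G fun p hp =>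
        arr 5 6 _ _ _ (by norm_num) (by norm_num) (.inr rfl) (h5 p hp)
    omega
  obtain ⟨σ', hpcommit⟩ := h6
  -- commits
  have h7 : ∀ p ∈ G, ⟨p, leader n k, k, .checkedCommit (tsign p (.commit w k))⟩ ∈
      (E.config t (E.checkpoint k 7)).sent := by
    intro p hp
    obtain ⟨x, hxc, hx⟩ := hsug p hp
    have hv := hGv 7 (by norm_num) p hp
    obtain ⟨g1, g2⟩ := hprem 7 p (by norm_num) (by norm_num) hp
    exact (hinv 7 p).1.checkedCommit ((hinv 7 p).2.1 k hv).1 hv (hinv 7 (leader n k)).1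
      (hL' 7 (by norm_num)) (H.lockCompatible ht) (hle 1 7 (by norm_num) hx) hxc g1 g2
      (arr 4 7 _ _ _ (by norm_num) (by norm_num) (.inl hp) (hplock p))
      (arr 6 7 _ _ _ (by norm_num) (by norm_num) (.inl hp) (hpcommit p))
  refine ((hinv 8 (leader n k)).1.lead.commit_progress k (hvL 8 (by norm_num)) (leader n k) w σ'
    (hle 6 8 (by norm_num) (hpcommit _))).resolve_left fun hph => ?_
  have := ((hinv 8 (leader n k)).2.1 k (hvL 8 (by norm_num))).2.checkedCommit w hph
  have hc := card_le_responders (wrap := .checkedCommit) (m := .commit w k)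
    (inbox := (E.st t (E.checkpoint k 8) (leader n k)).inbox) G fun p hp =>
      arr 7 8 _ _ _ (by norm_num) (by norm_num) (.inr rfl) (h7 p hp)
  omega

omit H ht in
-- With at least two parties nobody leads two consecutive views. Hence between two views of the same
-- leader there is a whole view in which earlier messages arrive.
theorem leader_add_two_le {b k : ℕ} (hn : 2 ≤ n) (h : leader n b = leader n k) (hbk : b < k) :
    b + 2 ≤ k := by
  have h1 : b % n = k % n := congrArg Fin.val h
  by_contra h2
  have h3 : k = b + 1 := by omega
  subst h3
  have h4 : (b + 1 - b) % n = 0 := Nat.sub_mod_eq_zero_of_mod_eq h1.symm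
  rw [Nat.add_sub_cancel_left, Nat.mod_eq_of_lt (by omega)] at h4
  omega

/-- A commit that was suggested to `L` in an earlier view than `k` has reached `L` when view `k`
starts. -/
theorem Admissible.commit_of_suggested {j b i : ℕ} (hj : E.gst ≤ E.start j) {p : Fin n}
    {c : Cert n} (hb : b < j + 1) (hpL : leader n b = leader n (j + 1))
    (hx : ⟨p, leader n (j + 1), b, .suggest (.commit c)⟩ ∈ (E.config t i).sent)
    (hL : leader n (j + 1) ∉ (E.config t (E.upto (E.start (j + 1)))).corrupted) :
    (E.st t (E.upto (E.start (j + 1))) (leader n (j + 1))).commit ≠ none := by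
  obtain ⟨e, he, hx⟩ := mem_sent hx
  obtain ⟨-, -, -, hv⟩ := H.sends_acts ht hx
  dsimp only at hv
  have hj1 := H.gst_le_start hj (Nat.le_succ j)
  have hd := H.delta_pos
  -- If the leader suggested the commit to itself, it already has one; this also covers `n = 1`,
  -- where the leader never changes. Otherwise the suggestion was sent before view `j`, and it
  -- arrives during that view at the latest.
  by_cases hp : p = leader n (j + 1)
  · have h1 : e < E.upto (E.start (j + 1)) :=
      H.lt_upto.2 (H.time_lt_start hj1 (p := p) (by omega))
    have h2 := sent_of_sends hx h1
    rw [← hp] at h2 ⊢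
    exact (H.inv ht _ p).1.party.sent_commit _ _ _ h2
  · have hn : 2 ≤ n := by
      by_contra hn
      have : n = 1 := by have := NeZero.pos n; omega
      subst this
      exact hp (Subsingleton.elim _ _)
    have h1 := leader_add_two_le hn hpL hb
    have h2 : E.time e < E.start j := H.time_lt_start hj (p := p) (by omega)
    have hval : c.isCommit t = true := by
      have := (H.inv ht (e + 1) p).1.wf.shape _ (sent_of_sends hx (Nat.lt_succ_self e)) rfl
      exact this.2.1
    refine H.commit_arrived ht hx (c := c) rfl hval (fun j' hj' => ?_) hL
    refine H.lt_upto.2 ?_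
    have h3 := H.start_succ hj
    have h4 : max (E.time e) E.gst ≤ E.start j := max_le h2.le hj
    linarith

end ViewOutcome

end Execution

namespace Execution

/-! ### Success or failure of a view, and termination -/

section Termination

variable {n : ℕ} [NeZero n] {E : Execution n} {t : ℕ}

/-- The set of parties that are never corrupted. -/
noncomputable def honest (E : Execution n) : Finset (Fin n) :=
  open Classical in Finset.univ.filter E.Honest

theorem mem_honest {p : Fin n} : p ∈ E.honest ↔ E.Honest p := by
  simp [honest]

theorem card_honest : E.honest.card + E.f = n := by
  classical
  have h : E.f = (Finset.univ.filter fun p => ¬ E.Honest p).card := by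
    rw [f, ← Set.ncard_coe_finset]
    congr 1
    ext p
    simp [Honest]
  rw [h]
  have := Finset.card_filter_add_card_filter_not (s := (Finset.univ : Finset (Fin n))) E.Honest
  simpa [honest] using this

/-- A view in which the leader succeeds. -/
def Succeeds (E : Execution n) (t k : ℕ) : Prop :=
  ∃ c, SentToAll (E.config t (E.upto (E.start (k + 1)))).sent (leader n k) k (.sendCommit c)

/-- A view in which the leader fails, because more than `t - f` honest parties have a commit, but
not more than `t` of them: these are the parties in `R`. -/
def Fails (E : Execution n) (t k : ℕ) (R : Finset (Fin n)) : Prop :=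
  R ⊆ E.honest ∧ t < R.card + E.f ∧ R.card ≤ t ∧
  (∀ p ∈ R, (E.st t (E.upto (E.start (k + 1))) p).commit ≠ none) ∧
  (∀ p ∈ E.honest, (E.st t (E.upto (E.start k)) p).commit ≠ none → p ∈ R) ∧
  (E.st t (E.upto (E.start (k + 1))) (leader n k)).commit ≠ none

variable (H : E.Admissible t) (ht : 3 * t < n)
include H ht

/-- The honest parties split into `G`, which have answered with a key or an input after one delay,
and `R`, which answer with a commit. If `G` has `n - t` members the leader succeeds. If not, `R` has
more than `t - f` members, and the leader succeeds by forwarding a commit unless it proposes on the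
basis of `n - t` suggestions, all from outside `R`. The preceding view must also start after GST, so
that commits suggested to this leader earlier have reached it. -/
theorem Admissible.view_outcome {j : ℕ} (hj : E.gst ≤ E.start j)
    (hL : leader n (j + 1) ∉ (E.config t (E.upto (E.start (j + 2)))).corrupted)
    (hc : (E.st t (E.upto (E.start (j + 1))) (leader n (j + 1))).commit = none) :
    E.Succeeds t (j + 1) ∨ ∃ R, E.Fails t (j + 1) R := by
  classical
  obtain ⟨k, hkdef⟩ : ∃ k, k = j + 1 := ⟨_, rfl⟩
  have hk : E.gst ≤ E.start k := H.gst_le_start hj (by omega)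
  rw [show j + 2 = k + 1 by omega] at hL
  rw [← hkdef] at hc hL ⊢
  have hcp := fun m (hm : m ≤ 8) => H.checkpoint_le_upto (k := k) hk hm
  have hL' : ∀ m, m ≤ 8 → leader n k ∉ (E.config t (E.checkpoint k m)).corrupted :=
    fun m hm h => hL (corrupted_mono (hcp m hm) h)
  have hL₀ : leader n k ∉ (E.config t (E.upto (E.start k))).corrupted :=
    fun h => hL (corrupted_mono (H.upto_mono (H.start_strictMono.monotone (by omega))) h)
  have h0 : E.checkpoint k 0 = E.after (E.start k) := by simp [checkpoint]
  have hreq : SentToAll (E.config t (E.checkpoint k 0)).sent (leader n k) k .requestSuggestion := by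
    rw [h0]
    exact H.request_sent ht hk (by rw [← h0]; exact hL' 0 (by norm_num)) hc
  have hdone : ∀ m, m ≤ 8 →
      (∃ c, SentToAll (E.config t (E.checkpoint k m)).sent (leader n k) k (.sendCommit c)) →
      E.Succeeds t k := fun m hm ⟨c, h⟩ => ⟨c, fun q => sent_mono (hcp m hm) (h q)⟩
  have hnot : ∀ p ∈ E.honest, ∀ i, p ∉ (E.config t i).corrupted :=
    fun p hp i => (mem_honest.1 hp).not_corrupted i
  set G := E.honest.filter fun p => E.Suggested t k (E.checkpoint k 1) p with hG
  set R := E.honest.filter fun p => ¬ E.Suggested t k (E.checkpoint k 1) p with hR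
  have hGR : G.card + R.card = E.honest.card := Finset.card_filter_add_card_filter_not _
  have hcard := E.card_honest
  have hf := H.faulty_le
  by_cases hGcard : n - t ≤ G.card
  · left
    exact hdone 8 le_rfl (H.sendCommit_of_suggested ht hk (hL' 8 le_rfl) hreq G
      (fun p hp => mem_honest.1 (Finset.mem_filter.1 hp).1) hGcard
      fun p hp => (Finset.mem_filter.1 hp).2)
  -- the parties in `R` suggest a commit
  have hsentTo : ∀ p ∈ R, leader n k ∈ (E.st t (E.checkpoint k 1) p).commitSentTo := by
    intro p hp
    obtain ⟨hp1, hp2⟩ := Finset.mem_filter.1 hp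
    have hv := H.view_checkpoint ht hk (m := 1) (by norm_num) (hnot p hp1 _)
    have hinv := H.inv ht (E.checkpoint k 1) p
    have hin := H.arrived_checkpoint ht hk (m := 0) (m' := 1) (by norm_num) (by norm_num)
      (hreq p) (hnot p hp1 _)
    have hph := mt (hinv.2.1 k hv).1.request (by simpa using hin)
    by_cases hrest : (E.st t (E.checkpoint k 1) p).partyPhase = .rest
    · exact (hinv.1.party.rest k hv hrest).resolve_left hp2
    · exact absurd (hinv.1.party.suggested k hv hph hrest) hp2
  have hsug : ∀ p ∈ R, ∃ c, ⟨p, leader n k, k, .suggest (.commit c)⟩ ∈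
      (E.config t (E.checkpoint k 1)).sent := by
    intro p hp
    have hp1 := (Finset.mem_filter.1 hp).1
    have hinv := H.inv ht (E.checkpoint k 1) p
    obtain ⟨c, b, hx⟩ := hinv.1.party.sent_to _ (hsentTo p hp)
    have hb : b ≤ k := by
      obtain ⟨j', hj', hbj⟩ := hinv.1.wf.view_le _ hx rfl
      rw [H.view_checkpoint ht hk (m := 1) (by norm_num) (hnot p hp1 _)] at hj'
      cases hj'
      exact hbj
    have hlead : leader n k = leader n b := (hinv.1.wf.shape _ hx rfl).1
    -- The record `commitSentTo` does not tell when the commit was suggested. Had it been in an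
    -- earlier view, the leader would have a commit by now, contrary to `hc`.
    rcases hb.eq_or_lt with rfl | hb
    · exact ⟨c, hx⟩
    · subst hkdef
      exact absurd hc (H.commit_of_suggested ht hj hb hlead.symm hx hL₀)
  have hcommit : ∀ p ∈ R, (E.st t (E.checkpoint k 1) p).commit ≠ none := by
    intro p hp
    obtain ⟨c, hx⟩ := hsug p hp
    exact (H.inv ht _ p).1.party.sent_commit _ _ _ hx
  -- the leader gets `n - t` suggestions
  have hvL := H.view_checkpoint ht hk (m := 2) (by norm_num) (hL' 2 (by norm_num))
  have hinvL := H.inv ht (E.checkpoint k 2) (leader n k)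
  have h2 : (E.st t (E.checkpoint k 2) (leader n k)).leaderPhase ≠ .suggest := by
    intro hph
    have := (hinvL.2.1 k hvL).2.suggest hph
    have hc := card_le_suggestions (t := t)
      (inbox := (E.st t (E.checkpoint k 2) (leader n k)).inbox) E.honest fun p hp => by
        have : ∃ x, ⟨p, leader n k, k, .suggest x⟩ ∈ (E.config t (E.checkpoint k 1)).sent := by
          by_cases hpG : E.Suggested t k (E.checkpoint k 1) p
          · obtain ⟨x, -, hx⟩ := hpG
            exact ⟨x, hx⟩
          · obtain ⟨c, hx⟩ := hsug p (Finset.mem_filter.2 ⟨hp, hpG⟩)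
            exact ⟨_, hx⟩
        obtain ⟨x, hx⟩ := this
        exact ⟨x, H.arrived_checkpoint ht hk (m := 1) (by norm_num) (by norm_num) hx
          (hL' 2 (by norm_num)), ((H.inv ht _ p).1.wf.shape _ hx rfl).2.1⟩
    omega
  rcases (hinvL.1.lead.request_progress k hvL (leader n k) (sent_mono
    (H.checkpoint_mono (by norm_num)) (hreq _))).resolve_left h2 with ⟨w, pr, hkey⟩ | h
  swap
  · exact .inl (hdone 2 (by norm_num) h)
  right
  obtain ⟨Q, hQ, hQx⟩ := hinvL.1.lead.proposal _ _ _ _ (hkey (leader n k))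
  -- An honest party does not suggest both a commit and something else in one view.
  have hdisj : Disjoint Q R := by
    rw [Finset.disjoint_left]
    intro q hq hqR
    obtain ⟨x, hx1, hx2, -⟩ := hQx q hq
    have hx2 := hx2.resolve_left (hnot q (Finset.mem_filter.1 hqR).1 _)
    obtain ⟨c, hx⟩ := hsug q hqR
    have := (H.inv ht _ q).1.party.suggest_kind _ _ _ hx2 _ _
      (sent_mono (H.checkpoint_mono (by norm_num)) hx)
    rw [hx1] at this
    simp [Suggestion.isCommit] at this
  have hQR : Q.card + R.card ≤ n := by
    rw [← Finset.card_union_of_disjoint hdisj]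
    simpa using Finset.card_le_univ (Q ∪ R)
  -- The lower bound comes from `G.card < n - t` and `G.card + R.card = n - f`, the upper bound from
  -- the `n - t` parties of `Q` outside `R`.
  refine ⟨R, Finset.filter_subset _ _, by omega, by omega, ?_, ?_, ?_⟩
  · exact fun p hp => H.commit_mono ht (hcp 1 (by norm_num)) (hcommit p hp)
  · intro p hp hpc
    refine Finset.mem_filter.2 ⟨hp, ?_⟩
    rintro ⟨x, hx1, hx2⟩
    exact hpc (H.commit_eq_none_upto ht hk hx2 (.inr ⟨x, rfl, hx1⟩))
  -- Since `f ≤ t`, the lower bound makes `R` nonempty; a commit suggested by one of its members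
  -- reaches the leader, possibly too late for its proposal but before the view ends.
  · have hRne : R.Nonempty := by
      rw [← Finset.card_pos]
      omega
    obtain ⟨p, hp⟩ := hRne
    obtain ⟨c, hx⟩ := hsug p hp
    have hval : c.isCommit t = true := ((H.inv ht _ p).1.wf.shape _ hx rfl).2.1
    obtain ⟨e, he, hx⟩ := mem_sent hx
    refine H.commit_arrived ht hx (c := c) rfl hval (fun j' hj' => ?_) hL
    have h3 := H.lt_after.1 he
    have h4 := H.start_succ hk
    have hd := H.delta_pos
    refine H.lt_upto.2 ?_
    have h5 : max (E.time e) E.gst ≤ E.start k + 1 * E.delta :=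
      max_le (by simpa using h3) (by linarith)
    linarith

/-- The commit is sent at the latest at the end of view `k`, hence is received within view `k + 1`;
this accounts for the 2. -/
theorem Admissible.commit_of_succeeds {k : ℕ} (hk : E.gst ≤ E.start k) (h : E.Succeeds t k)
    {m : ℕ} (hm : k + 2 ≤ m) {p : Fin n} (hp : p ∉ (E.config t (E.upto (E.start m))).corrupted) :
    (E.st t (E.upto (E.start m)) p).commit ≠ none := by
  obtain ⟨c, hc⟩ := h
  have hval : c.isCommit t = true := (H.inv ht _ (leader n k)).1.wf.shape _ (hc p) rfl
  obtain ⟨e, he, hx⟩ := mem_sent (hc p)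
  refine H.commit_arrived ht hx (c := c) rfl hval (fun j' hj' => ?_) hp
  have h1 := H.lt_upto.1 he
  have hk1 : E.gst ≤ E.start (k + 1) := H.gst_le_start hk (by omega)
  have h2 := H.start_succ hk1
  have hd := H.delta_pos
  have h3 := H.start_strictMono.monotone hm
  refine H.lt_upto.2 ?_
  have h5 : max (E.time e) E.gst ≤ E.start (k + 1) := max_le h1.le hk1
  linarith

/-- A leader that is not corrupted has a commit two views later. -/
theorem Admissible.leader_commits {j : ℕ} (hj : E.gst ≤ E.start j) {m : ℕ} (hm : j + 3 ≤ m)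
    (hL : leader n (j + 1) ∉ (E.config t (E.upto (E.start m))).corrupted) :
    (E.st t (E.upto (E.start m)) (leader n (j + 1))).commit ≠ none := by
  have hle : ∀ i, i ≤ m → E.upto (E.start i) ≤ E.upto (E.start m) :=
    fun i hi => H.upto_mono (H.start_strictMono.monotone hi)
  by_cases hc : (E.st t (E.upto (E.start (j + 1))) (leader n (j + 1))).commit = none
  · rcases H.view_outcome ht hj (fun h => hL (corrupted_mono (hle (j + 2) (by omega)) h)) hc with
      h | ⟨R, h⟩
    · exact H.commit_of_succeeds ht (H.gst_le_start hj (by omega)) h (by omega) hL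
    · exact H.commit_mono ht (hle (j + 2) (by omega)) h.2.2.2.2.2
  · exact H.commit_mono ht (hle _ (by omega)) hc

omit H ht in
theorem exists_view_of_leader (a : ℕ) (p : Fin n) : ∃ k, a ≤ k ∧ k < a + n ∧ leader n k = p := by
  have hn := NeZero.pos n
  have hp := p.isLt
  -- The offset is the residue of `p - a` modulo `n`, written without a truncated subtraction.
  refine ⟨a + (p + (n - a % n)) % n, by omega, ?_, ?_⟩
  · have := Nat.mod_lt (p + (n - a % n)) hn
    omega
  · apply Fin.ext
    change (a + (p + (n - a % n)) % n) % n = p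
    have h1 := Nat.mod_lt a hn
    have h2 : a + (p + (n - a % n)) = p + n * (a / n + 1) := by
      have := Nat.div_add_mod a n
      rw [mul_add, mul_one]
      omega
    rw [Nat.add_mod_mod, h2, Nat.add_mul_mod_self_left, Nat.mod_eq_of_lt hp]

/-- From some view on, every party that is not corrupted has a commit. -/
theorem Admissible.all_commit {j : ℕ} (hj : E.gst ≤ E.start j) {m : ℕ} (hm : j + n + 2 ≤ m)
    {p : Fin n} (hp : p ∉ (E.config t (E.upto (E.start m))).corrupted) :
    (E.st t (E.upto (E.start m)) p).commit ≠ none := by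
  obtain ⟨k, hk1, hk2, rfl⟩ := exists_view_of_leader (j + 1) p
  obtain ⟨k, rfl⟩ : ∃ i, k = i + 1 := ⟨k - 1, by omega⟩
  exact H.leader_commits ht (H.gst_le_start hj (by omega)) (by omega) hp

omit ht in
theorem Admissible.exists_start : ∃ k, E.gst ≤ E.start k :=
  (Filter.tendsto_atTop.1 (H.views.unbounded 0) E.gst).exists

theorem Admissible.termination : E.Termination t := by
  intro p hp
  obtain ⟨j, hj⟩ := H.exists_start
  have h := H.all_commit ht hj le_rfl (hp.not_corrupted _)
  obtain ⟨c, hc⟩ := Option.ne_none_iff_exists'.1 h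
  refine ⟨E.upto (E.start (j + n + 2)), c.value, ?_⟩
  have := (H.inv ht (E.upto (E.start (j + n + 2))) p).1.wf.decision
  rw [hc] at this
  exact this

end Termination

end Execution

/-! ### Potential functions for counting messages -/

section Cost

variable {n : ℕ} [NeZero n]

theorem countP_le_sum {α ι : Type*} (s : Finset ι) (P : ι → α → Prop)
    [∀ i, DecidablePred (P i)] (l : List α) (h : ∀ x ∈ l, ∃ i ∈ s, P i x) :
    l.length ≤ ∑ i ∈ s, l.countP (P i ·) := by
  induction l with
  | nil => simp
  | cons a l ih =>
    obtain ⟨i, hi, hia⟩ := h a (by simp)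
    have h1 := ih fun x hx => h x (by simp [hx])
    simp only [List.countP_cons, Finset.sum_add_distrib, List.length_cons]
    have h2 := Finset.single_le_sum (f := fun i => if decide (P i a) = true then 1 else 0)
      (fun _ _ => Nat.zero_le _) hi
    simp only [hia, decide_true, if_true] at h2
    omega

/-- A bound on the number of messages that `p` sends in view `k`. -/
def quota (p : Fin n) (k : ℕ) : ℕ := 4 + if p = leader n k then 5 * n else 0

/-- A bound on the number of messages that `p` still sends in view `k`. -/
def credit (p : Fin n) (k : ℕ) (s : State n) : ℕ :=
  match s.view with
  | none => quota p k
  | some j =>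
    if j < k then quota p k else
      if j = k then s.partyPhase.rank + n * s.leaderPhase.rank else 0

theorem credit_of_lt {p : Fin n} {k : ℕ} {s : State n} (h : ∀ j, s.view = some j → j < k) :
    credit p k s = quota p k := by
  unfold credit
  split
  · rfl
  · rw [if_pos (h _ ‹_›)]

theorem credit_of_eq {p : Fin n} {k : ℕ} {s : State n} (h : s.view = some k) :
    credit p k s = s.partyPhase.rank + n * s.leaderPhase.rank := by
  simp [credit, h]

theorem credit_of_gt {p : Fin n} {k b : ℕ} {s : State n} (h : s.view = some b) (hb : k < b) :
    credit p k s = 0 := by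
  simp only [credit, h]
  rw [if_neg (by omega), if_neg (by omega)]

variable {t : ℕ} {p : Fin n} {v : Value} {k b : ℕ} {o : Option (Packet n)}
  {s s' : State n} {l : List (Packet n)}

/-- Every transition pays for its messages out of the credit: a reply costs one of the four party
ranks, a broadcast costs one of the four leader ranks, each worth `n`. Entering a view as its active
leader turns the quota `4 + 5 * n` into `n` requests and the credit `4 + 4 * n`. -/
theorem Micro.length_add_credit (h : Micro t p v k o s s' l) :
    l.length + credit p k s' ≤ credit p k s := by
  rw [credit_of_eq h.out.1]
  cases h with
  | enterLead h1 h2 h3 =>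
    rw [credit_of_lt h1]
    simp only [length_broadcast, quota, h2, if_true, PartyPhase.rank, LeaderPhase.rank]
    omega
  | enterIdle h1 h2 =>
    rw [credit_of_lt h1]
    simp [quota, PartyPhase.rank, LeaderPhase.rank]
  | leadCommit _ h1 h2 | leadKey _ h1 h2 | leadInput _ _ h1 h2 | leadLock _ _ h1 h2
  | leadPropCommit _ _ h1 h2 | leadSend _ _ h1 h2 =>
    rw [credit_of_eq h1, length_broadcast, h2]
    simp only [LeaderPhase.rank]
    omega
  | accept _ _ h1 | recv _ h1 => simp [credit_of_eq h1]
  | requestOld h1 h2 | requestCommit _ h1 h2 | requestKey _ h1 h2 | requestInput h1 h2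
  | keyAccept _ _ h1 h2 | keyReject _ _ h1 h2 | setKey _ _ h1 h2 | setLock _ _ h1 h2 =>
    rw [credit_of_eq h1, h2]
    simp only [PartyPhase.rank, List.length_cons, List.length_nil]
    omega

theorem Micro.view_le_of_view (h : Micro t p v b o s s' l) {j : ℕ} (hj : s.view = some j) :
    j ≤ b := by
  cases h with
  | enterLead h1 | enterIdle h1 => exact (h1 j hj).le
  | accept _ _ h1 | recv _ h1 => rw [h1] at hj; cases hj; rfl
  | requestOld h1 | requestCommit _ h1 | requestKey _ h1 | requestInput h1
  | keyAccept _ _ h1 | keyReject _ _ h1 | setKey _ _ h1 | setLock _ _ h1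
  | leadCommit _ h1 | leadKey _ h1 | leadInput _ _ h1 | leadLock _ _ h1
  | leadPropCommit _ _ h1 | leadSend _ _ h1 => rw [h1] at hj; cases hj; rfl

theorem Micro.countP_add_credit (h : Micro t p v b o s s' l) (k : ℕ) :
    l.countP (fun x => x.src = p ∧ x.view = k) + credit p k s' ≤ credit p k s := by
  rcases lt_trichotomy b k with hb | rfl | hb
  · have h1 : l.countP (fun x => x.src = p ∧ x.view = k) = 0 := by
      rw [List.countP_eq_zero]
      intro x hx
      have := (h.out.2 x hx).2
      simp only [decide_eq_true_eq]
      omega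
    rw [h1, credit_of_lt (s := s), credit_of_lt (s := s'), zero_add]
    · intro j hj
      rw [h.out.1] at hj
      cases hj
      exact hb
    · exact fun j hj => (h.view_le_of_view hj).trans_lt hb
  · exact (Nat.add_le_add_right List.countP_le_length _).trans h.length_add_credit
  · have h1 : l.countP (fun x => x.src = p ∧ x.view = k) = 0 := by
      rw [List.countP_eq_zero]
      intro x hx
      have := (h.out.2 x hx).2
      simp only [decide_eq_true_eq]
      omega
    rw [h1, credit_of_gt h.out.1 hb]
    exact Nat.zero_le _

/-- The state of a party that has a commit and does no more than suggest it. -/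
def Settled (s : State n) : Prop :=
  s.commit ≠ none ∧ (s.partyPhase = .request ∨ s.partyPhase = .rest) ∧ s.leaderPhase = .off

/-- The only message of a settled party is a commit to a leader that is not yet in `commitSentTo`
and is then inserted. So messages to `F` are paid for by the growth of `commitSentTo ∩ F`. `Settled`
is assumed only if the view does not change, because entering a view with a commit establishes it.
-/
theorem Micro.settled (h : Micro t p v b o s s' l) (F : Finset (Fin n))
    (hc : s.commit ≠ none) (hs : ∀ j, s.view = some j → j = b → Settled s) :
    Settled s' ∧ l.countP (fun x => x.dst ∈ F) + (s.commitSentTo ∩ F).card ≤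
      (s'.commitSentTo ∩ F).card := by
  cases h with
  | enterLead _ _ h => exact absurd h hc
  | enterIdle _ _ => exact ⟨⟨hc, .inl rfl, rfl⟩, by simp⟩
  | accept _ _ h1 _ _ _ h => exact absurd h hc
  | recv _ h1 => exact ⟨hs _ h1 rfl, by simp⟩
  | requestOld h1 => exact ⟨⟨hc, .inr rfl, (hs _ h1 rfl).2.2⟩, by simp⟩
  | requestCommit _ h1 _ _ _ h2 =>
    refine ⟨⟨hc, .inr rfl, (hs _ h1 rfl).2.2⟩, ?_⟩
    by_cases hF : GSTAgreement.leader n b ∈ F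
    · rw [Finset.insert_inter_of_mem hF, Finset.card_insert_of_notMem (by simp [h2])]
      simp [hF, add_comm]
    · rw [Finset.insert_inter_of_notMem hF]
      simp [hF]
  | requestKey _ _ _ _ h | requestInput _ _ _ h => exact absurd h hc
  | keyAccept _ _ h1 h2 | keyReject _ _ h1 h2 | setKey _ _ h1 h2 | setLock _ _ h1 h2 =>
    have := (hs _ h1 rfl).2.1
    simp [h2] at this
  | leadCommit _ h1 h2 | leadKey _ h1 h2 | leadInput _ _ h1 h2 | leadLock _ _ h1 h2
  | leadPropCommit _ _ h1 h2 | leadSend _ _ h1 h2 =>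
    have := (hs _ h1 rfl).2.2
    simp [h2] at this

end Cost

namespace Execution

/-! ### Active views and late messages -/

section Messages

variable {n : ℕ} [NeZero n] {E : Execution n} {t : ℕ} (H : E.Admissible t) (ht : 3 * t < n)
include H ht

theorem Admissible.sum_countP_view_le (p : Fin n) (k N : ℕ) :
    ∑ i ∈ Finset.range N, (E.sends t i).countP (fun x => x.src = p ∧ x.view = k) ≤ quota p k := by
  suffices h : ∑ i ∈ Finset.range N, (E.sends t i).countP (fun x => x.src = p ∧ x.view = k) +
      credit p k (E.st t N p) ≤ quota p k by omega
  induction N with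
  | zero => simp [credit, st, config, Config.start, State.start]
  | succ N ih =>
    rw [Finset.sum_range_succ]
    by_cases ha : ∃ o, E.Acts t N p o
    · obtain ⟨o, ho⟩ := ha
      have := H.acts_ind ht ho (P := fun s l => l.countP (fun x => x.src = p ∧ x.view = k) +
        credit p k s ≤ credit p k (E.st t N p)) (by simp) fun s l s' l' h hm => by
          have := hm.countP_add_credit k
          simp only [List.countP_append]
          omega
      omega
    · push Not at ha
      have h0 : (E.sends t N).countP (fun x => x.src = p ∧ x.view = k) = 0 := by
        rw [List.countP_eq_zero]
        intro x hx
        obtain ⟨o, ho, -⟩ := H.sends_acts ht hx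
        simp only [decide_eq_true_eq]
        rintro ⟨rfl, -⟩
        exact ha o ho
      rw [h0, st_succ_of_not_acts ha]
      exact ih

omit ht H in
theorem sum_quota (k : ℕ) : ∑ p : Fin n, quota p k = 9 * n := by
  simp only [quota, Finset.sum_add_distrib, Finset.sum_ite_eq', Finset.mem_univ, if_true,
    Finset.sum_const, Finset.card_univ, Fintype.card_fin, smul_eq_mul]
  omega

/-- If messages are sent in a view after GST, its leader has been corrupted or had no commit at
the beginning. -/
theorem Admissible.leader_of_sends {e : ℕ} {x : Packet n} (hx : x ∈ E.sends t e)
    (hk : E.gst ≤ E.start x.view) :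
    (x.msg.isReply = true ∧ leader n x.view ∈ (E.config t (e + 1)).corrupted) ∨
      (E.st t (E.upto (E.start x.view)) (leader n x.view)).commit = none ∧
      (x.msg.isReply = true ∨ x.src = leader n x.view) := by
  have hx' := sent_of_sends hx (Nat.lt_succ_self e)
  obtain ⟨p, q, k, m⟩ := x
  have hinv := (H.inv ht (e + 1) p).1
  cases hm : m.isReply
  · obtain ⟨h1, h2⟩ := hinv.lead.request_sent _ _ _ hx' hm
    subst h1
    exact .inr ⟨H.commit_eq_none_upto ht hk (h2 (leader n k)) (.inl rfl), .inr rfl⟩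
  · rcases hinv.party.cause _ _ _ hx' hm with h | h
    · exact .inl ⟨rfl, h⟩
    · exact .inr ⟨H.commit_eq_none_upto ht hk h (.inl rfl), .inl rfl⟩

omit ht in
-- The view that follows the one in progress at an event after GST starts after GST as well, hence
-- at the common time; so at most one view before `k` can still be in progress.
theorem Admissible.le_view {k : ℕ} (hk : ∀ j < k, ¬ E.gst ≤ E.start j) {i : ℕ}
    (hi : E.gst ≤ E.time i) (p : Fin n) : k ≤ E.view i p + 1 := by
  by_contra h
  have h1 := hk (E.view i p + 1) (by omega)
  have h2 := (viewAt_spec H.views (H.time_nonneg i) p).2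
  refine h1 ?_
  have h3 : E.gst ≤ E.enter p (E.view i p + 1) := hi.trans h2.le
  unfold start
  rwa [H.views.common p 0 _ h3]

/-- The views in which the leader fails although it is honest and has no commit. -/
theorem Admissible.card_fails_le {A : Finset ℕ} (hA : Set.InjOn (leader n) A)
    (h : ∀ k ∈ A, E.Honest (leader n k) ∧
      (E.st t (E.upto (E.start k)) (leader n k)).commit = none ∧ ∃ R, E.Fails t k R) :
    A.card ≤ E.f + 1 := by
  rcases A.eq_empty_or_nonempty with rfl | hne
  · simp
  obtain ⟨hmin, hmax⟩ := And.intro (A.min'_mem hne) (A.max'_mem hne)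
  obtain ⟨a, ha⟩ : ∃ a, a = A.min' hne := ⟨_, rfl⟩
  obtain ⟨b, hb⟩ : ∃ b, b = A.max' hne := ⟨_, rfl⟩
  have hal : ∀ k ∈ A, a ≤ k := fun k hk => ha ▸ A.min'_le k hk
  have hbl : ∀ k ∈ A, k ≤ b := fun k hk => hb ▸ A.le_max' k hk
  rw [← ha] at hmin
  rw [← hb] at hmax
  rcases (hal b hmax).eq_or_lt with rfl | hab
  · have : A ⊆ {a} := fun k hk => by
      have := hal k hk
      have := hbl k hk
      simp only [Finset.mem_singleton]
      omega
    have := Finset.card_le_card this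
    simp at this
    omega
  obtain ⟨-, -, R, hR1, hR2, hR3, hR4, hR5, hR6⟩ := h a hmin
  obtain ⟨-, -, R', -, -, hR3', -, hR5', -⟩ := h b hmax
  have hmono : ∀ {i j : ℕ} {p : Fin n}, i ≤ j →
      (E.st t (E.upto (E.start i)) p).commit ≠ none →
      (E.st t (E.upto (E.start j)) p).commit ≠ none := fun hij hc =>
    H.commit_mono ht (H.upto_mono (H.start_strictMono.monotone hij)) hc
  -- Here `a` and `b` are the first and the last failing view, with parties `R` and `R'`, and `B`
  -- consists of the failing views strictly between them.
  set B := (A.erase a).erase b with hB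
  have hBA : ∀ k ∈ B, k ∈ A ∧ a < k ∧ k < b := fun k hk => by
    simp only [hB, Finset.mem_erase] at hk
    have := hal k hk.2.2
    have := hbl k hk.2.2
    exact ⟨hk.2.2, by omega, by omega⟩
  have hBcard : (B.image (leader n)).card = B.card :=
    Finset.card_image_of_injOn fun x hx y hy => hA (hBA x hx).1 (hBA y hy).1
  -- The members of `R` have commits after view `a`, whereas the leaders of the later failing views
  -- start without one.
  have hdisj : Disjoint R (B.image (leader n)) := by
    rw [Finset.disjoint_left]
    intro p hp hpB
    obtain ⟨k, hk, rfl⟩ := Finset.mem_image.1 hpB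
    obtain ⟨hkA, hak, -⟩ := hBA k hk
    exact hmono (by omega) (hR4 _ hp) (h k hkA).2.1
  have hsub : R ∪ B.image (leader n) ⊆ R' := by
    intro p hp
    rcases Finset.mem_union.1 hp with hp | hp
    · exact hR5' p (hR1 hp) (hmono (by omega) (hR4 p hp))
    · obtain ⟨k, hk, rfl⟩ := Finset.mem_image.1 hp
      obtain ⟨hkA, -, hkb⟩ := hBA k hk
      obtain ⟨hh, -, Q, hQ⟩ := h k hkA
      exact hR5' _ (mem_honest.2 hh) (hmono (i := k + 1) (by omega) hQ.2.2.2.2.2)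
  have h1 := Finset.card_le_card hsub
  rw [Finset.card_union_of_disjoint hdisj, hBcard] at h1
  -- From `R.card + B.card ≤ R'.card ≤ t` and `t < R.card + f` it follows that `B.card < f`; adding
  -- the two extreme views gives `f + 1`.
  have h2 : B.card = A.card - 1 - 1 := by
    rw [hB, Finset.card_erase_of_mem (by simp [hmax, hab.ne']), Finset.card_erase_of_mem hmin]
  omega

/-- Two views after the first success every party that is not corrupted has a commit, so a further
view of this kind can only be the next one. -/
theorem Admissible.card_succeeds_le {A : Finset ℕ} (h : ∀ k ∈ A, E.gst ≤ E.start k ∧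
    E.Honest (leader n k) ∧ (E.st t (E.upto (E.start k)) (leader n k)).commit = none ∧
    E.Succeeds t k) : A.card ≤ 2 := by
  rcases A.eq_empty_or_nonempty with rfl | hne
  · simp
  have h1 := h _ (A.min'_mem hne)
  have : A ⊆ {A.min' hne, A.min' hne + 1} := by
    intro k hk
    have h2 := A.min'_le k hk
    have h3 : ¬ A.min' hne + 2 ≤ k := fun h3 =>
      H.commit_of_succeeds ht h1.1 h1.2.2.2 h3 ((h k hk).2.1.not_corrupted _) (h k hk).2.2.1
    simp only [Finset.mem_insert, Finset.mem_singleton]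
    omega
  exact (Finset.card_le_card this).trans Finset.card_le_two

omit ht H in
theorem leader_injOn (a : ℕ) : Set.InjOn (leader n) (Finset.Ico a (a + n)) := by
  intro x hx y hy h
  simp only [Finset.coe_Ico, Set.mem_Ico] at hx hy
  have h1 : x % n = y % n := congrArg Fin.val h
  have hx' := Nat.div_add_mod x n
  have hy' := Nat.div_add_mod y n
  by_contra hxy
  have h2 : (n : ℤ) ∣ (x : ℤ) - y := by
    have : (y : ℤ) ≡ x [ZMOD n] := by
      rw [Int.natCast_modEq_iff]
      exact h1.symm
    exact this.dvd
  have h3 : |(x : ℤ) - y| < n := by rw [abs_lt]; omega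
  have := Int.eq_zero_of_abs_lt_dvd h2 h3
  omega

/-- The number of views of a round in which messages are sent. -/
theorem Admissible.card_active_le {a : ℕ} (ha : E.gst ≤ E.start a) {A : Finset ℕ}
    (hA : A ⊆ Finset.Ico (a + 1) (a + 1 + n))
    (h : ∀ k ∈ A, ∃ e, ∃ x ∈ E.sends t e, x.view = k) : A.card ≤ 2 * E.f + 3 := by
  classical
  have hinj : Set.InjOn (leader n) A := (leader_injOn (a + 1)).mono (by exact_mod_cast hA)
  have hgst : ∀ k ∈ A, E.gst ≤ E.start k := fun k hk =>
    H.gst_le_start ha (by have := Finset.mem_Ico.1 (hA hk); omega)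
  set A₁ := A.filter fun k => ¬ E.Honest (leader n k) with hA₁
  set A₂ := A.filter fun k => E.Honest (leader n k) with hA₂
  have hA12 : A₂.card + A₁.card = A.card := Finset.card_filter_add_card_filter_not _
  have h1 : A₁.card ≤ E.f := by
    have hc : (A₁.image (leader n)).card = A₁.card := Finset.card_image_of_injOn
      (hinj.mono (by exact_mod_cast Finset.filter_subset _ _))
    have hs : A₁.image (leader n) ⊆ E.honestᶜ := by
      intro p hp
      obtain ⟨k, hk, rfl⟩ := Finset.mem_image.1 hp
      rw [Finset.mem_compl, mem_honest]
      exact (Finset.mem_filter.1 hk).2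
    have := Finset.card_le_card hs
    rw [hc, Finset.card_compl, Fintype.card_fin] at this
    have := E.card_honest
    omega
  have hnone : ∀ k ∈ A₂, (E.st t (E.upto (E.start k)) (leader n k)).commit = none := by
    intro k hk
    obtain ⟨hk1, hk2⟩ := Finset.mem_filter.1 hk
    obtain ⟨e, x, hx, rfl⟩ := h k hk1
    rcases H.leader_of_sends ht hx (hgst _ hk1) with h | h
    · exact absurd h.2 (hk2.not_corrupted _)
    · exact h.1
  have h2 : (A₂.filter (E.Succeeds t)).card ≤ 2 := by
    refine H.card_succeeds_le ht fun k hk => ?_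
    obtain ⟨hk1, hk2⟩ := Finset.mem_filter.1 hk
    obtain ⟨hk3, hk4⟩ := Finset.mem_filter.1 hk1
    exact ⟨hgst k hk3, hk4, hnone k hk1, hk2⟩
  -- The total is `f` views with faulty leaders, 2 successes and `f + 1` failures.
  have h3 : (A₂.filter fun k => ¬ E.Succeeds t k).card ≤ E.f + 1 := by
    refine H.card_fails_le ht (hinj.mono ?_) fun k hk => ?_
    · exact_mod_cast (Finset.filter_subset _ _).trans (Finset.filter_subset _ _)
    obtain ⟨hk1, hk2⟩ := Finset.mem_filter.1 hk
    obtain ⟨hk3, hk4⟩ := Finset.mem_filter.1 hk1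
    refine ⟨hk4, hnone k hk1, ?_⟩
    have h5 := Finset.mem_Ico.1 (hA hk3)
    obtain ⟨j, rfl⟩ : ∃ j, k = j + 1 := ⟨k - 1, by omega⟩
    exact (H.view_outcome ht (H.gst_le_start ha (by omega)) (hk4.not_corrupted _)
      (hnone _ hk1)).resolve_left hk2
  have h4 := Finset.card_filter_add_card_filter_not (s := A₂) (E.Succeeds t)
  omega

variable {K : ℕ} (hK : E.gst ≤ E.start K)
  (hcommit : ∀ p, p ∉ (E.config t (E.upto (E.start K))).corrupted →
    (E.st t (E.upto (E.start K)) p).commit ≠ none)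
include hK hcommit

theorem Admissible.commit_of_acts {i : ℕ} {p : Fin n} {o : Option (Packet n)}
    (h : E.Acts t i p o) (hi : K ≤ E.view i p) : (E.st t i p).commit ≠ none := by
  have h1 : E.upto (E.start K) ≤ i := by
    by_contra h1
    have := H.lt_upto.1 (not_le.1 h1)
    have := H.start_le_time hK hi
    linarith
  exact H.commit_mono ht h1 (hcommit p fun h2 => h.1 (corrupted_mono h1 h2))

theorem Admissible.acts_settled {i : ℕ} {p : Fin n} {o : Option (Packet n)}
    (h : E.Acts t i p o) (hi : K ≤ E.view i p) (F : Finset (Fin n))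
    (hs : ∀ k, (E.st t i p).view = some k → K ≤ k → Settled (E.st t i p)) :
    (∀ k, (E.st t (i + 1) p).view = some k → K ≤ k → Settled (E.st t (i + 1) p)) ∧
    (E.sends t i).countP (fun x => x.dst ∈ F) + ((E.st t i p).commitSentTo ∩ F).card ≤
      ((E.st t (i + 1) p).commitSentTo ∩ F).card := by
  have hc := H.commit_of_acts ht hK hcommit h hi
  have key := H.acts_ind ht h (P := fun s l => s.commit ≠ none ∧
    (∀ k, s.view = some k → K ≤ k → Settled s) ∧
    l.countP (fun x => x.dst ∈ F) + ((E.st t i p).commitSentTo ∩ F).card ≤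
      (s.commitSentTo ∩ F).card) ⟨hc, hs, by simp⟩ ?_
  · exact key.2
  rintro s l s' l' ⟨h1, h2, h3⟩ hm
  obtain ⟨h4, h5⟩ := hm.settled F h1 fun j hj hji => h2 j hj (hji ▸ hi)
  refine ⟨h4.1, fun _ _ _ => h4, ?_⟩
  rw [List.countP_append]
  omega

/-- The potential is the number of members of `F` in `commitSentTo`: from view `K` on each message
to `F` increases it, and it never exceeds `F.card`. This is how suggesting a commit only once per
leader enters the count. -/
theorem Admissible.sum_countP_late_le (F : Finset (Fin n)) (p : Fin n) (N : ℕ) :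
    ∑ i ∈ Finset.range N,
      (E.sends t i).countP (fun x => x.src = p ∧ K ≤ x.view ∧ x.dst ∈ F) ≤ F.card := by
  suffices h : (∀ k, (E.st t N p).view = some k → K ≤ k → Settled (E.st t N p)) ∧
      ∑ i ∈ Finset.range N,
        (E.sends t i).countP (fun x => x.src = p ∧ K ≤ x.view ∧ x.dst ∈ F) ≤
        ((E.st t N p).commitSentTo ∩ F).card from
    h.2.trans (Finset.card_le_card Finset.inter_subset_right)
  induction N with
  | zero => simp [st, config, Config.start, State.start]
  | succ N ih =>
    rw [Finset.sum_range_succ]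
    have h0 : ¬ (∃ o, E.Acts t N p o ∧ K ≤ E.view N p) →
        (E.sends t N).countP (fun x => x.src = p ∧ K ≤ x.view ∧ x.dst ∈ F) = 0 := by
      intro h
      rw [List.countP_eq_zero]
      intro x hx
      obtain ⟨o, ho, -, hv⟩ := H.sends_acts ht hx
      simp only [decide_eq_true_eq]
      rintro ⟨rfl, h1, -⟩
      exact h ⟨o, ho, by omega⟩
    by_cases ha : ∃ o, E.Acts t N p o
    · obtain ⟨o, ho⟩ := ha
      by_cases hv : K ≤ E.view N p
      · obtain ⟨h1, h2⟩ := H.acts_settled ht hK hcommit ho hv F ih.1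
        refine ⟨h1, ?_⟩
        have h3 : (E.sends t N).countP (fun x => x.src = p ∧ K ≤ x.view ∧ x.dst ∈ F) ≤
            (E.sends t N).countP (fun x => x.dst ∈ F) :=
          List.countP_mono_left fun x _ hx => by simp_all
        omega
      · rw [h0 fun ⟨_, _, h⟩ => hv h]
        -- In a view before `K` nothing that counts is sent, and `commitSentTo` can only grow.
        refine ⟨fun k hk hKk => ?_, ?_⟩
        · rw [H.acts_view ht ho] at hk
          cases hk
          exact absurd hKk hv
        · refine ih.2.trans (Finset.card_le_card (Finset.inter_subset_inter_right ?_))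
          refine H.acts_ind ht ho
            (P := fun s _ => (E.st t N p).commitSentTo ⊆ s.commitSentTo) subset_rfl ?_
          intro s l s' l' h hm
          cases hm with
          | requestCommit => exact h.trans (Finset.subset_insert _ _)
          | _ => exact h
    · rw [h0 fun ⟨o, ho, _⟩ => ha ⟨o, ho⟩]
      push Not at ha
      rw [st_succ_of_not_acts ha]
      exact ih

/-- Once all parties have commits, messages are only sent to corrupted leaders. -/
theorem Admissible.dst_of_late {e : ℕ} {x : Packet n} (hx : x ∈ E.sends t e) (hv : K ≤ x.view) :
    x.dst ∉ E.honest := by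
  rw [mem_honest]
  have hle : E.upto (E.start K) ≤ E.upto (E.start x.view) :=
    H.upto_mono (H.start_strictMono.monotone hv)
  have hdst : x.msg.isReply = true → x.dst = leader n x.view := by
    intro hm
    have hs := (H.inv ht (e + 1) x.src).1.wf.shape x (sent_of_sends hx (Nat.lt_succ_self e)) rfl
    obtain ⟨p, q, k, m⟩ := x
    cases m <;> simp only [Msg.isReply, reduceCtorEq] at hm <;> exact hs.1
  have hcor : (E.st t (E.upto (E.start x.view)) (leader n x.view)).commit = none →
      leader n x.view ∈ (E.config t (E.upto (E.start K))).corrupted := by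
    intro h1
    by_contra h2
    exact H.commit_mono ht hle (hcommit _ h2) h1
  intro hh
  rcases H.leader_of_sends ht hx (H.gst_le_start hK hv) with ⟨h1, h2⟩ | ⟨h1, h2 | h2⟩
  · exact (hdst h1 ▸ hh).not_corrupted _ h2
  · exact (hdst h2 ▸ hh).not_corrupted _ (hcor h1)
  -- A leader that starts such a view without a commit was corrupted before view `K`, so as an
  -- uncorrupted sender it cannot occur.
  · obtain ⟨o, ho, -, hxv⟩ := H.sends_acts ht hx
    refine ho.1 (corrupted_mono ?_ (h2 ▸ hcor h1))
    by_contra h3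
    have := H.lt_upto.1 (not_le.1 h3)
    have := H.start_le_time hK (hv.trans_eq hxv)
    linarith

end Messages

/-! ### The total number of messages -/

section Total

variable {n : ℕ} [NeZero n] {E : Execution n} {t : ℕ}

theorem Admissible.messagesAfterGST_le (H : E.Admissible t) (ht : 3 * t < n) :
    E.messagesAfterGST t ≤ ((54 * (n + n * E.f) : ℕ) : ℕ∞) := by
  classical
  obtain ⟨a, ha, hmin⟩ : ∃ a, E.gst ≤ E.start a ∧ ∀ j < a, ¬ E.gst ≤ E.start j :=
    ⟨Nat.find H.exists_start, Nat.find_spec H.exists_start, fun _ => Nat.find_min _⟩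
  -- Everybody leads once in the `n` views from `a + 1` on, and the leader of the last of them, `a +
  -- n`, has its commit when view `a + n + 2` starts.
  set K := a + n + 2 with hKdef
  have hK : E.gst ≤ E.start K := H.gst_le_start ha (by omega)
  have hcommit : ∀ p, p ∉ (E.config t (E.upto (E.start K))).corrupted →
      (E.st t (E.upto (E.start K)) p).commit ≠ none :=
    fun p hp => H.all_commit ht ha le_rfl hp
  set A := (Finset.range K).filter fun k => a ≤ k + 1 ∧ ∃ e, ∃ x ∈ E.sends t e, x.view = k with hA
  have hAcard : A.card ≤ 2 * E.f + 6 := by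
    -- Three views lie outside the round: `a - 1`, which may be in progress at GST, `a`, whose
    -- predecessor need not start after GST, and `a + n + 1`, the last one before `K`.
    have h1 : A ⊆ {a - 1, a, a + n + 1} ∪ A ∩ Finset.Ico (a + 1) (a + 1 + n) := by
      intro k hk
      have h2 := Finset.mem_filter.1 hk
      have h3 := Finset.mem_range.1 h2.1
      simp only [Finset.mem_union, Finset.mem_insert, Finset.mem_singleton, Finset.mem_inter, hk,
        Finset.mem_Ico, true_and]
      omega
    have h2 := H.card_active_le ht ha (A := A ∩ Finset.Ico (a + 1) (a + 1 + n))
      Finset.inter_subset_right fun k hk =>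
        (Finset.mem_filter.1 (Finset.mem_inter.1 hk).1).2.2
    have h3 := (Finset.card_le_card h1).trans (Finset.card_union_le _ _)
    have h4 : ({a - 1, a, a + n + 1} : Finset ℕ).card ≤ 3 := Finset.card_le_three
    omega
  -- The messages are classified by sender and by either an active view (`some k`) or lateness
  -- (`none`); the late ones go to faulty parties only.
  set P : Fin n × Option ℕ → Packet n → Prop := fun j x => x.src = j.1 ∧
    j.2.elim (K ≤ x.view ∧ x.dst ∈ E.honestᶜ) fun k => x.view = k with hP
  have hstep : ∀ i, (if E.gst ≤ E.time i then (E.sends t i).length else 0) ≤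
      ∑ j ∈ Finset.univ ×ˢ Finset.insertNone A, (E.sends t i).countP (P j ·) := by
    intro i
    split_ifs with hi
    · refine countP_le_sum _ P _ fun x hx => ?_
      by_cases hx1 : K ≤ x.view
      · exact ⟨(x.src, none), by simp, rfl, hx1,
          Finset.mem_compl.2 (H.dst_of_late ht hK hcommit hx hx1)⟩
      · refine ⟨(x.src, some x.view), ?_, rfl, rfl⟩
        obtain ⟨-, -, -, hv⟩ := H.sends_acts ht hx
        simp only [Finset.mem_product, Finset.mem_univ, Finset.some_mem_insertNone, true_and, hA,
          Finset.mem_filter, Finset.mem_range]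
        exact ⟨by omega, hv ▸ H.le_view hmin hi x.src, i, x, hx, rfl⟩
    · exact Nat.zero_le _
  have hlate : ∀ N p, ∑ i ∈ Finset.range N, (E.sends t i).countP (P (p, none) ·) ≤ E.f := by
    intro N p
    have h1 := H.sum_countP_late_le ht hK hcommit E.honestᶜ p N
    have h2 : E.honestᶜ.card = E.f := by
      have := E.card_honest
      rw [Finset.card_compl, Fintype.card_fin]
      omega
    rw [h2] at h1
    refine le_trans (le_of_eq (Finset.sum_congr rfl fun i _ => ?_)) h1
    exact List.countP_congr fun x _ => by simp [hP]
  have hview : ∀ N p k, ∑ i ∈ Finset.range N, (E.sends t i).countP (P (p, some k) ·) ≤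
      quota p k := by
    intro N p k
    refine le_trans (le_of_eq (Finset.sum_congr rfl fun i _ => ?_)) (H.sum_countP_view_le ht p k N)
    exact List.countP_congr fun x _ => by simp [hP]
  unfold messagesAfterGST
  refine iSup_le fun N => Nat.cast_le.2 ?_
  calc _ ≤ ∑ i ∈ Finset.range N,
        ∑ j ∈ Finset.univ ×ˢ Finset.insertNone A, (E.sends t i).countP (P j ·) :=
        Finset.sum_le_sum fun i _ => by convert hstep i
    _ = ∑ p : Fin n, (∑ i ∈ Finset.range N, (E.sends t i).countP (P (p, none) ·) +
          ∑ k ∈ A, ∑ i ∈ Finset.range N, (E.sends t i).countP (P (p, some k) ·)) := by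
        rw [Finset.sum_comm, Finset.sum_product]
        exact Finset.sum_congr rfl fun p _ => Finset.sum_insertNone _ _
    _ ≤ ∑ p : Fin n, (E.f + ∑ k ∈ A, quota p k) :=
        Finset.sum_le_sum fun p _ => Nat.add_le_add (hlate N p)
          (Finset.sum_le_sum fun k _ => hview N p k)
    _ = n * E.f + A.card * (9 * n) := by
        rw [Finset.sum_add_distrib, Finset.sum_comm]
        simp [sum_quota]
    _ ≤ n * E.f + (2 * E.f + 6) * (9 * n) := by gcongr
    -- The left-hand side equals `54 * n + 19 * (n * f)`, so the constant comes from six views of `9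
    -- * n` messages each.
    _ ≤ 54 * (n + n * E.f) := by nlinarith [Nat.zero_le (n * E.f)]

end Total

end Execution

end GSTAgreement

theorem mainTheorem5 :
    ∃ C : ℕ, ∀ (n t : ℕ) [NeZero n], 3 * t < n →
      ∀ E : GSTAgreement.Execution n, E.Admissible t →
        E.Agreement t ∧ E.StrongUnanimity t ∧ E.Termination t ∧
        E.messagesAfterGST t ≤ ((C * (n + n * E.f) : ℕ) : ℕ∞) :=
  ⟨54, fun _ _ _ ht _ H =>
    ⟨H.agreement ht, H.strongUnanimity ht, H.termination ht, H.messagesAfterGST_le ht⟩⟩
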